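/- **Model.** Let $V$ be a finite set of $n\ge 1$ nodes with a distinguished node $l$ (the leader). A 1-interval connected dynamic network on $V$ is a sequence of connected simple graphs $G(1),G(2),\dots$ on $V$, where moreover in each round $r$ every node $u$ has an arbitrary labelling of its $d_u(r)$ incident edges by distinct local labels $1,\dots,d_u(r)$; graphs and labels may change arbitrarily from round to round. A protocol is a deterministic synchronous algorithm with one-to-each transmission: in round $r$ each node knows its state, $r$ and $d_u(r)$, sends a (possibly different) message over each of its edges, receives the messages sent by its neighbours together with its own labels of the edges on which they arrive, and updates its state. All nodes other than $l$ start in one common state, $l$ starts in a special state, and nodes know nothing else about the network (in particular not $n$). A node that terminates outputs a natural number and sends nothing any more. The size of a message is its length in bits (in a fixed self-delimiting binary code). **Protocol Individual_Conversations.** Every node keeps an id ($\bot$ at first, $0$ for the leader) and the conversation message with the largest timestamp that it knows, and sends both over all its edges in every round. An *unfrozen* node with id $j$ that knows the number $d$ of consecutive ids $0,\dots,d-1$ in use also offers, over its edges, pairwise distinct ids of the form $k\cdot d+j$, $k\ge 1$ (the smallest ones that it has not yet possibly assigned in the current cycle); it records an offered id as possibly assigned if the neighbour sent $\bot$ in that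 round. A node with id $\bot$ that gets offers adopts the smallest one and stores the others in its list of rejected ids; it stays frozen for the time being. The leader holds one conversation at a time: it sends a request addressed to an id, stamped with the current round; all nodes forward the message with the largest timestamp; the addressed node replies with a newly stamped report, and only then does the leader issue its next request. In round 1 the leader assigns $1,\dots,d_l(1)$ to its neighbours and sets $d=1+d_l(1)$. Then it repeats the following cycle. 1. It unfreezes itself and then the nodes $1,\dots,d-1$ one after the other, telling them $d$ (a node clears its lists when it is unfrozen); then there is one round in which all these $d$ nodes are unfrozen. 2. It freezes itself and then the nodes $1,\dots,d-1$ one after the other, asking each for its possibly assigned ids, one id per report. 3. If no id was possibly assigned, it announces $\mathrm{halt}(d)$; this is flooded, and if it has timestamp $t$, then at the end of round $t+d-1$ every node that knows it terminates and outputs its id. 4. Otherwise it goes through the collected ids in increasing order, sending for each id $x$ a request that contains the current value of $d$: if a node has id $x$, it changes its id to $d$ and says so, and the leader increases $d$ by $1$; otherwise the node that has $x$ in its list of rejected ids reports this. **Theorem.** Protocol Individual_Conversations solves minimal (consecutive) naming in anonymous unknown dynamic networks with one-to-each transmission and a unique leader, in $O(n^3)$ rounds with messages of size $\Theta(\log n)$.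 That is, there are $T\in\mathbb N$ and real constants $c,C>0$ such that for every $n\ge1$, every 1-interval connected dynamic network on $n$ nodes, all edge labellings and every choice of the leader, in the execution of the protocol * within $T n^3$ rounds all nodes have terminated, and their outputs are pairwise distinct and are exactly $0,1,\dots,n-1$; * every message that is sent has at most $C\log n$ bits, and, if $n\ge 2$, some message that is sent has at least $c\log n$ bits. -/

import Mathlib

universe u

/-! ## Dynamic networks with locally labelled edges -/

/-- A dynamic network on the node set `V`: for every round `r ≥ 1` an instantaneous graph,
and at every node `x` a labelling of the edges incident to `x` in that round by the local labels
`0, …, deg r x - 1`. Graphs and labellings are unrestricted from round to round: the network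
is chosen by an adversary. (Index `0` is not used.) -/
structure DynamicNetwork (V : Type u) where
  /-- the instantaneous graph of round `r` -/
  graph : ℕ → SimpleGraph V
  /-- the degree of a node in round `r` (forced by `port` to be the number of neighbours) -/
  deg : ℕ → V → ℕ
  /-- `port r x i` is the neighbour of `x` at the other end of the edge that `x` labels `i` -/
  port : (r : ℕ) → (x : V) → Fin (deg r x) ≃ (graph r).neighborSet x

namespace DynamicNetwork

variable {V : Type u}

/-- Every instantaneous graph is connected. -/
def OneIntervalConnected (N : DynamicNetwork V) : Prop :=
  ∀ r, 1 ≤ r → (N.graph r).Connected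

/-- The local label that the neighbour at the end of edge `i` of `x` gives to that same edge. -/
def backPort (N : DynamicNetwork V) (r : ℕ) (x : V) (i : Fin (N.deg r x)) :
    Fin (N.deg r (N.port r x i : V)) :=
  (N.port r (N.port r x i : V)).symm ⟨x, (N.port r x i).2.symm⟩

end DynamicNetwork

/-! ## Deterministic one-to-each protocols with a leader -/

/-- A deterministic protocol for anonymous nodes with one-to-each transmission. In round `r` a node
in state `s` that is told that it has `d` incident edges sends the message `send r s d i` over its
edge `i`, and then moves to the state `receive r s d inbox`, where `inbox i` is what arrives over
edge `i` (`none` if the neighbour has terminated). A node has terminated as soon as `output` of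
its state is defined. Messages are transmitted as bit strings, through an injective encoding. -/
structure Protocol where
  State : Type
  Msg : Type
  /-- the initial state of the leader -/
  leaderInit : State
  /-- the common initial state of all the other nodes -/
  otherInit : State
  send : ℕ → State → (d : ℕ) → Fin d → Msg
  receive : ℕ → State → (d : ℕ) → (Fin d → Option Msg) → State
  output : State → Option ℕ
  encode : Msg → List Bool
  encode_injective : Function.Injective encode

namespace Protocol

variable (P : Protocol) {V : Type u} (N : DynamicNetwork V)

/-- What a node `x` transmits over its edge `i` in round `r`, if the states at the beginning of the
round are `c`. Terminated nodes transmit nothing. -/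
def sent (r : ℕ) (c : V → P.State) (x : V) (i : Fin (N.deg r x)) : Option P.Msg :=
  if (P.output (c x)).isSome then none else some (P.send r (c x) (N.deg r x) i)

/-- What node `x` gets over its edge `i` in round `r`. -/
def inbox (r : ℕ) (c : V → P.State) (x : V) (i : Fin (N.deg r x)) : Option P.Msg :=
  P.sent N r c (N.port r x i) (N.backPort r x i)

/-- One synchronous round. Terminated nodes never change again. -/
def round (r : ℕ) (c : V → P.State) (x : V) : P.State :=
  if (P.output (c x)).isSome then c x
  else P.receive r (c x) (N.deg r x) (P.inbox N r c x)

/-- The states of all nodes after `r` rounds (the rounds are numbered `1, 2, …`), in the execution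
on the network `N` with leader `l`. -/
def config [DecidableEq V] (l : V) : ℕ → V → P.State
  | 0, x => if x = l then P.leaderInit else P.otherInit
  | r + 1, x => P.round N (r + 1) (config l r) x

end Protocol

/-- The labels `id x` are distinct and are exactly `0, 1, …, n - 1`, where `n` is the number
of nodes. -/
def IsMinimalNaming {V : Type u} [Fintype V] (id : V → ℕ) : Prop :=
  Function.Injective id ∧ Set.range id = {k | k < Fintype.card V}

/-! ## The protocol `Individual_Conversations` -/

namespace IndividualConversations

/-- The contents of the messages of a conversation. The first three are the requests of the leader
to the node with a given id, the next four the replies (reports) to such requests. -/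
inductive Body where
  /-- request to node `id`: start assigning ids, there are `d` consecutive ids at present -/
  | unfreeze (id d : ℕ)
  /-- request to node `id`: stop assigning ids, and report one possibly assigned id -/
  | collect (id : ℕ)
  /-- request to the node that has been offered `id`: if you adopted it, change it to `new` -/
  | seek (id new : ℕ)
  /-- reply to `unfreeze` -/
  | unfrozen (id : ℕ)
  /-- reply to `collect`: a possibly assigned id, or `none` if there are no more -/
  | collected (id : ℕ) (x : Option ℕ)
  /-- reply to `seek`: `id` was my id and has now been changed -/
  | adopted (id : ℕ)
  /-- reply to `seek`: `id` is one of the ids I rejected -/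
  | rejected (id : ℕ)
  /-- announcement of the leader: all `n` nodes have consecutive ids -/
  | halt (n : ℕ)

/-- A conversation message together with the round in which it was first sent. -/
structure Packet where
  stamp : ℕ
  body : Body

/-- What is sent over one edge in one round: the id of the sender (if it has one), an offer of an
id to the receiver (if the sender is currently assigning ids), and the latest conversation
message known to the sender. -/
structure Msg where
  name : Option ℕ
  offer : Option ℕ
  pkt : Option Packet

/-- The stage in which the leader is. -/
inductive Phase where
  /-- first round: the leader names its neighbours -/
  | start
  /-- waiting for the node with the given id to confirm that it is unfrozen -/
  | unfreezing (id : ℕ)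
  /-- one round in which all nodes with consecutive ids are assigning -/
  | common
  /-- waiting for a report of the node with the given id about its assignments -/
  | collecting (id : ℕ)
  /-- waiting for a reply of the node that was offered the given id -/
  | seeking (id : ℕ)
  /-- termination has been announced -/
  | stopped

/-- The additional variables of the leader. -/
structure Ctrl where
  phase : Phase
  /-- the number of consecutive ids in use -/
  count : ℕ
  /-- the possibly assigned ids of the current cycle that are known and not yet dealt with -/
  pool : Finset ℕ

/-- The state of a node. -/
structure Node where
  /-- the current id; `none` stands for the absence of an id -/
  name : Option ℕ
  /-- `some d` if the node is unfrozen, i.e. assigning ids, with `d` consecutive ids in use -/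
  active : Option ℕ
  /-- the ids that this node possibly assigned in this cycle and has not yet reported -/
  given : Finset ℕ
  /-- the ids that this node was offered and did not adopt -/
  rejected : Finset ℕ
  /-- the conversation message with the largest timestamp so far -/
  pkt : Option Packet
  /-- the additional variables of the leader; `none` for all the other nodes -/
  ctrl : Option Ctrl
  /-- the final output -/
  out : Option ℕ

/-- The `i`-th smallest (counted from `0`) of the ids `k * d + j`, `k ≥ 1`, outside the set `given`,
correct for `i < m`. -/
def freshId (j d : ℕ) (given : Finset ℕ) (m i : ℕ) : ℕ :=
  (((List.range' 1 (given.card + m)).map fun k => k * d + j).filter (· ∉ given)).getD i 0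

/-- The id that a node offers over its edge `i` if it has `m` edges. -/
def offer (s : Node) (m i : ℕ) : Option ℕ :=
  match s.name, s.active with
  | some j, some d => some (freshId j d s.given m i)
  | _, _ => none

def send (_r : ℕ) (s : Node) (m : ℕ) (i : Fin m) : Msg :=
  ⟨s.name, offer s m i, s.pkt⟩

/-- The later of two conversation messages (the first one if they have the same timestamp). -/
def later : Option Packet → Option Packet → Option Packet
  | none, q => q
  | some p, none => some p
  | some p, some q => if p.stamp < q.stamp then some q else some p

/-- Bookkeeping of an assigning node: an id offered over an edge was possibly assigned iff
the neighbour on that edge had no id. -/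
def recordGiven (s : Node) (m : ℕ) (inbox : Fin m → Option Msg) : Finset ℕ :=
  s.given ∪ Finset.univ.biUnion fun i : Fin m =>
    match inbox i with
    | some ⟨none, _, _⟩ => (offer s m i).toFinset
    | _ => ∅

/-- All ids that are offered to a node in a round. -/
def offered {m : ℕ} (inbox : Fin m → Option Msg) : Finset ℕ :=
  Finset.univ.biUnion fun i : Fin m => ((inbox i).bind Msg.offer).toFinset

/-- The latest conversation message among those received and the own one. -/
def latest (s : Node) {m : ℕ} (inbox : Fin m → Option Msg) : Option Packet :=
  (List.finRange m).foldl (fun p i => later p ((inbox i).bind Msg.pkt)) s.pkt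

/-- Processing of the received messages that is common to all nodes: an assigning node records the
possibly assigned ids, a node without an id adopts the smallest id that it is offered (if any)
and remembers the others as rejected, and the latest conversation message is kept. -/
def absorb (s : Node) {m : ℕ} (inbox : Fin m → Option Msg) : Node :=
  let s' : Node := { s with given := recordGiven s m inbox, pkt := latest s inbox }
  match s.name, (offered inbox).min with
  | none, some x => { s' with name := some x, rejected := (offered inbox).erase x }
  | _, _ => s'

/-- The reaction of a node other than the leader to the latest conversation message, where `t` is
the number of the next round: if it is a request to this node, then the node obeys and
replaces it by its report. -/
def respond (t : ℕ) (s : Node) : Node :=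
  match s.pkt with
  | some ⟨_, .unfreeze id d⟩ =>
      if s.name = some id then
        { s with active := some d, given := ∅, rejected := ∅, pkt := some ⟨t, .unfrozen id⟩ }
      else s
  | some ⟨_, .collect id⟩ =>
      if s.name = some id then
        match s.given.min with
        | some x => { s with active := none, given := s.given.erase x,
                             pkt := some ⟨t, .collected id (some x)⟩ }
        | none => { s with active := none, pkt := some ⟨t, .collected id none⟩ }
      else s
  | some ⟨_, .seek id new⟩ =>
      if s.name = some id then
        { s with name := some new, pkt := some ⟨t, .adopted id⟩ }
      else if id ∈ s.rejected then
        { s with pkt := some ⟨t, .rejected id⟩ }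
      else s
  | _ => s

/-- The leader continues with unfreezing node `j`; if all nodes with consecutive ids are unfrozen,
then there follows one round in which all of them assign. -/
def goUnfreeze (t : ℕ) (s : Node) (c : Ctrl) (j : ℕ) : Node :=
  if j < c.count then
    { s with pkt := some ⟨t, .unfreeze j c.count⟩, ctrl := some { c with phase := .unfreezing j } }
  else { s with ctrl := some { c with phase := .common } }

/-- The leader starts a new cycle: it unfreezes itself and then the other nodes one by one. -/
def newCycle (t : ℕ) (s : Node) (c : Ctrl) : Node :=
  goUnfreeze t { s with active := some c.count, given := ∅ } c 1

/-- The leader continues with the smallest of the possibly assigned ids; if there are no more,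
then the next cycle begins. -/
def goSeek (t : ℕ) (s : Node) (c : Ctrl) : Node :=
  match c.pool.min with
  | some x =>
    { s with pkt := some ⟨t, .seek x c.count⟩, ctrl := some { c with phase := .seeking x } }
  | none => newCycle t s c

/-- The leader continues with freezing node `j` and asking for its assignments; if all nodes have
reported, then it announces termination if there were no assignments at all, and otherwise
it reassigns consecutive ids. -/
def goCollect (t : ℕ) (s : Node) (c : Ctrl) (j : ℕ) : Node :=
  if j < c.count then
    { s with pkt := some ⟨t, .collect j⟩, ctrl := some { c with phase := .collecting j } }
  else if c.pool = ∅ then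
    { s with pkt := some ⟨t, .halt c.count⟩, ctrl := some { c with phase := .stopped } }
  else goSeek t s c

/-- The reaction of the leader, where `t` is the number of the next round. -/
def lead (t : ℕ) (s : Node) (c : Ctrl) : Node :=
  match c.phase with
  | .start => newCycle t s { c with count := 1 + s.given.card }
  | .unfreezing j =>
      match s.pkt with
      | some ⟨_, .unfrozen id⟩ => if id = j then goUnfreeze t s c (j + 1) else s
      | _ => s
  | .common => goCollect t { s with active := none, given := ∅ } { c with pool := s.given } 1
  | .collecting j =>
      match s.pkt with
      | some ⟨_, .collected id (some x)⟩ =>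
          if id = j then goCollect t s { c with pool := insert x c.pool } j else s
      | some ⟨_, .collected id none⟩ => if id = j then goCollect t s c (j + 1) else s
      | _ => s
  | .seeking x =>
      match s.pkt with
      | some ⟨_, .adopted id⟩ =>
          if id = x then goSeek t s { c with count := c.count + 1, pool := c.pool.erase x } else s
      | some ⟨_, .rejected id⟩ =>
          if id = x then goSeek t s { c with pool := c.pool.erase x } else s
      | _ => s
  | .stopped => s

/-- An announcement of termination with timestamp `b` and contents `n` takes effect at the end of
round `b + n - 1`: the node terminates with its id as output. Here `t` is the number of the
next round. -/
def finish (t : ℕ) (s : Node) : Node :=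
  match s.pkt with
  | some ⟨b, .halt n⟩ => if b + n ≤ t then { s with out := s.name } else s
  | _ => s

def receive (r : ℕ) (s : Node) (m : ℕ) (inbox : Fin m → Option Msg) : Node :=
  let s' := absorb s inbox
  finish (r + 1) <|
    match s'.ctrl with
    | none => respond (r + 1) s'
    | some c => lead (r + 1) s' c

/-- The leader initially has id `0` and the single consecutive id `0` is in use. -/
def leaderInit : Node :=
  ⟨some 0, some 1, ∅, ∅, none, some ⟨.start, 1, ∅⟩, none⟩

def otherInit : Node :=
  ⟨none, none, ∅, ∅, none, none, none⟩

/-! ### Binary encoding of the messages -/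

/-- Self-delimiting form of a bit string. -/
def encBits : List Bool → List Bool
  | [] => [false]
  | b :: l => true :: b :: encBits l

/-- Self-delimiting binary code of a natural number. -/
def encNat (x : ℕ) : List Bool := encBits (Nat.bits x)

def encOption {α : Type} (f : α → List Bool) : Option α → List Bool
  | none => [false]
  | some a => true :: f a

/-- A conversation message is encoded by a three-bit tag followed by its entries. -/
def encBody : Body → List Bool
  | .unfreeze id d => false :: false :: false :: (encNat id ++ encNat d)
  | .collect id => false :: false :: true :: encNat id
  | .seek id new => false :: true :: false :: (encNat id ++ encNat new)
  | .unfrozen id => false :: true :: true :: encNat id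
  | .collected id x => true :: false :: false :: (encNat id ++ encOption encNat x)
  | .adopted id => true :: false :: true :: encNat id
  | .rejected id => true :: true :: false :: encNat id
  | .halt n => true :: true :: true :: encNat n

def encPacket (p : Packet) : List Bool := encNat p.stamp ++ encBody p.body

def encode (m : Msg) : List Bool :=
  encOption encNat m.name ++ (encOption encNat m.offer ++ encOption encPacket m.pkt)

def PrefixFree {α : Type} (f : α → List Bool) : Prop :=
  ∀ a b l l', f a ++ l = f b ++ l' → a = b ∧ l = l'

theorem encBits_prefixFree : PrefixFree encBits := by
  intro a
  induction a with
  | nil => intro b l l' h; cases b <;> simp_all [encBits]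
  | cons x a ih =>
    intro b l l' h
    cases b with
    | nil => simp [encBits] at h
    | cons y b =>
      simp only [encBits, List.cons_append, List.cons.injEq, true_and] at h
      have := ih b l l' h.2
      simp [h.1, this]

theorem bits_injective : Function.Injective Nat.bits := by
  intro a b h
  apply Nat.digits.injective 2
  simp [Nat.digits_two_eq_bits, h]

theorem encNat_prefixFree : PrefixFree encNat := fun a b l l' h => by
  have := encBits_prefixFree _ _ _ _ h
  exact ⟨bits_injective this.1, this.2⟩

theorem encOption_prefixFree {α : Type} {f : α → List Bool} (hf : PrefixFree f) :
    PrefixFree (encOption f) := by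
  intro a b l l' h
  cases a <;> cases b <;> simp [encOption] at h ⊢
  · exact h
  · exact hf _ _ _ _ h

theorem encBody_prefixFree : PrefixFree encBody := by
  have h1 := encNat_prefixFree
  have h2 := encOption_prefixFree encNat_prefixFree
  intro a b l l' h
  cases a <;> cases b <;> simp [encBody] at h ⊢
  all_goals first
    | exact h1 _ _ _ _ h
    | (have h3 := h1 _ _ _ _ h
       first
         | (have h4 := h1 _ _ _ _ h3.2; exact ⟨⟨h3.1, h4.1⟩, h4.2⟩)
         | (have h4 := h2 _ _ _ _ h3.2; exact ⟨⟨h3.1, h4.1⟩, h4.2⟩))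

theorem encPacket_prefixFree : PrefixFree encPacket := by
  rintro ⟨s, b⟩ ⟨s', b'⟩ l l' h
  simp only [encPacket, List.append_assoc] at h
  have h1 := encNat_prefixFree _ _ _ _ h
  have h2 := encBody_prefixFree _ _ _ _ h1.2
  simp [h1.1, h2]

theorem encode_injective : Function.Injective encode := by
  rintro ⟨a, b, p⟩ ⟨a', b', p'⟩ h
  have h0 : encode ⟨a, b, p⟩ ++ [] = encode ⟨a', b', p'⟩ ++ [] := by rw [h]
  simp only [encode, List.append_assoc] at h0
  have h1 := encOption_prefixFree encNat_prefixFree _ _ _ _ h0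
  have h2 := encOption_prefixFree encNat_prefixFree _ _ _ _ h1.2
  have h3 := encOption_prefixFree encPacket_prefixFree _ _ _ _ h2.2
  simp [h1.1, h2.1, h3.1]

end IndividualConversations

/-- The protocol `Individual_Conversations`. -/
def Individual_Conversations : Protocol where
  State := IndividualConversations.Node
  Msg := IndividualConversations.Msg
  leaderInit := IndividualConversations.leaderInit
  otherInit := IndividualConversations.otherInit
  send := IndividualConversations.send
  receive := IndividualConversations.receive
  output := IndividualConversations.Node.out
  encode := IndividualConversations.encode
  encode_injective := IndividualConversations.encode_injective

namespace IndividualConversations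

/-! ### Fresh ids -/

/-! Write n for the number of nodes. Call the creation of a message, and the passage of the leader
into the common round, an event. Between two events the latest message only spreads. The graph of
each round is connected, so at least one more node gets the message as long as some node lacks it
(`holders_absorbed`). Hence events are at most about n rounds apart, and it is enough to bound their
number by O(n²). `Running` says this with a potential: r + n·h + n ≤ B + (number of holders), where
h bounds the events to come. A round of pure forwarding raises the number of holders, and an event
lowers h (`Running.next`).

Number of events. A cycle with d ids at its start spends about 4d events on unfreezing and freezing.
Unless it is the last one, it raises the count of ids, so a reserve of 4n(n - d) pays for all later
cycles. A possibly assigned id costs at most two events to be collected and two to be sought. Over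
the whole execution there are at most n² such ids: an id is recorded only when it is offered to a
nameless node, that node gets an id in the same round, and each of the n nodes offers it only one
id. Thus `credit` never increases, and every reported id lowers it.

Conversations. Old requests keep circulating and ids are used again in later cycles, so it has to be
excluded that a stale request is obeyed. The invariant is that a node addressed by a circulating
message other than the latest one already knows a strictly newer message (the field `outdated` of
`Conversation`). Forwarding could break it only for a node that has just got an id. Such a node has
an unfrozen neighbour, from which it learns a timestamp of the present cycle, while the requests of
the present cycle have so far concerned only ids below d (`Naming.stable`).

Naming. An offered id is congruent modulo d to the id of the node that offers it, so two nodes never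
offer the same id, and `freshId` keeps one node from repeating a recorded id. Therefore the recorded
ids are exactly the ids held, as name or as rejected offer, by nodes with id at least d, and each
has exactly one holder. So every id that is sought has exactly one node to answer for it, and the
increasing order keeps the next consecutive id free (`Renaming.rename`). If a nameless node exists
in the common round, some edge joins a named node to a nameless one. Then either an offer is
recorded there, or the named end itself holds an id issued in this cycle
(`Naming.exists_issued_absorbed`). Hence a cycle without recorded ids certifies d = n
(`Naming.complete`). The announcement then floods the network before it takes effect, so all nodes
stop in the same round.

Size. Ids are at most 3n² and timestamps are O(n³), so messages have O(log n) bits; the announcement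
contains n, which gives the lower bound. -/

theorem freshId_candidates_nodup {d : ℕ} (hd : 0 < d) (j : ℕ) (given : Finset ℕ) (m : ℕ) :
    (((List.range' 1 (given.card + m)).map fun k => k * d + j).filter (· ∉ given)).Nodup := by
  refine List.Nodup.filter _ (List.Nodup.map ?_ List.nodup_range')
  intro a b h
  exact Nat.eq_of_mul_eq_mul_right hd (by simpa using h)

/-- There are `given.card + m` distinct candidates and at most `given.card` of them are filtered
out. So the default value of `getD` in `freshId` is never reached for `i < m`. -/
theorem le_length_freshId_candidates {d : ℕ} (hd : 0 < d) (j : ℕ) (given : Finset ℕ) (m : ℕ) :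
    m ≤ (((List.range' 1 (given.card + m)).map fun k => k * d + j).filter (· ∉ given)).length := by
  set L := (List.range' 1 (given.card + m)).map fun k => k * d + j with hL
  have hnd : L.Nodup := by
    refine List.Nodup.map ?_ List.nodup_range'
    intro a b h
    exact Nat.eq_of_mul_eq_mul_right hd (by simpa using h)
  have h1 : L.toFinset.card = given.card + m := by
    rw [List.toFinset_card_of_nodup hnd]; simp [hL]
  have h2 : (L.filter (· ∉ given)).toFinset = L.toFinset \ given := by
    ext x; simp
  have h3 := List.toFinset_card_of_nodup (hnd.filter (· ∉ given))
  rw [h2] at h3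
  have h4 := Finset.le_card_sdiff given L.toFinset
  omega

/-- The bound on `k` is what later keeps all offered ids quadratic in the number of nodes. -/
theorem freshId_spec {d : ℕ} (hd : 0 < d) (j : ℕ) (given : Finset ℕ) {m i : ℕ} (hi : i < m) :
    freshId j d given m i ∉ given ∧
      ∃ k, 1 ≤ k ∧ k ≤ given.card + m ∧ freshId j d given m i = k * d + j := by
  have hl := lt_of_lt_of_le hi (le_length_freshId_candidates hd j given m)
  have hmem := List.getElem_mem hl
  have he : freshId j d given m i =
      (((List.range' 1 (given.card + m)).map fun k => k * d + j).filter (· ∉ given))[i] := by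
    unfold freshId
    rw [List.getD_eq_getElem _ _ hl]
  rw [he]
  rw [List.mem_filter] at hmem
  refine ⟨by simpa using hmem.2, ?_⟩
  obtain ⟨k, hk, hk'⟩ := List.mem_map.1 hmem.1
  rw [List.mem_range'_1] at hk
  exact ⟨k, hk.1, by omega, hk'.symm⟩

theorem freshId_injOn {d : ℕ} (hd : 0 < d) (j : ℕ) (given : Finset ℕ) {m i i' : ℕ} (hi : i < m)
    (hi' : i' < m) (h : freshId j d given m i = freshId j d given m i') : i = i' := by
  have hl := le_length_freshId_candidates hd j given m
  unfold freshId at h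
  rw [List.getD_eq_getElem _ _ (hi.trans_le hl), List.getD_eq_getElem _ _ (hi'.trans_le hl)] at h
  exact ((freshId_candidates_nodup hd j given m).getElem_inj_iff).1 h

/-! ### The latest conversation message -/

/-- The timestamp of a conversation message, `0` if there is none. -/
def stampOf : Option Packet → ℕ
  | none => 0
  | some p => p.stamp

@[simp] theorem stampOf_none : stampOf none = 0 := rfl
@[simp] theorem stampOf_some (p : Packet) : stampOf (some p) = p.stamp := rfl

theorem later_eq_or (p q : Option Packet) : later p q = p ∨ later p q = q := by
  cases p <;> cases q <;> simp only [later, true_or, or_true]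
  split_ifs <;> simp

theorem stampOf_later (p q : Option Packet) :
    stampOf p ≤ stampOf (later p q) ∧ stampOf q ≤ stampOf (later p q) := by
  cases p <;> cases q <;> simp [later]
  split_ifs with h <;> simp <;> omega

theorem foldl_later {ι : Type} (f : ι → Option Packet) (L : List ι) (p : Option Packet) :
    stampOf p ≤ stampOf (L.foldl (fun p i => later p (f i)) p) ∧
      (∀ i ∈ L, stampOf (f i) ≤ stampOf (L.foldl (fun p i => later p (f i)) p)) ∧
      (L.foldl (fun p i => later p (f i)) p = p ∨
        ∃ i, L.foldl (fun p i => later p (f i)) p = f i) := by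
  induction L generalizing p with
  | nil => simp
  | cons a L ih =>
    obtain ⟨h1, h2, h3⟩ := ih (later p (f a))
    obtain ⟨h4, h5⟩ := stampOf_later p (f a)
    simp only [List.foldl_cons]
    refine ⟨h4.trans h1, ?_, ?_⟩
    · intro i hi
      rcases List.mem_cons.1 hi with rfl | hi
      · exact h5.trans h1
      · exact h2 i hi
    · rcases h3 with h3 | h3
      · rw [h3]
        rcases later_eq_or p (f a) with h | h
        · exact Or.inl h
        · exact Or.inr ⟨a, h⟩
      · exact Or.inr h3

/-! ### Absorbing the messages of a round -/

section Absorb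

variable (s : Node) {m : ℕ} (inbox : Fin m → Option Msg)

theorem absorb_eq_of_named {j : ℕ} (h : s.name = some j) :
    absorb s inbox = { s with given := recordGiven s m inbox, pkt := latest s inbox } := by
  unfold absorb; rw [h]

theorem absorb_eq_of_not_offered (h : offered inbox = ∅) :
    absorb s inbox = { s with given := recordGiven s m inbox, pkt := latest s inbox } := by
  unfold absorb; rw [h]; cases s.name <;> rfl

theorem absorb_eq_of_offered (h : s.name = none) (h' : (offered inbox).Nonempty) :
    absorb s inbox = { s with given := recordGiven s m inbox, pkt := latest s inbox,
                              name := some ((offered inbox).min' h'),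
                              rejected := (offered inbox).erase ((offered inbox).min' h') } := by
  unfold absorb; rw [h, ← Finset.coe_min' h']

theorem absorb_given : (absorb s inbox).given = recordGiven s m inbox := by
  unfold absorb; split <;> rfl

theorem absorb_pkt : (absorb s inbox).pkt = latest s inbox := by
  unfold absorb; split <;> rfl

theorem absorb_active : (absorb s inbox).active = s.active := by
  unfold absorb; split <;> rfl

theorem absorb_ctrl : (absorb s inbox).ctrl = s.ctrl := by
  unfold absorb; split <;> rfl

theorem absorb_out : (absorb s inbox).out = s.out := by
  unfold absorb; split <;> rfl

theorem absorb_eq_self_of_isEmpty (h : m = 0) : absorb s inbox = s := by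
  subst h
  rw [absorb_eq_of_not_offered _ _ (by simp [offered])]
  simp [recordGiven, latest]

end Absorb

/-! ### The absorption of messages in a network -/

section Network

variable {V : Type u} (N : DynamicNetwork V) (r : ℕ) (c : V → Node)

/-- What node `x` gets over its edges in round `r`. -/
def mail (x : V) (i : Fin (N.deg r x)) : Option Msg :=
  Individual_Conversations.inbox N r c x i

/-- The states after the common processing of the messages received in round `r`. -/
def absorbed (x : V) : Node := absorb (c x) (mail N r c x)

open Classical in
/-- The id offered by `x` to `z` in round `r`. -/
noncomputable def offerTo (x z : V) : Option ℕ :=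
  if h : (N.graph r).Adj x z then offer (c x) (N.deg r x) ((N.port r x).symm ⟨z, h⟩) else none

variable {N r c}

/-- Eliminates the local labels: the label that the neighbour gives to the edge is the one that
`offerTo` looks up, so from here on messages are described by pairs of nodes. -/
theorem mail_eq (hout : ∀ x, (c x).out = none) (x : V) (i : Fin (N.deg r x)) :
    mail N r c x i = some ⟨(c (N.port r x i)).name, offerTo N r c (N.port r x i) x,
      (c (N.port r x i)).pkt⟩ := by
  have hadj : (N.graph r).Adj (N.port r x i) x := (N.port r x i).2.symm
  have h1 : Individual_Conversations.output (c (N.port r x i)) = none := hout _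
  unfold mail Protocol.inbox Protocol.sent
  rw [if_neg (by rw [h1]; simp)]
  unfold offerTo
  rw [dif_pos hadj]
  rfl

theorem exists_port {x y : V} (h : (N.graph r).Adj x y) : ∃ i, (N.port r x i : V) = y :=
  ⟨(N.port r x).symm ⟨y, h⟩, by simp⟩

theorem mem_offered_mail (hout : ∀ x, (c x).out = none) (x : V) (v : ℕ) :
    v ∈ offered (mail N r c x) ↔ ∃ y, offerTo N r c y x = some v := by
  unfold offered
  simp only [Finset.mem_biUnion, Finset.mem_univ, true_and, mail_eq hout, Option.bind_some,
    Option.mem_toFinset, Option.mem_def]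
  constructor
  · rintro ⟨i, hi⟩; exact ⟨_, hi⟩
  · rintro ⟨y, hy⟩
    have hadj : (N.graph r).Adj y x := by
      by_contra h
      simp [offerTo, h] at hy
    obtain ⟨i, hi⟩ := exists_port hadj.symm
    exact ⟨i, by rw [hi]; exact hy⟩

/-- An id is recorded exactly when its receiver was nameless, which is also when the receiver takes
notice of it. Both ends agree, hence issued and held ids can be matched. -/
theorem mem_absorbed_given (hout : ∀ x, (c x).out = none) (x : V) (v : ℕ) :
    v ∈ (absorbed N r c x).given ↔
      v ∈ (c x).given ∨ ∃ z, (c z).name = none ∧ offerTo N r c x z = some v := by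
  unfold absorbed
  rw [absorb_given, recordGiven, Finset.mem_union]
  refine or_congr Iff.rfl ?_
  simp only [Finset.mem_biUnion, Finset.mem_univ, true_and, mail_eq hout]
  have key : ∀ i : Fin (N.deg r x), offer (c x) (N.deg r x) i = offerTo N r c x (N.port r x i) := by
    intro i
    unfold offerTo
    have hadj : (N.graph r).Adj x (N.port r x i) := (N.port r x i).2
    rw [dif_pos hadj]
    exact congrArg _ (congrArg _ ((N.port r x).symm_apply_apply i).symm)
  constructor
  · rintro ⟨i, hi⟩
    rcases hn : (c (N.port r x i)).name with _ | j
    · rw [hn] at hi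
      simp only [Option.mem_toFinset, Option.mem_def] at hi
      exact ⟨_, hn, by rw [← key]; exact hi⟩
    · rw [hn] at hi; simp at hi
  · rintro ⟨z, hz, hv⟩
    have hadj : (N.graph r).Adj x z := by
      by_contra h
      simp [offerTo, h] at hv
    obtain ⟨i, hi⟩ := exists_port hadj
    refine ⟨i, ?_⟩
    rw [hi, hz]
    simp only [Option.mem_toFinset, Option.mem_def]
    rw [key, hi]; exact hv

theorem absorbed_pkt (hout : ∀ x, (c x).out = none) (x : V) :
    stampOf (c x).pkt ≤ stampOf (absorbed N r c x).pkt ∧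
      (∀ y, (N.graph r).Adj x y → stampOf (c y).pkt ≤ stampOf (absorbed N r c x).pkt) ∧
      ∃ y, (absorbed N r c x).pkt = (c y).pkt := by
  obtain ⟨h1, h2, h3⟩ := foldl_later (fun i => ((mail N r c x) i).bind Msg.pkt)
    (List.finRange (N.deg r x)) (c x).pkt
  have h : (absorbed N r c x).pkt = latest (c x) (mail N r c x) := absorb_pkt _ _
  rw [h]
  refine ⟨h1, ?_, ?_⟩
  · intro y hy
    obtain ⟨i, hi⟩ := exists_port hy
    have := h2 i (List.mem_finRange i)
    rw [mail_eq hout, hi] at this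
    exact this
  · rcases h3 with h3 | ⟨i, h3⟩
    · exact ⟨x, h3⟩
    · refine ⟨N.port r x i, ?_⟩
      unfold latest
      rw [h3, mail_eq hout]
      rfl

theorem offerTo_eq_some {x z : V} {v : ℕ} (h : offerTo N r c x z = some v) :
    (N.graph r).Adj x z ∧ ∃ j d, (c x).name = some j ∧ (c x).active = some d := by
  unfold offerTo at h
  split_ifs at h with hadj
  refine ⟨hadj, ?_⟩
  unfold offer at h
  split at h
  · exact ⟨_, _, ‹_›, ‹_›⟩
  · simp at h

theorem offerTo_spec {x z : V} {v j d : ℕ} (hd : 0 < d) (hj : (c x).name = some j)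
    (ha : (c x).active = some d) (h : offerTo N r c x z = some v) :
    v ∉ (c x).given ∧ ∃ k, 1 ≤ k ∧ k ≤ (c x).given.card + N.deg r x ∧ v = k * d + j := by
  have hadj := (offerTo_eq_some h).1
  unfold offerTo offer at h
  rw [dif_pos hadj, hj, ha] at h
  simp only [Option.some.injEq] at h
  subst h
  exact freshId_spec hd j _ (Fin.is_lt _)

theorem offerTo_injective {x z z' : V} {v j d : ℕ} (hd : 0 < d) (hj : (c x).name = some j)
    (ha : (c x).active = some d) (h : offerTo N r c x z = some v)
    (h' : offerTo N r c x z' = some v) : z = z' := by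
  have hadj := (offerTo_eq_some h).1
  have hadj' := (offerTo_eq_some h').1
  unfold offerTo offer at h h'
  rw [dif_pos hadj, hj, ha] at h
  rw [dif_pos hadj', hj, ha] at h'
  simp only [Option.some.injEq] at h h'
  have := freshId_injOn hd j (c x).given (Fin.is_lt _) (Fin.is_lt _) (h.trans h'.symm)
  have := (N.port r x).symm.injective (Fin.ext this)
  exact congrArg Subtype.val this

theorem exists_offerTo {x z : V} {j d : ℕ} (hj : (c x).name = some j)
    (ha : (c x).active = some d) (hadj : (N.graph r).Adj x z) :
    ∃ v, offerTo N r c x z = some v := by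
  unfold offerTo offer
  rw [dif_pos hadj, hj, ha]
  exact ⟨_, rfl⟩

theorem absorbed_active (x : V) : (absorbed N r c x).active = (c x).active := absorb_active _ _

theorem absorbed_ctrl (x : V) : (absorbed N r c x).ctrl = (c x).ctrl := absorb_ctrl _ _

theorem absorbed_out (x : V) : (absorbed N r c x).out = (c x).out := absorb_out _ _

theorem absorbed_of_named {x : V} {j : ℕ} (h : (c x).name = some j) :
    (absorbed N r c x).name = some j ∧ (absorbed N r c x).rejected = (c x).rejected := by
  unfold absorbed
  rw [absorb_eq_of_named _ _ h]
  exact ⟨h, rfl⟩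

theorem absorbed_of_not_offered (hout : ∀ x, (c x).out = none) {x : V}
    (h : ∀ y, offerTo N r c y x = none) :
    (absorbed N r c x).name = (c x).name ∧ (absorbed N r c x).rejected = (c x).rejected := by
  have : offered (mail N r c x) = ∅ := by
    ext v
    rw [mem_offered_mail hout]
    simp [h]
  unfold absorbed
  rw [absorb_eq_of_not_offered _ _ this]
  exact ⟨rfl, rfl⟩

theorem absorbed_of_offered (hout : ∀ x, (c x).out = none) {x y : V} {w : ℕ}
    (hx : (c x).name = none) (h : offerTo N r c y x = some w) :
    ∃ v, (absorbed N r c x).name = some v ∧ (∃ y, offerTo N r c y x = some v) ∧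
      ∀ w, w = v ∨ w ∈ (absorbed N r c x).rejected ↔ ∃ y, offerTo N r c y x = some w := by
  have hne : (offered (mail N r c x)).Nonempty := ⟨w, (mem_offered_mail hout x w).2 ⟨y, h⟩⟩
  have hmin := Finset.min'_mem _ hne
  unfold absorbed
  rw [absorb_eq_of_offered _ _ hx hne]
  refine ⟨_, rfl, (mem_offered_mail hout x _).1 hmin, fun w => ?_⟩
  rw [← mem_offered_mail hout, Finset.mem_erase]
  constructor
  · rintro (rfl | h)
    · exact hmin
    · exact h.2
  · intro hw
    by_cases h : w = (offered (mail N r c x)).min' hne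
    · exact Or.inl h
    · exact Or.inr ⟨h, hw⟩

/-- A connected graph has an edge leaving any proper subset. -/
theorem exists_adj_boundary {G : SimpleGraph V} (hG : G.Connected) {p : V → Prop} {x y : V}
    (hx : p x) (hy : ¬ p y) : ∃ a b, G.Adj a b ∧ p a ∧ ¬ p b := by
  obtain ⟨w⟩ := hG.preconnected x y
  obtain ⟨d, -, h1, h2⟩ := w.exists_boundary_dart {v | p v} hx hy
  exact ⟨d.fst, d.snd, d.adj, h1, h2⟩

/-! ### One round -/

/-- The reaction of a node, where `t` is the number of the next round. -/
def react (t : ℕ) (s : Node) : Node :=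
  match s.ctrl with
  | none => respond t s
  | some k => lead t s k

/-- The states of all nodes after `r` rounds. -/
def states [DecidableEq V] (N : DynamicNetwork V) (l : V) (r : ℕ) : V → Node :=
  Individual_Conversations.config N l r

theorem states_zero [DecidableEq V] (N : DynamicNetwork V) (l x : V) :
    states N l 0 x = if x = l then leaderInit else otherInit := rfl

theorem states_succ [DecidableEq V] (N : DynamicNetwork V) (l : V) (r : ℕ)
    (hout : ∀ x, (states N l r x).out = none) (x : V) :
    states N l (r + 1) x = finish (r + 2) (react (r + 2) (absorbed N (r + 1) (states N l r) x)) := by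
  have h : Individual_Conversations.output (Individual_Conversations.config N l r x) = none :=
    hout x
  unfold states
  rw [Protocol.config, Protocol.round, if_neg (by rw [h]; simp)]
  rfl

theorem states_of_terminated [DecidableEq V] (N : DynamicNetwork V) (l : V) {r : ℕ} {x : V} {i : ℕ}
    (h : (states N l r x).out = some i) {r' : ℕ} (hr : r ≤ r') :
    (states N l r' x).out = some i := by
  induction r', hr using Nat.le_induction with
  | base => exact h
  | succ r' _ ih =>
    have : Individual_Conversations.output (Individual_Conversations.config N l r' x) = some i := ih
    unfold states
    rw [Protocol.config, Protocol.round, if_pos (by rw [this]; rfl)]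
    exact ih

end Network

/-! ### Invariants -/

/-- A node in state `s` reacts to a conversation message with contents `b`. -/
def Answers (s : Node) : Body → Prop
  | .unfreeze id _ => s.name = some id
  | .collect id => s.name = some id
  | .seek id _ => s.name = some id ∨ id ∈ s.rejected
  | _ => False

/-- The message can occur in the assigning or the collecting part of a cycle with `d`
consecutive ids. -/
def Low (d : ℕ) : Body → Prop
  | .unfreeze id _ => id < d
  | .collect id => id < d
  | .seek _ _ => False
  | _ => True

/-- All numbers in the message are at most `M`. -/
def SmallBody (M : ℕ) : Body → Prop
  | .unfreeze id d => id ≤ M ∧ d ≤ M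
  | .collect id => id ≤ M
  | .seek id new => id ≤ M ∧ new ≤ M
  | .unfrozen id => id ≤ M
  | .collected id x => id ≤ M ∧ ∀ y, x = some y → y ≤ M
  | .adopted id => id ≤ M
  | .rejected id => id ≤ M
  | .halt n => n ≤ M

/-- A node with an id `≥ d` was offered the id `y`. -/
def Holds (d : ℕ) (s : Node) (y : ℕ) : Prop :=
  ∃ i, s.name = some i ∧ d ≤ i ∧ (y = i ∨ y ∈ s.rejected)

variable {V : Type u}

/-- The id `y` was possibly assigned in the current cycle, where `E` are the ids that have been
reported already. -/
def Issued (c : V → Node) (E : Finset ℕ) (y : ℕ) : Prop :=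
  (∃ x, y ∈ (c x).given) ∨ y ∈ E

/-- The number of nodes without an id. -/
def nameless [Fintype V] (c : V → Node) : ℕ :=
  (Finset.univ.filter fun x => (c x).name = none).card

open Classical in
/-- The number of nodes whose latest conversation message is `Q`. -/
noncomputable def holders [Fintype V] (c : V → Node) (Q : Packet) : ℕ :=
  (Finset.univ.filter fun x => (c x).pkt = some Q).card

/-- An upper bound for the number of ids that may still be possibly assigned. -/
def credit [Fintype V] (c : V → Node) : ℕ :=
  ∑ x, (c x).given.card + Fintype.card V * nameless c

/-- The state of a conversation after round `r`: `P` is the last message of the leader, and `Q` is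
the latest message. -/
structure Conversation (c : V → Node) (l : V) (P Q : Packet) (r M : ℕ) : Prop where
  leader_pkt : (c l).pkt = some P ∨ (c l).pkt = some Q
  eq_or_lt : P = Q ∨ P.stamp < Q.stamp
  stamp_pos : 0 < P.stamp
  stamp_le : Q.stamp ≤ r + 1
  pkt_cases : ∀ y p, (c y).pkt = some p → p = Q ∨ p = P ∨ p.stamp < P.stamp
  -- Excludes obeying a stale copy: a message that a node would answer is the latest one, or older
  -- than what the node already knows.
  outdated : ∀ x, x ≠ l → ∀ y p, (c y).pkt = some p → Answers (c x) p.body →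
    p.stamp < stampOf (c x).pkt ∨ p = Q
  small : ∀ y p, (c y).pkt = some p → SmallBody M p.body
  halt_eq : ∀ y p k, (c y).pkt = some p → p.body = .halt k → p = Q
  exists_holder : ∃ y, (c y).pkt = some Q

/-- The assigning and collecting part of a cycle with `d` consecutive ids that began with the
timestamp `τ`: the nodes with ids `< k` have been unfrozen, those with ids `< f` have reported
all their assignments, and `E` are the reported ids. -/
structure Naming [Fintype V] (c : V → Node) (l : V) (M d k f : ℕ) (E : Finset ℕ) (τ : ℕ) :
    Prop where
  name_inj : ∀ x y i, (c x).name = some i → (c y).name = some i → x = y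
  name_surj : ∀ i < d, ∃ x, (c x).name = some i
  name_leader : (c l).name = some 0
  two_le : 2 ≤ d
  unfrozen_pos : 0 < k
  unfrozen_le : k ≤ d
  active_spec : ∀ x e, (c x).active = some e → e = d ∧ ∃ i, (c x).name = some i ∧ f ≤ i ∧ i < k
  active_all : f = 0 → ∀ x i, i < k → (c x).name = some i → (c x).active = some d
  given_spec : ∀ x y, y ∈ (c x).given →
    d ≤ y ∧ y ≤ M ∧ f ≤ y % d ∧ y % d < k ∧ (c x).name = some (y % d)
  extra_spec : ∀ y ∈ E, d ≤ y ∧ y ≤ M ∧ ∀ x, (c x).name = some (y % d) → (c x).active = none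
  -- These three fields match the issued ids with unique holders. Only nodes with id at least `d`
  -- count as holders, so lists of rejected ids left over from the previous cycle at nodes not yet
  -- unfrozen do no harm.
  held_of_issued : ∀ y, Issued c E y → ∃ z, Holds d (c z) y
  issued_of_held : ∀ z y, Holds d (c z) y → Issued c E y
  held_unique : ∀ z z' y, Holds d (c z) y → Holds d (c z') y → z = z'
  rejected_unfrozen : ∀ z i, (c z).name = some i → i < k → (c z).rejected = ∅
  rejected_nameless : ∀ z, (c z).name = none → (c z).rejected = ∅
  card_given : ∀ x, (c x).given.card + nameless c ≤ Fintype.card V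
  progress : 0 < f → (∃ y, Issued c E y) ∨ ∀ z, (c z).name ≠ none
  -- The last two fields serve nodes that are named during the cycle: such a node learns a stamp of
  -- at least `τ` from its unfrozen neighbour, and messages with such stamps do not address ids of
  -- `d` or more.
  low : ∀ x p, (c x).pkt = some p → τ ≤ p.stamp → Low d p.body
  active_stamp : ∀ x, (c x).active ≠ none → τ ≤ stampOf (c x).pkt

/-- The part of a cycle in which the leader deals with the possibly assigned ids: the cycle began
with `d` consecutive ids, at present there are `m` of them, and the ids in `E` remain. -/
structure Renaming (c : V → Node) (l : V) (M d m : ℕ) (E : Finset ℕ) : Prop where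
  name_inj : ∀ x y i, (c x).name = some i → (c y).name = some i → x = y
  name_surj : ∀ i < m, ∃ x, (c x).name = some i
  name_leader : (c l).name = some 0
  rejected_leader : (c l).rejected = ∅
  two_le : 2 ≤ m
  le_count : d ≤ m
  frozen : ∀ x, (c x).active = none
  given_empty : ∀ x, (c x).given = ∅
  remaining_ge : ∀ y ∈ E, m ≤ y
  remaining_le : ∀ y ∈ E, y ≤ M
  answer_exists : ∀ y ∈ E, ∃ z, (c z).name = some y ∨ y ∈ (c z).rejected
  answer_unique : ∀ y ∈ E, ∀ z z', ((c z).name = some y ∨ y ∈ (c z).rejected) →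
    ((c z').name = some y ∨ y ∈ (c z').rejected) → z = z'
  name_cases : ∀ z y, (c z).name = some y → y < m ∨ y ∈ E
  rejected_nameless : ∀ z, (c z).name = none → (c z).rejected = ∅
  -- Guarantees that the count has grown when the ids are exhausted: somebody has been renamed, or
  -- somebody whose id remains in `E` still will be.
  progress : d < m ∨ ∃ z y, (c z).name = some y ∧ y ∈ E

/-! ### Counting bounds for ids, degrees and holders -/

section

variable {c : V → Node}

theorem count_le_card [Fintype V] {d : ℕ} (h : ∀ i < d, ∃ x, (c x).name = some i) :
    d ≤ Fintype.card V := by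
  choose f hf using h
  have : Function.Injective fun i : Fin d => f i i.2 := by
    intro i j hij
    have h1 := hf i i.2
    have h2 := hf j j.2
    simp only at hij
    rw [hij, h2] at h1
    exact Fin.ext (Option.some.inj h1).symm
  simpa using Fintype.card_le_of_injective _ this

theorem deg_le_card [Fintype V] (N : DynamicNetwork V) (r : ℕ) (x : V) :
    N.deg r x ≤ Fintype.card V := by
  have : Function.Injective fun i : Fin (N.deg r x) => (N.port r x i : V) :=
    Subtype.val_injective.comp (N.port r x).injective
  simpa using Fintype.card_le_of_injective _ this

theorem holders_le [Fintype V] (c : V → Node) (Q : Packet) : holders c Q ≤ Fintype.card V :=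
  Finset.card_le_univ _

end

/-! ### Absorption preserves the invariants -/

section Absorbed

variable {N : DynamicNetwork V} {R : ℕ} {c : V → Node}

/-- An id offered in the assigning or collecting part of a cycle. -/
theorem Naming.offerTo_spec [Fintype V] {l : V} {d k f τ : ℕ} {E : Finset ℕ}
    (h : Naming c l (3 * Fintype.card V ^ 2) d k f E τ) {x z : V} {v : ℕ}
    (hv : offerTo N R c x z = some v) :
    (c x).active = some d ∧ (c x).name = some (v % d) ∧ d ≤ v ∧ v ≤ 3 * Fintype.card V ^ 2 ∧
      f ≤ v % d ∧ v % d < k ∧ ¬ Issued c E v := by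
  obtain ⟨hadj, j, e, hj, he⟩ := offerTo_eq_some hv
  obtain ⟨rfl, i, hi, hfi, hik⟩ := h.active_spec x e he
  obtain rfl : i = j := Option.some.inj (hi.symm.trans hj)
  have hd := h.two_le
  obtain ⟨hnot, q, hq1, hq2, rfl⟩ := IndividualConversations.offerTo_spec (by omega) hj he hv
  have hlt : i < e := hik.trans_le h.unfrozen_le
  have hmod : (q * e + i) % e = i := by
    rw [Nat.mul_comm, Nat.mul_add_mod, Nat.mod_eq_of_lt hlt]
  rw [hmod]
  have hn := count_le_card h.name_surj
  have hdeg := deg_le_card N R x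
  have hcard := h.card_given x
  -- The id is `q * e + i` with `q ≤ 2n` (recorded ids plus degree), `e ≤ n` and `i < e`, hence at
  -- most 2n² + n ≤ 3n².
  refine ⟨he, hj, by nlinarith, by nlinarith, hfi, hik, ?_⟩
  -- The residue of an issued id names its issuer. If the id is still in a `given` set, that set is
  -- the one of `x`, which fresh ids avoid; if it has been reported, the node with this residue as
  -- id is frozen, but `x` is unfrozen.
  rintro (⟨x', hx'⟩ | hE)
  · have := h.given_spec x' _ hx'
    rw [hmod] at this
    obtain rfl := h.name_inj _ _ _ hj this.2.2.2.2
    exact hnot hx'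
  · have := (h.extra_spec _ hE).2.2 x (by rw [hmod]; exact hj)
    rw [he] at this
    simp at this

/-- The residue modulo `d` identifies the offering node, and that node puts distinct ids on its
edges. -/
theorem Naming.offerTo_unique [Fintype V] {l : V} {d k f τ : ℕ} {E : Finset ℕ}
    (h : Naming c l (3 * Fintype.card V ^ 2) d k f E τ) {x z x' z' : V} {v : ℕ}
    (hv : offerTo N R c x z = some v) (hv' : offerTo N R c x' z' = some v) : z = z' := by
  have h1 := h.offerTo_spec hv
  have h2 := h.offerTo_spec hv'
  obtain rfl := h.name_inj _ _ _ h1.2.1 h2.2.1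
  have := h.two_le
  exact offerTo_injective (by omega) h1.2.1 h1.1 hv hv'

theorem issued_absorbed (hout : ∀ x, (c x).out = none) (E : Finset ℕ) (y : ℕ) :
    Issued (absorbed N R c) E y ↔
      Issued c E y ∨ ∃ x z, (c z).name = none ∧ offerTo N R c x z = some y := by
  unfold Issued
  simp only [mem_absorbed_given hout]
  constructor
  · rintro (⟨x, h | ⟨z, h⟩⟩ | h)
    · exact Or.inl (Or.inl ⟨x, h⟩)
    · exact Or.inr ⟨x, z, h⟩
    · exact Or.inl (Or.inr h)
  · rintro ((⟨x, h⟩ | h) | ⟨x, z, h⟩)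
    · exact Or.inl ⟨x, Or.inl h⟩
    · exact Or.inr h
    · exact Or.inl ⟨x, Or.inr ⟨z, h⟩⟩

theorem absorbed_name_cases (hout : ∀ x, (c x).out = none) (z : V) :
    ((absorbed N R c z).name = (c z).name ∧ (absorbed N R c z).rejected = (c z).rejected ∧
      ((c z).name = none → ∀ x, offerTo N R c x z = none)) ∨
    ((c z).name = none ∧ ∃ v, (absorbed N R c z).name = some v ∧
      (∃ x, offerTo N R c x z = some v) ∧
      ∀ w, w = v ∨ w ∈ (absorbed N R c z).rejected ↔ ∃ x, offerTo N R c x z = some w) := by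
  rcases hn : (c z).name with _ | j
  · by_cases h : ∀ x, offerTo N R c x z = none
    · have := absorbed_of_not_offered (N := N) (r := R) hout h
      exact Or.inl ⟨this.1.trans hn, this.2, fun _ => h⟩
    · push Not at h
      obtain ⟨x, hx⟩ := h
      obtain ⟨v, hv⟩ := Option.ne_none_iff_exists'.1 hx
      exact Or.inr ⟨rfl, absorbed_of_offered hout hn hv⟩
  · have := absorbed_of_named (N := N) (r := R) hn
    exact Or.inl ⟨this.1, this.2, by simp⟩

/-- A round changes the held ids by the same offers to nameless nodes as it changes the issued ids
in `issued_absorbed`; this preserves the matching between them. -/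
theorem Naming.holds_absorbed [Fintype V] (hout : ∀ x, (c x).out = none) {l : V} {d k f τ : ℕ}
    {E : Finset ℕ} (h : Naming c l (3 * Fintype.card V ^ 2) d k f E τ) (z : V) (y : ℕ) :
    Holds d (absorbed N R c z) y ↔
      Holds d (c z) y ∨ ((c z).name = none ∧ ∃ x, offerTo N R c x z = some y) := by
  rcases absorbed_name_cases (N := N) (R := R) hout z with ⟨h1, h2, h3⟩ | ⟨h1, v, h2, ⟨x, h3⟩, h4⟩
  · unfold Holds
    rw [h1, h2]
    constructor
    · exact Or.inl
    · rintro (h | ⟨h, x, hx⟩)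
      · exact h
      · rw [h3 h] at hx; simp at hx
  · rw [← h4]
    unfold Holds
    rw [h1, h2]
    have := (h.offerTo_spec h3).2.2.1
    simp [this]

/-- Each id newly recorded by `x` was offered to a different edge's nameless neighbour, and that
neighbour is named in this very round. So what `given` gains is compensated by the loss of nameless
nodes. Summation over `x` gives `credit_absorbed`. -/
theorem nameless_absorbed [Fintype V] (hout : ∀ x, (c x).out = none) (x : V) :
    (absorbed N R c x).given.card + nameless (absorbed N R c) ≤
      (c x).given.card + nameless c := by
  classical
  set S := Finset.univ.filter fun z => (c z).name = none ∧ offerTo N R c x z ≠ none with hS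
  have h1 : (absorbed N R c x).given ⊆
      (c x).given ∪ S.biUnion fun z => (offerTo N R c x z).toFinset := by
    intro v hv
    rcases (mem_absorbed_given hout x v).1 hv with h | ⟨z, hz, hv⟩
    · exact Finset.mem_union_left _ h
    · refine Finset.mem_union_right _ (Finset.mem_biUnion.2 ⟨z, ?_, by simp [hv]⟩)
      simp [hS, hz, hv]
  have h2 : (S.biUnion fun z => (offerTo N R c x z).toFinset).card ≤ S.card := by
    refine (Finset.card_biUnion_le_card_mul _ _ 1 ?_).trans (by simp)
    intro z _
    cases offerTo N R c x z <;> simp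
  have h3 : nameless (absorbed N R c) + S.card ≤ nameless c := by
    unfold nameless
    rw [← Finset.card_union_of_disjoint]
    · refine Finset.card_le_card ?_
      intro z hz
      rcases Finset.mem_union.1 hz with hz | hz
      · simp only [Finset.mem_filter, Finset.mem_univ, true_and] at hz ⊢
        rcases absorbed_name_cases (N := N) (R := R) hout z with h | h
        · rw [← h.1]; exact hz
        · exact h.1
      · simp only [hS, Finset.mem_filter, Finset.mem_univ, true_and] at hz ⊢
        exact hz.1
    · rw [Finset.disjoint_left]
      intro z hz hz'
      simp only [hS, Finset.mem_filter, Finset.mem_univ, true_and] at hz hz'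
      obtain ⟨v, hv⟩ := Option.ne_none_iff_exists'.1 hz'.2
      obtain ⟨w, hw, -⟩ := absorbed_of_offered hout hz'.1 hv
      rw [hz] at hw
      simp at hw
  have h4 := (Finset.card_le_card h1).trans (Finset.card_union_le _ _)
  omega

theorem credit_absorbed [Fintype V] (hout : ∀ x, (c x).out = none) :
    credit (absorbed N R c) ≤ credit c := by
  have h : ∀ c : V → Node, credit c = ∑ x, ((c x).given.card + nameless c) := by
    intro c
    rw [Finset.sum_add_distrib]
    simp [credit]
  rw [h, h]
  exact Finset.sum_le_sum fun x _ => nameless_absorbed hout x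

theorem Naming.absorbed [Fintype V] (hout : ∀ x, (c x).out = none) {l : V} {d k f τ : ℕ}
    {E : Finset ℕ} (h : Naming c l (3 * Fintype.card V ^ 2) d k f E τ) :
    Naming (absorbed N R c) l (3 * Fintype.card V ^ 2) d k f E τ := by
  have hnew : ∀ z i, (IndividualConversations.absorbed N R c z).name = some i →
      ((c z).name = some i ∧
        (IndividualConversations.absorbed N R c z).rejected = (c z).rejected) ∨
      ((c z).name = none ∧ ∃ x, offerTo N R c x z = some i) := by
    intro z i hi
    rcases absorbed_name_cases (N := N) (R := R) hout z with h1 | ⟨h1, v, h2, h3, -⟩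
    · exact Or.inl ⟨h1.1 ▸ hi, h1.2.1⟩
    · rw [h2] at hi
      obtain rfl := Option.some.inj hi
      exact Or.inr ⟨h1, h3⟩
  have hlow : ∀ z i, i < d → (IndividualConversations.absorbed N R c z).name = some i →
      (c z).name = some i ∧
        (IndividualConversations.absorbed N R c z).rejected = (c z).rejected := by
    intro z i hid hi
    rcases hnew z i hi with h1 | ⟨-, x, hx⟩
    · exact h1
    · have := (h.offerTo_spec hx).2.2.1
      omega
  have hold : ∀ z i, (c z).name = some i →
      (IndividualConversations.absorbed N R c z).name = some i :=
    fun z i hi => (absorbed_of_named hi).1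
  have hd := h.two_le
  -- Two old holders are equal by the invariant. An old and a new holder cannot share an id, since
  -- an id held before is issued and an offered id is not. Two new holders are equal by
  -- `Naming.offerTo_unique`.
  have huniq : ∀ z z' y, Holds d (IndividualConversations.absorbed N R c z) y →
      Holds d (IndividualConversations.absorbed N R c z') y → z = z' := by
    intro z z' y hz hz'
    rcases (h.holds_absorbed hout z y).1 hz with hz | ⟨hz, x, hx⟩ <;>
      rcases (h.holds_absorbed hout z' y).1 hz' with hz' | ⟨hz', x', hx'⟩
    · exact h.held_unique _ _ _ hz hz'
    · exact absurd (h.issued_of_held _ _ hz) (h.offerTo_spec hx').2.2.2.2.2.2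
    · exact absurd (h.issued_of_held _ _ hz') (h.offerTo_spec hx).2.2.2.2.2.2
    · exact h.offerTo_unique hx hx'
  constructor
  · intro x y i hx hy
    by_cases hi : i < d
    · exact h.name_inj x y i (hlow _ _ hi hx).1 (hlow _ _ hi hy).1
    · exact huniq x y i ⟨i, hx, by omega, Or.inl rfl⟩ ⟨i, hy, by omega, Or.inl rfl⟩
  · intro i hi
    obtain ⟨x, hx⟩ := h.name_surj i hi
    exact ⟨x, hold _ _ hx⟩
  · exact hold _ _ h.name_leader
  · exact h.two_le
  · exact h.unfrozen_pos
  · exact h.unfrozen_le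
  · intro x e he
    rw [absorbed_active] at he
    obtain ⟨h1, i, hi, h2⟩ := h.active_spec x e he
    exact ⟨h1, i, hold _ _ hi, h2⟩
  · intro hf x i hi hx
    rw [absorbed_active]
    exact h.active_all hf x i hi (hlow _ _ (hi.trans_le h.unfrozen_le) hx).1
  · intro x y hy
    rcases (mem_absorbed_given hout x y).1 hy with hy | ⟨z, hz, hy⟩
    · have := h.given_spec x y hy
      exact ⟨this.1, this.2.1, this.2.2.1, this.2.2.2.1, hold _ _ this.2.2.2.2⟩
    · have := h.offerTo_spec hy
      exact ⟨this.2.2.1, this.2.2.2.1, this.2.2.2.2.1, this.2.2.2.2.2.1, hold _ _ this.2.1⟩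
  · intro y hy
    have := h.extra_spec y hy
    refine ⟨this.1, this.2.1, fun x hx => ?_⟩
    rw [absorbed_active]
    exact this.2.2 x (hlow _ _ (Nat.mod_lt _ (by omega)) hx).1
  · intro y hy
    rcases (issued_absorbed hout E y).1 hy with hy | ⟨x, z, hz, hy⟩
    · obtain ⟨z, hz⟩ := h.held_of_issued y hy
      exact ⟨z, (h.holds_absorbed hout z y).2 (Or.inl hz)⟩
    · exact ⟨z, (h.holds_absorbed hout z y).2 (Or.inr ⟨hz, x, hy⟩)⟩
  · intro z y hy
    rcases (h.holds_absorbed hout z y).1 hy with hy | ⟨hz, x, hy⟩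
    · exact (issued_absorbed hout E y).2 (Or.inl (h.issued_of_held _ _ hy))
    · exact (issued_absorbed hout E y).2 (Or.inr ⟨x, z, hz, hy⟩)
  · exact huniq
  · intro z i hi hik
    obtain ⟨h1, h2⟩ := hlow z i (hik.trans_le h.unfrozen_le) hi
    rw [h2]
    exact h.rejected_unfrozen z i h1 hik
  · intro z hz
    rcases absorbed_name_cases (N := N) (R := R) hout z with h1 | ⟨h1, v, h2, h3, -⟩
    · rw [h1.2.1]
      exact h.rejected_nameless z (h1.1 ▸ hz)
    · rw [h2] at hz
      simp at hz
  · intro x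
    exact (nameless_absorbed hout x).trans (h.card_given x)
  · intro hf
    refine (h.progress hf).imp (fun ⟨y, hy⟩ => ⟨y, (issued_absorbed hout E y).2 (Or.inl hy)⟩) ?_
    intro hall z
    obtain ⟨i, hi⟩ := Option.ne_none_iff_exists'.1 (hall z)
    rw [hold _ _ hi]
    simp
  · intro x p hp hτ
    obtain ⟨y, hy⟩ := (absorbed_pkt (N := N) (r := R) hout x).2.2
    exact h.low y p (hy ▸ hp) hτ
  · intro x hx
    rw [absorbed_active] at hx
    exact (h.active_stamp x hx).trans (absorbed_pkt hout x).1

theorem Renaming.offerTo_eq_none {l : V} {M d m : ℕ} {E : Finset ℕ} (h : Renaming c l M d m E)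
    (x z : V) : offerTo N R c x z = none := by
  by_contra hne
  obtain ⟨v, hv⟩ := Option.ne_none_iff_exists'.1 hne
  obtain ⟨-, j, e, -, he⟩ := offerTo_eq_some hv
  rw [h.frozen] at he
  simp at he

theorem Renaming.congr {l : V} {M d m : ℕ} {E : Finset ℕ} (h : Renaming c l M d m E)
    {c' : V → Node} (hc : ∀ x, (c' x).name = (c x).name ∧ (c' x).rejected = (c x).rejected ∧
      (c' x).active = (c x).active ∧ (c' x).given = (c x).given) :
    Renaming c' l M d m E := by
  constructor
  · simpa only [hc] using h.name_inj
  · simpa only [hc] using h.name_surj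
  · simpa only [hc] using h.name_leader
  · simpa only [hc] using h.rejected_leader
  · exact h.two_le
  · exact h.le_count
  · simpa only [hc] using h.frozen
  · simpa only [hc] using h.given_empty
  · exact h.remaining_ge
  · exact h.remaining_le
  · simpa only [hc] using h.answer_exists
  · simpa only [hc] using h.answer_unique
  · simpa only [hc] using h.name_cases
  · simpa only [hc] using h.rejected_nameless
  · simpa only [hc] using h.progress

theorem Naming.congr [Fintype V] {l : V} {M d k f τ : ℕ} {E : Finset ℕ}
    (h : Naming c l M d k f E τ) {c' : V → Node}
    (hc : ∀ x, (c' x).name = (c x).name ∧ (c' x).rejected = (c x).rejected ∧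
      (c' x).active = (c x).active ∧ (c' x).given = (c x).given)
    (hlow : ∀ x p, (c' x).pkt = some p → τ ≤ p.stamp → Low d p.body)
    (hst : ∀ x, stampOf (c x).pkt ≤ stampOf (c' x).pkt) : Naming c' l M d k f E τ := by
  constructor
  · simpa only [hc] using h.name_inj
  · simpa only [hc] using h.name_surj
  · simpa only [hc] using h.name_leader
  · exact h.two_le
  · exact h.unfrozen_pos
  · exact h.unfrozen_le
  · simpa only [hc] using h.active_spec
  · simpa only [hc] using h.active_all
  · simpa only [hc] using h.given_spec
  · simpa only [hc] using h.extra_spec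
  · simpa only [Issued, Holds, hc] using h.held_of_issued
  · simpa only [Issued, Holds, hc] using h.issued_of_held
  · simpa only [Holds, hc] using h.held_unique
  · simpa only [hc] using h.rejected_unfrozen
  · simpa only [hc] using h.rejected_nameless
  · simpa only [nameless, hc] using h.card_given
  · simpa only [Issued, hc] using h.progress
  · exact hlow
  · intro x hx
    rw [(hc x).2.2.1] at hx
    exact (h.active_stamp x hx).trans (hst x)

theorem Renaming.absorbed_same (hout : ∀ x, (c x).out = none) {l : V} {M d m : ℕ} {E : Finset ℕ}
    (h : Renaming c l M d m E) (x : V) :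
    (absorbed N R c x).name = (c x).name ∧ (absorbed N R c x).rejected = (c x).rejected := by
  exact absorbed_of_not_offered hout fun y => h.offerTo_eq_none _ _

theorem Renaming.absorbed (hout : ∀ x, (c x).out = none) {l : V} {M d m : ℕ} {E : Finset ℕ}
    (h : Renaming c l M d m E) : Renaming (absorbed N R c) l M d m E := by
  refine h.congr fun x => ?_
  have := h.absorbed_same (N := N) (R := R) hout x
  refine ⟨this.1, this.2, absorbed_active x, ?_⟩
  ext v
  rw [mem_absorbed_given hout]
  simp [h.offerTo_eq_none]

/-- Nodes whose reactions may change during absorption are up to date. -/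
def Stable (c a : V → Node) : Prop :=
  ∀ x, ((a x).name = (c x).name ∧ (a x).rejected = (c x).rejected) ∨
    ∀ y p, (a y).pkt = some p → Answers (a x) p.body → p.stamp < stampOf (a x).pkt

theorem Answers.congr {s s' : Node} {b : Body} (h : Answers s b) (h1 : s'.name = s.name)
    (h2 : s'.rejected = s.rejected) : Answers s' b := by
  cases b <;> simp only [Answers, h1, h2] at h ⊢ <;> exact h

/-- No message in the network has a larger stamp than `Q`, and by `pkt_cases` one that is at least
as new equals `Q`. So `Q` is never displaced and wins wherever it arrives. -/
theorem Conversation.absorbed_holder {l : V} {P Q : Packet} {r M : ℕ}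
    (h : Conversation c l P Q r M) (hout : ∀ x, (c x).out = none) {x y : V}
    (hy : (c y).pkt = some Q) (hxy : x = y ∨ (N.graph R).Adj x y) :
    (absorbed N R c x).pkt = some Q := by
  obtain ⟨h1, h2, z, hz⟩ := absorbed_pkt (N := N) (r := R) hout x
  have hst : Q.stamp ≤ stampOf (absorbed N R c x).pkt := by
    rcases hxy with rfl | hxy
    · rw [hy] at h1; exact h1
    · have := h2 y hxy
      rw [hy] at this; exact this
  have hpos : 0 < Q.stamp := by
    have := h.stamp_pos
    rcases h.eq_or_lt with rfl | h
    · exact this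
    · omega
  rcases hp : (absorbed N R c x).pkt with _ | p
  · rw [hp] at hst
    simp at hst
    omega
  · rw [hp] at hst hz
    simp only [stampOf_some] at hst
    rcases h.pkt_cases z p hz.symm with rfl | rfl | hlt
    · rfl
    · rcases h.eq_or_lt with rfl | h
      · rfl
      · omega
    · rcases h.eq_or_lt with rfl | h <;> omega

/-- Forwarding creates no messages and does not lower the stamp known to a node. Only `outdated` is
delicate, because a node may change the ids it answers to; this is what `Stable` controls. -/
theorem Conversation.absorbed {l : V} {P Q : Packet} {r M : ℕ}
    (h : Conversation c l P Q r M) (hout : ∀ x, (c x).out = none)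
    (hst : Stable c (absorbed N R c)) : Conversation (absorbed N R c) l P Q r M := by
  have hsub : ∀ x p, (IndividualConversations.absorbed N R c x).pkt = some p →
      ∃ y, (c y).pkt = some p := by
    intro x p hp
    obtain ⟨y, hy⟩ := (absorbed_pkt (N := N) (r := R) hout x).2.2
    exact ⟨y, hy ▸ hp⟩
  have hmono := fun x => (absorbed_pkt (N := N) (r := R) hout x).1
  constructor
  · rcases h.leader_pkt with hl | hl
    · have h1 := hmono l
      rw [hl] at h1
      rcases hp : (IndividualConversations.absorbed N R c l).pkt with _ | p
      · rw [hp] at h1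
        have := h.stamp_pos
        simp at h1
        omega
      · rw [hp] at h1
        simp only [stampOf_some] at h1
        obtain ⟨y, hy⟩ := hsub l p hp
        rcases h.pkt_cases y p hy with rfl | rfl | hlt
        · exact Or.inr rfl
        · exact Or.inl rfl
        · omega
    · exact Or.inr (h.absorbed_holder hout hl (Or.inl rfl))
  · exact h.eq_or_lt
  · exact h.stamp_pos
  · exact h.stamp_le
  · intro y p hp
    obtain ⟨z, hz⟩ := hsub y p hp
    exact h.pkt_cases z p hz
  · intro x hx y p hp hans
    rcases hst x with ⟨h1, h2⟩ | h1
    · obtain ⟨z, hz⟩ := hsub y p hp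
      rcases h.outdated x hx z p hz (hans.congr h1.symm h2.symm) with h3 | h3
      · exact Or.inl (h3.trans_le (hmono x))
      · exact Or.inr h3
    · exact Or.inl (h1 y p hp hans)
  · intro y p hp
    obtain ⟨z, hz⟩ := hsub y p hp
    exact h.small z p hz
  · intro y p k hp
    obtain ⟨z, hz⟩ := hsub y p hp
    exact h.halt_eq z p k hz
  · obtain ⟨y, hy⟩ := h.exists_holder
    exact ⟨y, h.absorbed_holder hout hy (Or.inl rfl)⟩

/-- The holders form a nonempty proper set of nodes, so connectivity gives an edge leaving it, and
the message crosses that edge. -/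
theorem holders_absorbed [Fintype V] {l : V} {P Q : Packet} {r M : ℕ}
    (h : Conversation c l P Q r M) (hout : ∀ x, (c x).out = none)
    (hconn : (N.graph R).Connected) {x : V} (hx : (c x).pkt ≠ some Q) :
    holders c Q + 1 ≤ holders (absorbed N R c) Q := by
  classical
  obtain ⟨y, hy⟩ := h.exists_holder
  obtain ⟨a, b, hab, ha, hb⟩ :=
    exists_adj_boundary (p := fun x => (c x).pkt = some Q) hconn hy hx
  unfold holders
  rw [← Nat.lt_iff_add_one_le]
  refine Finset.card_lt_card ⟨fun z hz => ?_, fun hsub => ?_⟩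
  · simp only [Finset.mem_filter, Finset.mem_univ, true_and] at hz ⊢
    exact h.absorbed_holder hout hz (Or.inl rfl)
  · have hb' : b ∈ Finset.univ.filter fun x => (absorbed N R c x).pkt = some Q := by
      simp only [Finset.mem_filter, Finset.mem_univ, true_and]
      exact h.absorbed_holder hout ha (Or.inr hab.symm)
    have := hsub hb'
    simp only [Finset.mem_filter, Finset.mem_univ, true_and] at this
    exact hb this

/-- A node named in this round hears from the unfrozen node whose offer it adopts, so its stamp
becomes at least `τ`. A message it answers that is not older would then be `Low`, but a low request
addresses an id below `d`, while the new id and the rejected ones only come into play for larger ids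
or for `seek`. -/
theorem Naming.stable [Fintype V] (hout : ∀ x, (c x).out = none) {l : V} {d k f τ : ℕ}
    {E : Finset ℕ} (h : Naming c l (3 * Fintype.card V ^ 2) d k f E τ) :
    Stable c (IndividualConversations.absorbed N R c) := by
  intro x
  rcases absorbed_name_cases (N := N) (R := R) hout x with h1 | ⟨h1, v, h2, ⟨z, h3⟩, h4⟩
  · exact Or.inl ⟨h1.1, h1.2.1⟩
  · refine Or.inr fun y p hp hans => ?_
    by_contra hlt
    obtain ⟨hz1, hz2, hz3, -⟩ := h.offerTo_spec h3
    have hτ : τ ≤ stampOf (c z).pkt := h.active_stamp z (by rw [hz1]; simp)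
    have hle := (absorbed_pkt (N := N) (r := R) hout x).2.1 z (offerTo_eq_some h3).1.symm
    have hlow := (h.absorbed (N := N) (R := R) hout).low y p hp (by omega)
    rcases p with ⟨t, b⟩
    cases b <;> simp only [Answers, Low, h2, Option.some.injEq] at hans hlow <;> omega

theorem Renaming.stable (hout : ∀ x, (c x).out = none) {l : V} {M d m : ℕ} {E : Finset ℕ}
    (h : Renaming c l M d m E) : Stable c (IndividualConversations.absorbed N R c) :=
  fun x => Or.inl (h.absorbed_same hout x)

/-- If all nodes with consecutive ids assign in a round, then an id gets assigned, unless all nodes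
have consecutive ids. -/
theorem Naming.exists_issued_absorbed [Fintype V] (hout : ∀ x, (c x).out = none) {l : V}
    {d τ : ℕ} (h : Naming c l (3 * Fintype.card V ^ 2) d d 0 ∅ τ)
    (hconn : (N.graph R).Connected) :
    (∃ y, Issued (IndividualConversations.absorbed N R c) ∅ y) ∨
      ∀ z, (IndividualConversations.absorbed N R c z).name ≠ none := by
  by_cases hall : ∀ z, (c z).name ≠ none
  · refine Or.inr fun z => ?_
    obtain ⟨i, hi⟩ := Option.ne_none_iff_exists'.1 (hall z)
    rw [(absorbed_of_named hi).1]
    simp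
  · push Not at hall
    obtain ⟨z, hz⟩ := hall
    obtain ⟨a, b, hab, ha, hb⟩ := exists_adj_boundary (p := fun x => (c x).name ≠ none) hconn
      (x := l) (y := z) (by rw [h.name_leader]; simp) (by simpa using hz)
    simp only [ne_eq, not_not] at hb
    obtain ⟨i, hi⟩ := Option.ne_none_iff_exists'.1 ha
    left
    -- At an edge from a named to a nameless node, a named end with a consecutive id is unfrozen and
    -- its offer gets recorded. A named end with a larger id is itself evidence of an issued id.
    by_cases hid : i < d
    · obtain ⟨v, hv⟩ := exists_offerTo hi (h.active_all rfl a i hid hi) hab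
      exact ⟨v, (issued_absorbed hout _ _).2 (Or.inr ⟨a, b, hb, hv⟩)⟩
    · exact ⟨i, (issued_absorbed hout _ _).2
        (Or.inl (h.issued_of_held a i ⟨i, hi, by omega, Or.inl rfl⟩))⟩

end Absorbed

variable {V : Type u} {a : V → Node} {l e : V} {s : Node}

/-! ### The conversations when a message is created -/

section Conversation

variable {P Q : Packet} {r M : ℕ}

theorem Conversation.stamp_le_succ (h : Conversation a l P Q r M) {y : V} {p : Packet}
    (hp : (a y).pkt = some p) : p.stamp ≤ r + 1 := by
  have h1 := h.stamp_le
  have h2 := h.eq_or_lt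
  rcases h.pkt_cases y p hp with rfl | rfl | h3
  · exact h1
  · rcases h2 with rfl | h2 <;> omega
  · rcases h2 with rfl | h2 <;> omega

theorem Conversation.stampOf_le_succ (h : Conversation a l P Q r M) (y : V) :
    stampOf (a y).pkt ≤ r + 1 := by
  rcases hp : (a y).pkt with _ | p
  · simp
  · exact h.stamp_le_succ hp

/-- The leader issues a new message after it got a reply. -/
theorem Conversation.issue [DecidableEq V] (h : Conversation a l P Q r M) (hans : ∀ s, ¬ Answers s Q.body)
    (hhalt : ∀ k, Q.body ≠ .halt k) {b : Body} (hs : s.pkt = some ⟨r + 2, b⟩)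
    (hb : SmallBody M b) :
    Conversation (Function.update a l s) l ⟨r + 2, b⟩ ⟨r + 2, b⟩ (r + 1) M := by
  have hcases : ∀ y p, (Function.update a l s y).pkt = some p →
      p = ⟨r + 2, b⟩ ∨ (a y).pkt = some p := by
    intro y p hp
    by_cases hy : y = l
    · subst hy
      rw [Function.update_self, hs] at hp
      exact Or.inl (Option.some.inj hp).symm
    · rw [Function.update_of_ne hy] at hp
      exact Or.inr hp
  constructor
  · left; rw [Function.update_self]; exact hs
  · exact Or.inl rfl
  · simp
  · simp
  · intro y p hp
    rcases hcases y p hp with rfl | hp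
    · exact Or.inl rfl
    · have := h.stamp_le_succ hp
      right; right
      simp only
      omega
  · intro x hx y p hp hax
    rcases hcases y p hp with rfl | hp
    · exact Or.inr rfl
    · rw [Function.update_of_ne hx] at hax ⊢
      rcases h.outdated x hx y p hp hax with h1 | rfl
      · exact Or.inl h1
      · exact absurd hax (hans _)
  · intro y p hp
    rcases hcases y p hp with rfl | hp
    · exact hb
    · exact h.small y p hp
  · intro y p k hp hk
    rcases hcases y p hp with rfl | hp
    · rfl
    · have := h.halt_eq y p k hp hk
      subst this
      exact absurd hk (hhalt k)
  · exact ⟨l, by rw [Function.update_self]; exact hs⟩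

/-- The leader proceeds after it got a reply, without issuing a new message. -/
theorem Conversation.keep [DecidableEq V] (h : Conversation a l P Q r M) (hl : (a l).pkt = some Q)
    (hs : s.pkt = some Q) : Conversation (Function.update a l s) l Q Q (r + 1) M := by
  have hpkt : ∀ y, (Function.update a l s y).pkt = (a y).pkt := by
    intro y
    by_cases hy : y = l
    · subst hy
      rw [Function.update_self, hs, hl]
    · rw [Function.update_of_ne hy]
  constructor
  · left; rw [hpkt, hl]
  · exact Or.inl rfl
  · rcases h.eq_or_lt with rfl | h1
    · exact h.stamp_pos
    · omega
  · have := h.stamp_le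
    omega
  · intro y p hp
    rw [hpkt] at hp
    rcases h.pkt_cases y p hp with rfl | rfl | h1
    · exact Or.inl rfl
    · rcases h.eq_or_lt with rfl | h2
      · exact Or.inl rfl
      · exact Or.inr (Or.inr h2)
    · right; right
      rcases h.eq_or_lt with rfl | h2
      · exact h1
      · exact h1.trans h2
  · intro x hx y p hp hax
    rw [hpkt] at hp
    rw [Function.update_of_ne hx] at hax ⊢
    exact h.outdated x hx y p hp hax
  · intro y p hp
    rw [hpkt] at hp
    exact h.small y p hp
  · intro y p k hp
    rw [hpkt] at hp
    exact h.halt_eq y p k hp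
  · exact ⟨l, by rw [hpkt, hl]⟩

/-- The addressee of a request replies. -/
theorem Conversation.reply [DecidableEq V] (h : Conversation a l P P r M) (he : e ≠ l)
    (huniq : ∀ x, x ≠ l → Answers (a x) P.body → x = e) (hhalt : ∀ k, P.body ≠ .halt k)
    {b : Body} (hs : s.pkt = some ⟨r + 2, b⟩) (hb : SmallBody M b) :
    Conversation (Function.update a e s) l P ⟨r + 2, b⟩ (r + 1) M := by
  have hcases : ∀ y p, (Function.update a e s y).pkt = some p →
      p = ⟨r + 2, b⟩ ∨ (a y).pkt = some p := by
    intro y p hp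
    by_cases hy : y = e
    · subst hy
      rw [Function.update_self, hs] at hp
      exact Or.inl (Option.some.inj hp).symm
    · rw [Function.update_of_ne hy] at hp
      exact Or.inr hp
  constructor
  · left
    rw [Function.update_of_ne he.symm]
    simpa using h.leader_pkt
  · right
    have := h.stamp_le
    simp only
    omega
  · exact h.stamp_pos
  · simp
  · intro y p hp
    rcases hcases y p hp with rfl | hp
    · exact Or.inl rfl
    · have := h.pkt_cases y p hp
      tauto
  · intro x hx y p hp hax
    rcases hcases y p hp with rfl | hq
    · exact Or.inr rfl
    · left
      -- The addressee now has a newer stamp than every other message. All other nodes are not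
      -- addressed by `P`, so for them `P` may cease to be the latest message.
      by_cases hxe : x = e
      · subst hxe
        rw [Function.update_self, hs]
        have := h.stamp_le_succ hq
        simp only [stampOf_some]
        omega
      · rw [Function.update_of_ne hxe] at hax ⊢
        rcases h.outdated x hx y p hq hax with h1 | rfl
        · exact h1
        · exact absurd (huniq x hx hax) hxe
  · intro y p hp
    rcases hcases y p hp with rfl | hp
    · exact hb
    · exact h.small y p hp
  · intro y p k hp hk
    rcases hcases y p hp with rfl | hp
    · rfl
    · have := h.halt_eq y p k hp hk
      subst this
      exact absurd hk (hhalt k)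
  · exact ⟨e, by rw [Function.update_self]; exact hs⟩

end Conversation

/-! ### The state of the naming when a message is created -/

section Naming

theorem low_update [DecidableEq V] {τ d t : ℕ} {b : Body}
    (h : ∀ x p, (a x).pkt = some p → τ ≤ p.stamp → Low d p.body)
    (hs : s.pkt = some ⟨t, b⟩) (hb : Low d b) :
    ∀ x p, (Function.update a e s x).pkt = some p → τ ≤ p.stamp → Low d p.body := by
  intro x p hp hτ
  by_cases hx : x = e
  · subst hx
    rw [Function.update_self, hs] at hp
    rw [← Option.some.inj hp]
    exact hb
  · rw [Function.update_of_ne hx] at hp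
    exact h x p hp hτ

theorem stampOf_update [DecidableEq V] {t : ℕ} {b : Body} (hs : s.pkt = some ⟨t, b⟩)
    (ht : stampOf (a e).pkt ≤ t) (x : V) :
    stampOf (a x).pkt ≤ stampOf (Function.update a e s x).pkt := by
  by_cases hx : x = e
  · subst hx
    rw [Function.update_self, hs]
    exact ht
  · rw [Function.update_of_ne hx]

theorem fields_update [DecidableEq V] (h1 : s.name = (a e).name) (h2 : s.rejected = (a e).rejected)
    (h3 : s.active = (a e).active) (h4 : s.given = (a e).given) (x : V) :
    (Function.update a e s x).name = (a x).name ∧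
      (Function.update a e s x).rejected = (a x).rejected ∧
      (Function.update a e s x).active = (a x).active ∧
      (Function.update a e s x).given = (a x).given := by
  by_cases hx : x = e
  · subst hx
    simp [h1, h2, h3, h4]
  · simp [Function.update_of_ne hx]

variable [Fintype V]

/-- Stated as an equation of sums to avoid subtraction: only the `given` set of `e` changes, and the
number of nameless nodes does not. -/
theorem credit_update [DecidableEq V] (hn : s.name = none ↔ (a e).name = none) :
    credit (Function.update a e s) + (a e).given.card = credit a + s.given.card := by
  unfold credit
  have h1 : nameless (Function.update a e s) = nameless a := by
    unfold nameless
    congr 1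
    ext x
    simp only [Finset.mem_filter, Finset.mem_univ, true_and]
    by_cases hx : x = e
    · subst hx; simpa using hn
    · rw [Function.update_of_ne hx]
  rw [h1, ← Finset.add_sum_erase _ _ (Finset.mem_univ e),
    ← Finset.add_sum_erase _ (fun x => (a x).given.card) (Finset.mem_univ e),
    Function.update_self]
  have : ∑ x ∈ Finset.univ.erase e, (Function.update a e s x).given.card =
      ∑ x ∈ Finset.univ.erase e, (a x).given.card :=
    Finset.sum_congr rfl fun x hx => by rw [Function.update_of_ne (Finset.ne_of_mem_erase hx)]
  omega

variable {M d k f τ t : ℕ} {E : Finset ℕ} {b : Body}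

theorem Naming.update_pkt [DecidableEq V] (h : Naming a l M d k f E τ) (h1 : s.name = (a e).name)
    (h2 : s.rejected = (a e).rejected) (h3 : s.active = (a e).active)
    (h4 : s.given = (a e).given) (hs : s.pkt = some ⟨t, b⟩) (hb : Low d b)
    (ht : stampOf (a e).pkt ≤ t) : Naming (Function.update a e s) l M d k f E τ :=
  h.congr (fields_update h1 h2 h3 h4) (low_update h.low hs hb) (stampOf_update hs ht)

/-- Clearing the lists of node `j` loses nothing of this cycle. Recorded ids have residues below
`j`, so its `given` is already empty, and having an id below `d` it is not a holder, so its rejected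
ids are leftovers. -/
theorem Naming.unfreeze [DecidableEq V] {j : ℕ} (h : Naming a l M d j 0 ∅ τ) (hj : (a e).name = some j)
    (hjd : j < d) (h1 : s.name = (a e).name) (h2 : s.rejected = ∅) (h3 : s.active = some d)
    (h4 : s.given = ∅) (hs : s.pkt = some ⟨t, b⟩) (hb : Low d b)
    (ht : stampOf (a e).pkt ≤ t) (hτ : τ ≤ t) :
    Naming (Function.update a e s) l M d (j + 1) 0 ∅ τ := by
  have hname : ∀ x, (Function.update a e s x).name = (a x).name := by
    intro x
    by_cases hx : x = e
    · subst hx; simp [h1]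
    · rw [Function.update_of_ne hx]
  have hempty : (a e).given = ∅ := by
    refine Finset.eq_empty_of_forall_notMem fun y hy => ?_
    have := h.given_spec e y hy
    rw [hj] at this
    have := Option.some.inj this.2.2.2.2
    omega
  have hgiven : ∀ x, (Function.update a e s x).given = (a x).given := by
    intro x
    by_cases hx : x = e
    · subst hx; simp [h4, hempty]
    · rw [Function.update_of_ne hx]
  have hholds : ∀ x y, Holds d (Function.update a e s x) y ↔ Holds d (a x) y := by
    intro x y
    by_cases hx : x = e
    · subst hx
      unfold Holds
      rw [hname, hj]
      constructor <;>
      · rintro ⟨i, hi, hdi, -⟩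
        have := Option.some.inj hi
        omega
    · rw [Function.update_of_ne hx]
  have hissued : ∀ y, Issued (Function.update a e s) ∅ y ↔ Issued a ∅ y := by
    intro y
    simp only [Issued, hgiven]
  constructor
  · simpa only [hname] using h.name_inj
  · simpa only [hname] using h.name_surj
  · simpa only [hname] using h.name_leader
  · exact h.two_le
  · omega
  · omega
  · intro x i hi
    rw [hname]
    by_cases hx : x = e
    · subst hx
      rw [Function.update_self, h3] at hi
      exact ⟨(Option.some.inj hi).symm, j, hj, by omega, by omega⟩
    · rw [Function.update_of_ne hx] at hi
      obtain ⟨h5, i, h6, h7, h8⟩ := h.active_spec x i hi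
      exact ⟨h5, i, h6, h7, by omega⟩
  · intro _ x i hi hx
    rw [hname] at hx
    by_cases hxe : x = e
    · subst hxe
      rw [Function.update_self, h3]
    · rw [Function.update_of_ne hxe]
      have : i ≠ j := by
        rintro rfl
        exact hxe (h.name_inj _ _ _ hx hj)
      exact h.active_all rfl x i (by omega) hx
  · intro x y hy
    rw [hgiven] at hy
    rw [hname]
    have := h.given_spec x y hy
    exact ⟨this.1, this.2.1, this.2.2.1, by omega, this.2.2.2.2⟩
  · simp
  · simpa only [hissued, hholds] using h.held_of_issued
  · simpa only [hissued, hholds] using h.issued_of_held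
  · simpa only [hholds] using h.held_unique
  · intro x i hi hij
    rw [hname] at hi
    by_cases hx : x = e
    · subst hx; simp [h2]
    · rw [Function.update_of_ne hx]
      have : i ≠ j := by
        rintro rfl
        exact hx (h.name_inj _ _ _ hi hj)
      exact h.rejected_unfrozen x i hi (by omega)
  · intro x hx
    rw [hname] at hx
    by_cases hxe : x = e
    · subst hxe; simp [h2]
    · rw [Function.update_of_ne hxe]
      exact h.rejected_nameless x hx
  · simpa only [nameless, hname, hgiven] using h.card_given
  · simp
  · exact low_update h.low hs hb
  · intro x hx
    by_cases hxe : x = e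
    · subst hxe
      rw [Function.update_self, hs]
      exact hτ
    · rw [Function.update_of_ne hxe] at hx ⊢
      exact h.active_stamp x hx

/-- Node `j` stops assigning, and some of its possibly assigned ids get collected. -/
theorem Naming.freeze [DecidableEq V] {j f' : ℕ} {E' : Finset ℕ} (h : Naming a l M d d j E τ)
    (hj : (a e).name = some j) (h1 : s.name = (a e).name) (h2 : s.rejected = (a e).rejected)
    (h3 : s.active = none) (h4 : s.given ⊆ (a e).given)
    (hE : ∀ y, y ∈ (a e).given ∨ y ∈ E ↔ y ∈ s.given ∨ y ∈ E')
    (hf : f' = j ∨ f' = j + 1 ∧ s.given = ∅) (hf' : 0 < f')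
    (hprog : (∃ y, Issued a E y) ∨ ∀ z, (a z).name ≠ none)
    (hs : s.pkt = some ⟨t, b⟩) (hb : Low d b) (ht : stampOf (a e).pkt ≤ t) :
    Naming (Function.update a e s) l M d d f' E' τ := by
  have hname : ∀ x, (Function.update a e s x).name = (a x).name := by
    intro x
    by_cases hx : x = e
    · subst hx; simp [h1]
    · rw [Function.update_of_ne hx]
  have hrej : ∀ x, (Function.update a e s x).rejected = (a x).rejected := by
    intro x
    by_cases hx : x = e
    · subst hx; simp [h2]
    · rw [Function.update_of_ne hx]
  have hgiven : ∀ x, (Function.update a e s x).given ⊆ (a x).given := by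
    intro x
    by_cases hx : x = e
    · subst hx; simpa using h4
    · rw [Function.update_of_ne hx]
  have hactive : ∀ x i, (Function.update a e s x).active = some i →
      x ≠ e ∧ (a x).active = some i := by
    intro x i hi
    by_cases hx : x = e
    · subst hx
      rw [Function.update_self, h3] at hi
      simp at hi
    · rw [Function.update_of_ne hx] at hi
      exact ⟨hx, hi⟩
  -- A reported id moves from `given` to the collection of the leader, so the set of issued ids
  -- stays the same.
  have hissued : ∀ y, Issued (Function.update a e s) E' y ↔ Issued a E y := by
    intro y
    unfold Issued
    constructor
    · rintro (⟨x, hx⟩ | hy)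
      · exact Or.inl ⟨x, hgiven x hx⟩
      · rcases (hE y).2 (Or.inr hy) with hy | hy
        · exact Or.inl ⟨e, hy⟩
        · exact Or.inr hy
    · rintro (⟨x, hx⟩ | hy)
      · by_cases hxe : x = e
        · subst hxe
          rcases (hE y).1 (Or.inl hx) with hy | hy
          · exact Or.inl ⟨x, by simpa using hy⟩
          · exact Or.inr hy
        · exact Or.inl ⟨x, by rwa [Function.update_of_ne hxe]⟩
      · rcases (hE y).1 (Or.inr hy) with hy | hy
        · exact Or.inl ⟨e, by simpa using hy⟩
        · exact Or.inr hy
  have hnej : ∀ x i, x ≠ e → (a x).name = some i → i ≠ j := by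
    rintro x i hx hi rfl
    exact hx (h.name_inj _ _ _ hi hj)
  constructor
  · simpa only [hname] using h.name_inj
  · simpa only [hname] using h.name_surj
  · simpa only [hname] using h.name_leader
  · exact h.two_le
  · exact h.unfrozen_pos
  · exact le_rfl
  · intro x i hi
    rw [hname]
    obtain ⟨hx, hi⟩ := hactive x i hi
    obtain ⟨h5, i, h6, h7, h8⟩ := h.active_spec x i hi
    have := hnej x i hx h6
    exact ⟨h5, i, h6, by omega, by omega⟩
  · omega
  · intro x y hy
    have := h.given_spec x y (hgiven x hy)
    rw [hname]
    refine ⟨this.1, this.2.1, ?_, this.2.2.2.1, this.2.2.2.2⟩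
    rcases hf with rfl | ⟨rfl, hf⟩
    · exact this.2.2.1
    · have hx : x ≠ e := by
        rintro rfl
        rw [Function.update_self, hf] at hy
        simp at hy
      have := hnej x _ hx this.2.2.2.2
      omega
  · intro y hy
    have key : ∀ x, (a x).active = none → (Function.update a e s x).active = none := by
      intro x hx
      by_cases hxe : x = e
      · subst hxe; simp [h3]
      · rw [Function.update_of_ne hxe, hx]
    rcases (hE y).2 (Or.inr hy) with hy | hy
    · have := h.given_spec e y hy
      refine ⟨this.1, this.2.1, fun x hx => ?_⟩
      rw [hname] at hx
      obtain rfl := h.name_inj _ _ _ hx this.2.2.2.2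
      simp [h3]
    · have := h.extra_spec y hy
      refine ⟨this.1, this.2.1, fun x hx => ?_⟩
      rw [hname] at hx
      exact key x (this.2.2 x hx)
  · simpa only [hissued, Holds, hname, hrej] using h.held_of_issued
  · simpa only [hissued, Holds, hname, hrej] using h.issued_of_held
  · simpa only [Holds, hname, hrej] using h.held_unique
  · simpa only [hname, hrej] using h.rejected_unfrozen
  · simpa only [hname, hrej] using h.rejected_nameless
  · intro x
    refine le_trans (Nat.add_le_add_right (Finset.card_le_card (hgiven x)) _) ?_
    simpa only [nameless, hname] using h.card_given x
  · intro _
    simpa only [hissued, hname] using hprog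
  · exact low_update h.low hs hb
  · intro x hx
    obtain ⟨i, hi⟩ := Option.ne_none_iff_exists'.1 hx
    obtain ⟨hxe, hi⟩ := hactive x i hi
    rw [Function.update_of_ne hxe]
    exact h.active_stamp x (by rw [hi]; simp)

theorem Naming.given_eq_empty (h : Naming a l M d d d E τ) (x : V) : (a x).given = ∅ := by
  refine Finset.eq_empty_of_forall_notMem fun y hy => ?_
  have := h.given_spec x y hy
  omega

/-- All assignments have been collected. -/
theorem Naming.toRenaming (h : Naming a l M d d d E τ) (hE : E.Nonempty) :
    Renaming a l M d d E := by
  have hd := h.two_le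
  -- By now every node with a consecutive id has been unfrozen and has an empty list, and so has
  -- every nameless node. So an answer to a seek can only come from a holder of this cycle.
  have hans : ∀ z y, y ∈ E → ((a z).name = some y ∨ y ∈ (a z).rejected) → Holds d (a z) y := by
    intro z y hy hz
    have hdy := (h.extra_spec y hy).1
    rcases hz with hz | hz
    · exact ⟨y, hz, hdy, Or.inl rfl⟩
    · rcases hn : (a z).name with _ | i
      · rw [h.rejected_nameless z hn] at hz
        simp at hz
      · by_cases hi : i < d
        · rw [h.rejected_unfrozen z i hn hi] at hz
          simp at hz
        · exact ⟨i, hn, by omega, Or.inr hz⟩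
  have hmem : ∀ z i, (a z).name = some i → d ≤ i → i ∈ E := by
    intro z i hi hdi
    rcases h.issued_of_held z i ⟨i, hi, hdi, Or.inl rfl⟩ with ⟨x, hx⟩ | hi
    · rw [h.given_eq_empty] at hx
      simp at hx
    · exact hi
  constructor
  · exact h.name_inj
  · exact h.name_surj
  · exact h.name_leader
  · exact h.rejected_unfrozen l 0 h.name_leader (by omega)
  · exact hd
  · exact le_rfl
  · intro x
    by_contra hx
    obtain ⟨i, hi⟩ := Option.ne_none_iff_exists'.1 hx
    obtain ⟨-, i, -, h1, h2⟩ := h.active_spec x i hi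
    omega
  · exact h.given_eq_empty
  · exact fun y hy => (h.extra_spec y hy).1
  · exact fun y hy => (h.extra_spec y hy).2.1
  · intro y hy
    obtain ⟨z, i, hi, hdi, hyi⟩ := h.held_of_issued y (Or.inr hy)
    refine ⟨z, ?_⟩
    rcases hyi with rfl | hyi
    · exact Or.inl hi
    · exact Or.inr hyi
  · intro y hy z z' hz hz'
    exact h.held_unique z z' y (hans z y hy hz) (hans z' y hy hz')
  · intro z y hz
    by_cases hy : y < d
    · exact Or.inl hy
    · exact Or.inr (hmem z y hz (by omega))
  · exact h.rejected_nameless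
  · right
    obtain ⟨y, hy⟩ := hE
    obtain ⟨z, i, hi, hdi, -⟩ := h.held_of_issued y (Or.inr hy)
    exact ⟨z, i, hi, hmem z i hi hdi⟩

/-- If no ids were assigned in a cycle, then all nodes have consecutive ids. -/
theorem Naming.complete (h : Naming a l M d d d ∅ τ) :
    d = Fintype.card V ∧ ∀ x, ∃ i, (a x).name = some i ∧ i < d := by
  have hnot : ∀ y, ¬ Issued a ∅ y := by
    rintro y (⟨x, hx⟩ | hy)
    · rw [h.given_eq_empty] at hx
      simp at hx
    · simp at hy
  have hd := h.two_le
  have hall : ∀ x, ∃ i, (a x).name = some i ∧ i < d := by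
    intro x
    rcases h.progress (by omega) with ⟨y, hy⟩ | h1
    · exact absurd hy (hnot y)
    · obtain ⟨i, hi⟩ := Option.ne_none_iff_exists'.1 (h1 x)
      refine ⟨i, hi, ?_⟩
      by_contra hlt
      exact hnot i (h.issued_of_held x i ⟨i, hi, by omega, Or.inl rfl⟩)
  refine ⟨le_antisymm (count_le_card h.name_surj) ?_, hall⟩
  choose g hg hgd using hall
  have : Function.Injective fun x => (⟨g x, hgd x⟩ : Fin d) := by
    intro x y hxy
    have : g x = g y := congrArg Fin.val hxy
    exact h.name_inj x y (g x) (hg x) (by rw [this]; exact hg y)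
  simpa using Fintype.card_le_of_injective _ this

/-- A new cycle begins. -/
theorem Renaming.newCycle [DecidableEq V] {m : ℕ} (h : Renaming a l M d m ∅) (h1 : s.name = (a l).name)
    (h2 : s.rejected = (a l).rejected) (h3 : s.active = some m) (h4 : s.given = ∅)
    (hs : s.pkt = some ⟨t, b⟩) (hb : Low m b) (ht : ∀ x, stampOf (a x).pkt < t) :
    Naming (Function.update a l s) l M m 1 0 ∅ t := by
  have hname : ∀ x, (Function.update a l s x).name = (a x).name := by
    intro x
    by_cases hx : x = l
    · subst hx; simp [h1]
    · rw [Function.update_of_ne hx]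
  have hrej : ∀ x, (Function.update a l s x).rejected = (a x).rejected := by
    intro x
    by_cases hx : x = l
    · subst hx; simp [h2]
    · rw [Function.update_of_ne hx]
  have hgiven : ∀ x, (Function.update a l s x).given = ∅ := by
    intro x
    by_cases hx : x = l
    · subst hx; simpa using h4
    · rw [Function.update_of_ne hx]; exact h.given_empty x
  have hactive : ∀ x, (Function.update a l s x).active ≠ none → x = l := by
    intro x hx
    by_contra hxl
    rw [Function.update_of_ne hxl] at hx
    exact hx (h.frozen x)
  -- Nothing remains to be dealt with, so all ids are below `m` and there are no holders at the new
  -- threshold, whatever the old lists of rejected ids contain.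
  have hholds : ∀ x y, ¬ Holds m (Function.update a l s x) y := by
    rintro x y ⟨i, hi, hmi, -⟩
    rw [hname] at hi
    rcases h.name_cases x i hi with h5 | h5
    · omega
    · simp at h5
  have hm := h.two_le
  have hdm := h.le_count
  constructor
  · simpa only [hname] using h.name_inj
  · simpa only [hname] using h.name_surj
  · simpa only [hname] using h.name_leader
  · omega
  · omega
  · omega
  · intro x i hi
    obtain rfl := hactive x (by rw [hi]; simp)
    rw [Function.update_self, h3] at hi
    exact ⟨(Option.some.inj hi).symm, 0, by rw [hname]; exact h.name_leader, le_rfl, one_pos⟩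
  · intro _ x i hi hx
    obtain rfl : i = 0 := by omega
    rw [hname] at hx
    obtain rfl := h.name_inj _ _ _ hx h.name_leader
    simp [h3]
  · intro x y hy
    rw [hgiven] at hy
    simp at hy
  · simp
  · rintro y (⟨x, hx⟩ | hy)
    · rw [hgiven] at hx
      simp at hx
    · simp at hy
  · exact fun z y hy => absurd hy (hholds z y)
  · exact fun z _ y hy => absurd hy (hholds z y)
  · intro x i hi hi1
    obtain rfl : i = 0 := by omega
    rw [hname] at hi
    obtain rfl := h.name_inj _ _ _ hi h.name_leader
    rw [hrej]
    exact h.rejected_leader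
  · simpa only [hname, hrej] using h.rejected_nameless
  · intro x
    rw [hgiven]
    simpa [nameless] using Finset.card_le_univ _
  · omega
  · intro x p hp hτ
    by_cases hx : x = l
    · subst hx
      rw [Function.update_self, hs] at hp
      rw [← Option.some.inj hp]
      exact hb
    · rw [Function.update_of_ne hx] at hp
      have := ht x
      rw [hp] at this
      simp only [stampOf_some] at this
      omega
  · intro x hx
    obtain rfl := hactive x hx
    rw [Function.update_self, hs]
    simp

end Naming

/-! ### Renaming: the effect of the replies to a seek -/

section Renaming

variable {M d m t : ℕ} {E : Finset ℕ}

theorem Renaming.update_pkt [DecidableEq V] (h : Renaming a l M d m E) (h1 : s.name = (a e).name)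
    (h2 : s.rejected = (a e).rejected) (h3 : s.active = (a e).active)
    (h4 : s.given = (a e).given) : Renaming (Function.update a e s) l M d m E :=
  h.congr (fields_update h1 h2 h3 h4)

/-- Since `e` rejected `x` and only one node answers for `x`, no node has `x` as its name. So
dropping `x` leaves no named node without a consecutive or remaining id. -/
theorem Renaming.erase {x : ℕ} (h : Renaming a l M d m E) (hx : x ∈ E)
    (h1 : (a e).name ≠ some x) (h2 : x ∈ (a e).rejected) : Renaming a l M d m (E.erase x) := by
  have hne : ∀ z y, (a z).name = some y → y ≠ x := by
    rintro z y hz rfl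
    obtain rfl := h.answer_unique y hx z e (Or.inl hz) (Or.inr h2)
    exact h1 hz
  constructor
  · exact h.name_inj
  · exact h.name_surj
  · exact h.name_leader
  · exact h.rejected_leader
  · exact h.two_le
  · exact h.le_count
  · exact h.frozen
  · exact h.given_empty
  · exact fun y hy => h.remaining_ge y (Finset.mem_of_mem_erase hy)
  · exact fun y hy => h.remaining_le y (Finset.mem_of_mem_erase hy)
  · exact fun y hy => h.answer_exists y (Finset.mem_of_mem_erase hy)
  · exact fun y hy => h.answer_unique y (Finset.mem_of_mem_erase hy)
  · intro z y hz
    exact (h.name_cases z y hz).imp_right fun h3 => Finset.mem_erase.2 ⟨hne z y hz, h3⟩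
  · exact h.rejected_nameless
  · exact h.progress.imp_right fun ⟨z, y, hz, hy⟩ =>
      ⟨z, y, hz, Finset.mem_erase.2 ⟨hne z y hz, hy⟩⟩

/-- The node with the smallest remaining id gets the next consecutive id. -/
theorem Renaming.rename [DecidableEq V] {x : ℕ} (h : Renaming a l M d m E) (hx : x ∈ E) (hmin : ∀ y ∈ E, x ≤ y)
    (hex : (a e).name = some x) (h1 : s.name = some m)
    (h2 : s.rejected = (a e).rejected) (h3 : s.active = (a e).active)
    (h4 : s.given = (a e).given) :
    Renaming (Function.update a e s) l M d (m + 1) (E.erase x) := by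
  have hmx := h.remaining_ge x hx
  have hrej : ∀ z, (Function.update a e s z).rejected = (a z).rejected := by
    intro z
    by_cases hz : z = e
    · subst hz; simp [h2]
    · rw [Function.update_of_ne hz]
  have hname : ∀ z i, (Function.update a e s z).name = some i →
      (z = e ∧ i = m) ∨ (z ≠ e ∧ (a z).name = some i ∧ i ≠ x) := by
    intro z i hz
    by_cases hze : z = e
    · subst hze
      rw [Function.update_self, h1] at hz
      exact Or.inl ⟨rfl, (Option.some.inj hz).symm⟩
    · rw [Function.update_of_ne hze] at hz
      refine Or.inr ⟨hze, hz, ?_⟩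
      rintro rfl
      exact hze (h.name_inj _ _ _ hz hex)
  -- All remaining ids are at least `m`, and `x` is the smallest. If `m` is in use as a remaining
  -- id, then `m = x`, which is the id of `e`.
  have hnem : ∀ z, z ≠ e → (a z).name ≠ some m := by
    intro z hze hz
    rcases h.name_cases z m hz with h5 | h5
    · omega
    · have := hmin m h5
      obtain rfl : m = x := by omega
      exact hze (h.name_inj _ _ _ hz hex)
  have hback : ∀ y, y ∈ E.erase x → ∀ z, (Function.update a e s z).name = some y ∨
      y ∈ (Function.update a e s z).rejected → (a z).name = some y ∨ y ∈ (a z).rejected := by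
    intro y hy z hz
    rw [hrej] at hz
    refine hz.imp_left fun hz => ?_
    rcases hname z y hz with ⟨-, rfl⟩ | h5
    · have h6 := Finset.mem_erase.1 hy
      have := hmin y h6.2
      omega
    · exact h5.2.1
  have hd := h.two_le
  have hdm := h.le_count
  have hle : l ≠ e := by
    rintro rfl
    rw [h.name_leader] at hex
    have := Option.some.inj hex
    omega
  constructor
  · intro y z i hy hz
    rcases hname y i hy with ⟨rfl, rfl⟩ | ⟨h5, h6, h7⟩ <;>
      rcases hname z i hz with ⟨rfl, h8⟩ | ⟨h8, h9, h10⟩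
    · rfl
    · exact absurd h9 (hnem z h8)
    · subst h8
      exact absurd h6 (hnem y h5)
    · exact h.name_inj _ _ _ h6 h9
  · intro i hi
    by_cases him : i = m
    · exact ⟨e, by rw [Function.update_self, h1, him]⟩
    · obtain ⟨z, hz⟩ := h.name_surj i (by omega)
      refine ⟨z, ?_⟩
      have : z ≠ e := by
        rintro rfl
        rw [hex] at hz
        have := Option.some.inj hz
        omega
      rw [Function.update_of_ne this, hz]
  · rw [Function.update_of_ne hle]
    exact h.name_leader
  · rw [hrej]; exact h.rejected_leader
  · omega
  · omega
  · intro z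
    by_cases hz : z = e
    · subst hz; rw [Function.update_self, h3]; exact h.frozen _
    · rw [Function.update_of_ne hz]; exact h.frozen z
  · intro z
    by_cases hz : z = e
    · subst hz; rw [Function.update_self, h4]; exact h.given_empty _
    · rw [Function.update_of_ne hz]; exact h.given_empty z
  · intro y hy
    have h6 := Finset.mem_erase.1 hy
    have := hmin y h6.2
    omega
  · exact fun y hy => h.remaining_le y (Finset.mem_of_mem_erase hy)
  · intro y hy
    have h6 := Finset.mem_erase.1 hy
    obtain ⟨z, hz⟩ := h.answer_exists y h6.2
    refine ⟨z, ?_⟩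
    rw [hrej]
    refine hz.imp_left fun hz => ?_
    have : z ≠ e := by
      rintro rfl
      rw [hex] at hz
      exact h6.1 (Option.some.inj hz).symm
    rw [Function.update_of_ne this, hz]
  · intro y hy z z' hz hz'
    exact h.answer_unique y (Finset.mem_of_mem_erase hy) z z' (hback y hy z hz) (hback y hy z' hz')
  · intro z y hz
    rcases hname z y hz with ⟨-, rfl⟩ | ⟨-, h5, h6⟩
    · left; omega
    · rcases h.name_cases z y h5 with h7 | h7
      · left; omega
      · exact Or.inr (Finset.mem_erase.2 ⟨h6, h7⟩)
  · intro z hz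
    rw [hrej]
    have : z ≠ e := by
      rintro rfl
      rw [Function.update_self, h1] at hz
      simp at hz
    rw [Function.update_of_ne this] at hz
    exact h.rejected_nameless z hz
  · left; omega

end Renaming

variable {V : Type u}

/-! ### The stages of the execution -/

/-- The leader has the additional variables `k`, and no node has terminated. -/
structure Roles (c : V → Node) (l : V) (k : Ctrl) : Prop where
  leader : (c l).ctrl = some k
  other : ∀ x, x ≠ l → (c x).ctrl = none
  running : ∀ x, (c x).out = none

/-- The possible situations before termination is announced. Here `h` is an upper bound for the
number of requests and replies still to come. -/
inductive Stage [Fintype V] (c : V → Node) (l : V) : Ctrl → Packet → Packet → ℕ → Prop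
  -- In the bounds on `h`, a unit of `credit` is worth four events (two to collect an id, two to
  -- seek it) and an element of `E` two. The linear term in `d` and `j` covers what remains of
  -- unfreezing and freezing. The last term pays 4n for each unit by which the count can still grow,
  -- hence for all later cycles.
  | unfreezing {d j τ t h : ℕ} {E : Finset ℕ} (hj : 1 ≤ j) (hjd : j < d)
      (hN : Naming c l (3 * Fintype.card V ^ 2) d j 0 ∅ τ) (hτ : τ ≤ t)
      (hh : 4 * credit c + 2 * (2 * d + 1 - j) + 1 +
        4 * Fintype.card V * (Fintype.card V - d) ≤ h) :
      Stage c l ⟨.unfreezing j, d, E⟩ ⟨t, .unfreeze j d⟩ ⟨t, .unfreeze j d⟩ h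
  | unfrozen {d j τ t t' h : ℕ} {E : Finset ℕ} (hj : 1 ≤ j) (hjd : j < d)
      (hN : Naming c l (3 * Fintype.card V ^ 2) d (j + 1) 0 ∅ τ) (hτ : τ ≤ t')
      (hh : 4 * credit c + 2 * (2 * d + 1 - j) +
        4 * Fintype.card V * (Fintype.card V - d) ≤ h) :
      Stage c l ⟨.unfreezing j, d, E⟩ ⟨t, .unfreeze j d⟩ ⟨t', .unfrozen j⟩ h
  | common {d j τ t h : ℕ} {E : Finset ℕ} (hjd : j < d)
      (hN : Naming c l (3 * Fintype.card V ^ 2) d d 0 ∅ τ) (hτ : τ ≤ t)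
      (hh : 4 * credit c + 2 * (d + 1) + 4 * Fintype.card V * (Fintype.card V - d) ≤ h) :
      Stage c l ⟨.common, d, E⟩ ⟨t, .unfrozen j⟩ ⟨t, .unfrozen j⟩ h
  | collecting {d j τ t h : ℕ} {E : Finset ℕ} (hj : 1 ≤ j) (hjd : j < d)
      (hN : Naming c l (3 * Fintype.card V ^ 2) d d j E τ) (hτ : τ ≤ t)
      (hh : 4 * credit c + 2 * (d - j) + 1 + 2 * E.card +
        4 * Fintype.card V * (Fintype.card V - d) ≤ h) :
      Stage c l ⟨.collecting j, d, E⟩ ⟨t, .collect j⟩ ⟨t, .collect j⟩ h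
  | collectedSome {d j τ t t' h x : ℕ} {E : Finset ℕ} (hj : 1 ≤ j) (hjd : j < d)
      (hN : Naming c l (3 * Fintype.card V ^ 2) d d j (insert x E) τ) (hτ : τ ≤ t')
      (hh : 4 * credit c + 2 * (d - j) + 4 + 2 * E.card +
        4 * Fintype.card V * (Fintype.card V - d) ≤ h) :
      Stage c l ⟨.collecting j, d, E⟩ ⟨t, .collect j⟩ ⟨t', .collected j (some x)⟩ h
  | collectedNone {d j τ t t' h : ℕ} {E : Finset ℕ} (hj : 1 ≤ j) (hjd : j < d)
      (hN : Naming c l (3 * Fintype.card V ^ 2) d d (j + 1) E τ) (hτ : τ ≤ t')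
      (hh : 4 * credit c + 2 * (d - j) + 2 * E.card +
        4 * Fintype.card V * (Fintype.card V - d) ≤ h) :
      Stage c l ⟨.collecting j, d, E⟩ ⟨t, .collect j⟩ ⟨t', .collected j none⟩ h
  | seeking {d m x t h : ℕ} {E : Finset ℕ} (hx : x ∈ E) (hmin : ∀ y ∈ E, x ≤ y)
      (hN : Renaming c l (3 * Fintype.card V ^ 2) d m E)
      (hh : 4 * credit c + 1 + 2 * E.card +
        4 * Fintype.card V * (Fintype.card V - d) ≤ h) :
      Stage c l ⟨.seeking x, m, E⟩ ⟨t, .seek x m⟩ ⟨t, .seek x m⟩ h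
  | adopted {d m x t t' h : ℕ} {E : Finset ℕ} (hx : x ∈ E)
      (hN : Renaming c l (3 * Fintype.card V ^ 2) d (m + 1) (E.erase x))
      (hh : 4 * credit c + 2 * E.card + 4 * Fintype.card V * (Fintype.card V - d) ≤ h) :
      Stage c l ⟨.seeking x, m, E⟩ ⟨t, .seek x m⟩ ⟨t', .adopted x⟩ h
  | rejected {d m x t t' h : ℕ} {E : Finset ℕ} (hx : x ∈ E)
      (hN : Renaming c l (3 * Fintype.card V ^ 2) d m (E.erase x))
      (hh : 4 * credit c + 2 * E.card + 4 * Fintype.card V * (Fintype.card V - d) ≤ h) :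
      Stage c l ⟨.seeking x, m, E⟩ ⟨t, .seek x m⟩ ⟨t', .rejected x⟩ h

/-- Termination has been announced with timestamp `t`, and no node has terminated yet. -/
structure Halting [Fintype V] (c : V → Node) (l : V) (r t : ℕ) : Prop where
  ctrl : ∃ k, Roles c l k ∧ k.phase = .stopped
  conv : Conversation c l ⟨t, .halt (Fintype.card V)⟩ ⟨t, .halt (Fintype.card V)⟩ r
    (3 * Fintype.card V ^ 2)
  name_lt : ∀ x, ∃ i, (c x).name = some i ∧ i < Fintype.card V
  name_inj : ∀ x y i, (c x).name = some i → (c y).name = some i → x = y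
  le_holders : r + 2 ≤ t + holders c ⟨t, .halt (Fintype.card V)⟩
  active_eq : ∀ x, (c x).active = none

/-- The situation after a request, a reply or an announcement has been created in round
`r + 1`, if `h` more were expected before. -/
def Next [Fintype V] (l : V) (r h : ℕ) (c : V → Node) : Prop :=
  (∃ k P Q h', h' + 1 ≤ h ∧ Roles c l k ∧
    Conversation c l P Q (r + 1) (3 * Fintype.card V ^ 2) ∧ Stage c l k P Q h') ∨
  Halting c l (r + 1) (r + 2)

theorem one_le_holders [Fintype V] {c : V → Node} {l : V} {P Q : Packet} {r M : ℕ}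
    (h : Conversation c l P Q r M) : 1 ≤ holders c Q := by
  classical
  obtain ⟨y, hy⟩ := h.exists_holder
  exact Finset.card_pos.2 ⟨y, by simpa using hy⟩

theorem finish_eq_self {t : ℕ} {s : Node} (h : ∀ p k, s.pkt = some p → p.body ≠ .halt k) :
    finish t s = s := by
  unfold finish
  split
  · next b n hp => exact absurd rfl (h _ n hp)
  · rfl

theorem finish_of_pkt {t t' : ℕ} {s : Node} {b : Body} (h : s.pkt = some ⟨t', b⟩)
    (hb : ∀ k, b ≠ .halt k) : finish t s = s :=
  finish_eq_self fun p k hp => by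
    obtain rfl := Option.some.inj (h.symm.trans hp)
    exact hb k

theorem finish_halt {t b n : ℕ} {s : Node} (h : s.pkt = some ⟨b, .halt n⟩) :
    finish t s = if b + n ≤ t then { s with out := s.name } else s := by
  unfold finish
  rw [h]

theorem respond_eq_self {t : ℕ} {s : Node} (h : ∀ p, s.pkt = some p → ¬ Answers s p.body) :
    respond t s = s := by
  rcases hp : s.pkt with _ | ⟨b, body⟩
  · unfold respond; rw [hp]
  · have := h _ hp
    unfold respond
    rw [hp]
    cases body <;> simp only [Answers] at this ⊢
    · rw [if_neg this]
    · rw [if_neg this]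
    · push Not at this
      rw [if_neg this.1, if_neg this.2]

theorem credit_update_eq [Fintype V] [DecidableEq V] {a : V → Node} {e : V} {s : Node}
    (h1 : s.name = (a e).name) (h2 : s.given = (a e).given) :
    credit (Function.update a e s) = credit a := by
  have := credit_update (a := a) (e := e) (s := s) (by rw [h1])
  rw [h2] at this
  omega

/-! ### The nodes that can react in a round -/

section Round

variable {a : V → Node} {l e : V} {s : Node} {k : Ctrl} {P Q : Packet} {r M : ℕ}

theorem Roles.update_other [DecidableEq V] (h : Roles a l k) (he : e ≠ l)
    (h1 : s.ctrl = (a e).ctrl) (h2 : s.out = (a e).out) : Roles (Function.update a e s) l k := by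
  constructor
  · rw [Function.update_of_ne he.symm]; exact h.leader
  · intro x hx
    by_cases hxe : x = e
    · subst hxe; rw [Function.update_self, h1]; exact h.other _ hx
    · rw [Function.update_of_ne hxe]; exact h.other _ hx
  · intro x
    by_cases hxe : x = e
    · subst hxe; rw [Function.update_self, h2]; exact h.running _
    · rw [Function.update_of_ne hxe]; exact h.running _

theorem Roles.update_leader [DecidableEq V] (h : Roles a l k) {k' : Ctrl}
    (h1 : s.ctrl = some k') (h2 : s.out = (a l).out) : Roles (Function.update a l s) l k' := by
  constructor
  · rw [Function.update_self]; exact h1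
  · intro x hx
    rw [Function.update_of_ne hx]; exact h.other _ hx
  · intro x
    by_cases hxe : x = l
    · subst hxe; rw [Function.update_self, h2]; exact h.running _
    · rw [Function.update_of_ne hxe]; exact h.running _

theorem Conversation.finish_eq_self (h : Conversation a l P Q r M) (hQ : ∀ k, Q.body ≠ .halt k)
    (t : ℕ) (x : V) : finish t (a x) = a x := by
  refine IndividualConversations.finish_eq_self fun p k hp hk => ?_
  have := h.halt_eq x p k hp hk
  subst this
  exact hQ k hk

theorem round_eq_update [DecidableEq V] {t : ℕ} (hne : ∀ x, x ≠ e → react t (a x) = a x)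
    (hfin : ∀ x, finish t (a x) = a x) (hs : react t (a e) = s) (hsf : finish t s = s) :
    (fun x => finish t (react t (a x))) = Function.update a e s := by
  funext x
  by_cases hx : x = e
  · subst hx; rw [Function.update_self, hs, hsf]
  · rw [Function.update_of_ne hx, hne x hx, hfin]

/-- Only the addressee reacts to a request, once it has arrived. -/
theorem Conversation.react_request (h : Conversation a l P P r M) (hR : Roles a l k) {t : ℕ}
    (hlead : lead t (a l) k = a l)
    (huniq : ∀ x, x ≠ l → Answers (a x) P.body → x = e) :
    (∀ x, x ≠ e → react t (a x) = a x) ∧ ((a e).pkt ≠ some P → ∀ x, react t (a x) = a x) := by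
  have key : ∀ x, (x ≠ e ∨ (a e).pkt ≠ some P) → react t (a x) = a x := by
    intro x hx
    by_cases hxl : x = l
    · subst hxl
      unfold react
      rw [hR.leader]
      exact hlead
    · unfold react
      rw [hR.other x hxl]
      refine respond_eq_self fun p hp hans => ?_
      rcases h.outdated x hxl x p hp hans with h1 | rfl
      · rw [hp] at h1
        simp at h1
      · have := huniq x hxl hans
        subst this
        rcases hx with hx | hx
        · exact hx rfl
        · exact hx hp
  exact ⟨fun x hx => key x (Or.inl hx), fun hx x => key x (Or.inr hx)⟩

/-- Only the leader reacts to a reply, once it has arrived. -/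
theorem Conversation.react_reply (h : Conversation a l P Q r M) (hR : Roles a l k) {t : ℕ}
    (hlead : (a l).pkt = some P → lead t (a l) k = a l) (hans : ∀ s, ¬ Answers s Q.body) :
    (∀ x, x ≠ l → react t (a x) = a x) ∧ ((a l).pkt ≠ some Q → ∀ x, react t (a x) = a x) := by
  have key : ∀ x, x ≠ l → react t (a x) = a x := by
    intro x hxl
    unfold react
    rw [hR.other x hxl]
    refine respond_eq_self fun p hp hans' => ?_
    rcases h.outdated x hxl x p hp hans' with h1 | rfl
    · rw [hp] at h1
      simp at h1
    · exact hans _ hans'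
  refine ⟨key, fun hl x => ?_⟩
  by_cases hxl : x = l
  · subst hxl
    unfold react
    rw [hR.leader]
    exact hlead (h.leader_pkt.resolve_right hl)
  · exact key x hxl

/-- While the leader waits for a reply, it keeps its own message. -/
theorem Conversation.leader_pkt_eq (h : Conversation a l P P r M) : (a l).pkt = some P := by
  simpa using h.leader_pkt

end Round

/-! ### What each stage leads to -/

section Events

variable [Fintype V] {a : V → Node} {l : V} {k : Ctrl} {r : ℕ}

/-- Either nothing happens in a round except that messages are forwarded, or a message
is created. -/
def Outcome (a : V → Node) (l : V) (Q : Packet) (r h : ℕ) : Prop :=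
  ((∀ x, react (r + 2) (a x) = a x) ∧ ∃ x, (a x).pkt ≠ some Q) ∨
    Next l r h fun x => finish (r + 2) (react (r + 2) (a x))

theorem card_le_sq : Fintype.card V ≤ 3 * Fintype.card V ^ 2 := by
  nlinarith [Nat.le_mul_self (Fintype.card V)]

/-- The pattern for every request: the invariant yields one addressee `e`, different from the
leader. Until `e` has the message nobody reacts, and `e` itself is a node without the message; once
`e` has it, the round changes only `e`. -/
theorem outcome_unfreezing [DecidableEq V] {d j τ t h : ℕ} {E : Finset ℕ} (hj : 1 ≤ j)
    (hjd : j < d) (hN : Naming a l (3 * Fintype.card V ^ 2) d j 0 ∅ τ) (hτ : τ ≤ t)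
    (hh : 4 * credit a + 2 * (2 * d + 1 - j) + 1 +
      4 * Fintype.card V * (Fintype.card V - d) ≤ h)
    (hR : Roles a l ⟨.unfreezing j, d, E⟩)
    (hC : Conversation a l ⟨t, .unfreeze j d⟩ ⟨t, .unfreeze j d⟩ r (3 * Fintype.card V ^ 2)) :
    Outcome a l ⟨t, .unfreeze j d⟩ r h := by
  obtain ⟨e, he⟩ := hN.name_surj j hjd
  have hel : e ≠ l := by
    rintro rfl
    rw [hN.name_leader] at he
    have := Option.some.inj he
    omega
  have hn := count_le_card hN.name_surj
  have hM := card_le_sq (V := V)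
  have huniq : ∀ x, x ≠ l → Answers (a x) (.unfreeze j d) → x = e :=
    fun x _ hx => hN.name_inj _ _ _ hx he
  obtain ⟨h1, h2⟩ := hC.react_request hR (t := r + 2) (e := e)
    (by unfold lead; rw [hC.leader_pkt_eq]) huniq
  by_cases hpe : (a e).pkt = some ⟨t, .unfreeze j d⟩
  · have hreact : react (r + 2) (a e) = { a e with
        active := some d, given := ∅, rejected := ∅, pkt := some ⟨r + 2, .unfrozen j⟩ } := by
      unfold react respond
      rw [hR.other e hel, hpe]
      simp [he, hR.other e hel]
    have hst := hC.stampOf_le_succ e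
    have hst' := hC.stamp_le
    simp only at hst'
    refine Or.inr ?_
    dsimp only at hreact
    rw [round_eq_update h1 (hC.finish_eq_self (by simp) _) hreact (finish_of_pkt rfl (by simp))]
    refine Or.inl ⟨_, _, _, h - 1, by omega, hR.update_other hel rfl rfl,
      hC.reply hel huniq (by simp) rfl (by simp only [SmallBody]; omega),
      .unfrozen hj hjd (hN.unfreeze he hjd rfl rfl rfl rfl rfl (by simp [Low]) (by omega)
        (by omega)) (by omega) ?_⟩
    have := credit_update (a := a) (e := e) (s := { a e with
        active := some d, given := ∅, rejected := ∅, pkt := some ⟨r + 2, .unfrozen j⟩ }) Iff.rfl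
    simp only [Finset.card_empty] at this
    omega
  · exact Or.inl ⟨h2 hpe, e, hpe⟩

/-- After the last confirmation the leader enters the common round without a new message. This still
counts as one event, and the old reply then plays both roles `P` and `Q`. -/
theorem outcome_unfrozen [DecidableEq V] {d j τ t t' h : ℕ} {E : Finset ℕ} (hj : 1 ≤ j)
    (hjd : j < d) (hN : Naming a l (3 * Fintype.card V ^ 2) d (j + 1) 0 ∅ τ) (hτ : τ ≤ t')
    (hh : 4 * credit a + 2 * (2 * d + 1 - j) +
      4 * Fintype.card V * (Fintype.card V - d) ≤ h)
    (hR : Roles a l ⟨.unfreezing j, d, E⟩)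
    (hC : Conversation a l ⟨t, .unfreeze j d⟩ ⟨t', .unfrozen j⟩ r (3 * Fintype.card V ^ 2)) :
    Outcome a l ⟨t', .unfrozen j⟩ r h := by
  have hn := count_le_card hN.name_surj
  have hM := card_le_sq (V := V)
  obtain ⟨h1, h2⟩ := hC.react_reply hR (t := r + 2)
    (by intro hp; unfold lead; rw [hp]) (by simp [Answers])
  have hst := hC.stampOf_le_succ l
  have hst' := hC.stamp_le
  simp only at hst'
  by_cases hpl : (a l).pkt = some ⟨t', .unfrozen j⟩
  · refine Or.inr ?_
    have hreact : react (r + 2) (a l) =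
        goUnfreeze (r + 2) (a l) ⟨.unfreezing j, d, E⟩ (j + 1) := by
      unfold react lead
      rw [hR.leader, hpl]
      simp
    unfold goUnfreeze at hreact
    simp only at hreact
    split_ifs at hreact with hlt
    · rw [round_eq_update h1 (hC.finish_eq_self (by simp) _) hreact (finish_of_pkt rfl (by simp))]
      refine Or.inl ⟨_, _, _, h - 1, by omega, hR.update_leader rfl rfl,
        hC.issue (by simp [Answers]) (by simp) rfl (by simp only [SmallBody]; omega),
        .unfreezing (by omega) hlt (hN.update_pkt rfl rfl rfl rfl rfl (by simpa [Low] using hlt)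
          (by omega)) (by omega) ?_⟩
      rw [credit_update_eq (by rfl) (by rfl)]
      omega
    · obtain rfl : d = j + 1 := by omega
      rw [round_eq_update h1 (hC.finish_eq_self (by simp) _) hreact
        (finish_of_pkt hpl (by simp))]
      refine Or.inl ⟨_, _, _, h - 1, by omega, hR.update_leader rfl rfl,
        hC.keep hpl hpl,
        .common hjd (hN.update_pkt rfl rfl rfl rfl hpl (by simp [Low])
          (by rw [hpl]; simp)) (by omega) ?_⟩
      rw [credit_update_eq (by rfl) (by rfl)]
      omega
  · exact Or.inl ⟨h2 hpl, l, hpl⟩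

/-- This stage never waits. The leader freezes itself and moves its own recorded ids to the pool
without any message; each of them gives up four units and needs only two for its seek. `hprog` is
recorded here because only in this round all consecutive ids are assigning. -/
theorem outcome_common [DecidableEq V] {d j τ t h : ℕ} {E : Finset ℕ} (hjd : j < d)
    (hN : Naming a l (3 * Fintype.card V ^ 2) d d 0 ∅ τ) (hτ : τ ≤ t)
    (hprog : (∃ y, Issued a ∅ y) ∨ ∀ z, (a z).name ≠ none)
    (hh : 4 * credit a + 2 * (d + 1) + 4 * Fintype.card V * (Fintype.card V - d) ≤ h)
    (hR : Roles a l ⟨.common, d, E⟩)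
    (hC : Conversation a l ⟨t, .unfrozen j⟩ ⟨t, .unfrozen j⟩ r (3 * Fintype.card V ^ 2)) :
    Outcome a l ⟨t, .unfrozen j⟩ r h := by
  have hn := count_le_card hN.name_surj
  have hM := card_le_sq (V := V)
  have hd := hN.two_le
  have h1 : ∀ x, x ≠ l → react (r + 2) (a x) = a x := by
    intro x hx
    unfold react
    rw [hR.other x hx]
    refine respond_eq_self fun p hp hans => ?_
    rcases hC.outdated x hx x p hp hans with h1 | rfl
    · rw [hp] at h1
      simp at h1
    · simp [Answers] at hans
  have hst := hC.stampOf_le_succ l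
  have hst' := hC.stamp_le
  simp only at hst'
  refine Or.inr ?_
  have hreact : react (r + 2) (a l) = { a l with
      active := none, given := ∅, pkt := some ⟨r + 2, .collect 1⟩,
      ctrl := some ⟨.collecting 1, d, (a l).given⟩ } := by
    unfold react lead goCollect
    rw [hR.leader]
    simp only
    rw [if_pos (by omega)]
  dsimp only at hreact
  rw [round_eq_update h1 (hC.finish_eq_self (by simp) _) hreact (finish_of_pkt rfl (by simp))]
  have hcr := credit_update (a := a) (e := l) (s := { a l with
      active := none, given := ∅, pkt := some ⟨r + 2, .collect 1⟩,
      ctrl := some ⟨.collecting 1, d, (a l).given⟩ }) Iff.rfl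
  simp only [Finset.card_empty] at hcr
  refine Or.inl ⟨_, _, _, h - 1, by omega, hR.update_leader rfl rfl,
    hC.issue (by simp [Answers]) (by simp) rfl (by simp only [SmallBody]; omega),
    .collecting (τ := τ) le_rfl (by omega) (hN.freeze hN.name_leader rfl rfl rfl (by simp)
      (by simp) (Or.inr ⟨rfl, rfl⟩) one_pos hprog rfl (by simp only [Low]; omega) (by omega))
      (by omega) (by omega)⟩

/-- A reported id lowers `credit` by one. The four units set free pay for the report, for the
repeated request to the same node, and for the later seek and its reply. -/
theorem outcome_collecting [DecidableEq V] {d j τ t h : ℕ} {E : Finset ℕ} (hj : 1 ≤ j)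
    (hjd : j < d) (hN : Naming a l (3 * Fintype.card V ^ 2) d d j E τ) (hτ : τ ≤ t)
    (hh : 4 * credit a + 2 * (d - j) + 1 + 2 * E.card +
      4 * Fintype.card V * (Fintype.card V - d) ≤ h)
    (hR : Roles a l ⟨.collecting j, d, E⟩)
    (hC : Conversation a l ⟨t, .collect j⟩ ⟨t, .collect j⟩ r (3 * Fintype.card V ^ 2)) :
    Outcome a l ⟨t, .collect j⟩ r h := by
  obtain ⟨e, he⟩ := hN.name_surj j hjd
  have hel : e ≠ l := by
    rintro rfl
    rw [hN.name_leader] at he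
    have := Option.some.inj he
    omega
  have hn := count_le_card hN.name_surj
  have hM := card_le_sq (V := V)
  have huniq : ∀ x, x ≠ l → Answers (a x) (.collect j) → x = e :=
    fun x _ hx => hN.name_inj _ _ _ hx he
  obtain ⟨h1, h2⟩ := hC.react_request hR (t := r + 2) (e := e)
    (by unfold lead; rw [hC.leader_pkt_eq]) huniq
  have hst := hC.stampOf_le_succ e
  have hst' := hC.stamp_le
  simp only at hst'
  by_cases hpe : (a e).pkt = some ⟨t, .collect j⟩
  · refine Or.inr ?_
    rcases (a e).given.eq_empty_or_nonempty with hg | hg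
    · have hreact : react (r + 2) (a e) = { a e with
          active := none, pkt := some ⟨r + 2, .collected j none⟩ } := by
        unfold react respond
        rw [hR.other e hel, hpe]
        simp [he, hg, hR.other e hel]
      dsimp only at hreact
      rw [round_eq_update h1 (hC.finish_eq_self (by simp) _) hreact (finish_of_pkt rfl (by simp))]
      refine Or.inl ⟨_, _, _, h - 1, by omega, hR.update_other hel rfl rfl,
        hC.reply hel huniq (by simp) rfl (by simp [SmallBody]; omega),
        .collectedNone (τ := τ) hj hjd (hN.freeze he rfl rfl rfl (by simp)
          (by simp) (Or.inr ⟨rfl, hg⟩) (by omega) (hN.progress hj) rfl (by simp [Low])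
          (by omega)) (by omega) ?_⟩
      rw [credit_update_eq (by rfl) (by rfl)]
      omega
    · have hmem := Finset.min'_mem _ hg
      set x := (a e).given.min' hg with hx
      have hreact : react (r + 2) (a e) = { a e with
          active := none, given := (a e).given.erase x,
          pkt := some ⟨r + 2, .collected j (some x)⟩ } := by
        unfold react respond
        rw [hR.other e hel, hpe]
        simp only
        rw [if_pos he, ← Finset.coe_min' hg]
        simp only [hR.other e hel]
        rfl
      dsimp only at hreact
      rw [round_eq_update h1 (hC.finish_eq_self (by simp) _) hreact (finish_of_pkt rfl (by simp))]
      have hcr := credit_update (a := a) (e := e) (s := { a e with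
          active := none, given := (a e).given.erase x,
          pkt := some ⟨r + 2, .collected j (some x)⟩ }) Iff.rfl
      have hcard := Finset.card_erase_add_one hmem
      simp only at hcr
      have hxM := (hN.given_spec e x hmem).2.1
      refine Or.inl ⟨_, _, _, h - 1, by omega, hR.update_other hel rfl rfl,
        hC.reply hel huniq (by simp) rfl (by simp [SmallBody]; omega),
        .collectedSome (τ := τ) hj hjd (hN.freeze he rfl rfl rfl (Finset.erase_subset _ _)
          (fun y => ?_) (Or.inl rfl) (by omega) (hN.progress hj) rfl (by simp [Low])
          (by omega)) (by omega) (by omega)⟩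
      simp only [Finset.mem_erase, Finset.mem_insert]
      by_cases hyx : y = x
      · subst hyx; simp [hmem]
      · simp [hyx]
  · exact Or.inl ⟨h2 hpe, e, hpe⟩

theorem outcome_collectedSome [DecidableEq V] {d j τ t t' h x : ℕ} {E : Finset ℕ} (hj : 1 ≤ j)
    (hjd : j < d) (hN : Naming a l (3 * Fintype.card V ^ 2) d d j (insert x E) τ) (hτ : τ ≤ t')
    (hh : 4 * credit a + 2 * (d - j) + 4 + 2 * E.card +
      4 * Fintype.card V * (Fintype.card V - d) ≤ h)
    (hR : Roles a l ⟨.collecting j, d, E⟩)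
    (hC : Conversation a l ⟨t, .collect j⟩ ⟨t', .collected j (some x)⟩ r
      (3 * Fintype.card V ^ 2)) :
    Outcome a l ⟨t', .collected j (some x)⟩ r h := by
  have hn := count_le_card hN.name_surj
  have hM := card_le_sq (V := V)
  obtain ⟨h1, h2⟩ := hC.react_reply hR (t := r + 2)
    (by intro hp; unfold lead; rw [hp]) (by simp [Answers])
  have hst := hC.stampOf_le_succ l
  have hst' := hC.stamp_le
  simp only at hst'
  by_cases hpl : (a l).pkt = some ⟨t', .collected j (some x)⟩
  · refine Or.inr ?_
    have hreact : react (r + 2) (a l) = { a l with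
        pkt := some ⟨r + 2, .collect j⟩, ctrl := some ⟨.collecting j, d, insert x E⟩ } := by
      unfold react lead goCollect
      rw [hR.leader, hpl]
      simp [hjd]
    dsimp only at hreact
    rw [round_eq_update h1 (hC.finish_eq_self (by simp) _) hreact (finish_of_pkt rfl (by simp))]
    refine Or.inl ⟨_, _, _, h - 1, by omega, hR.update_leader rfl rfl,
      hC.issue (by simp [Answers]) (by simp) rfl (by simp only [SmallBody]; omega),
      .collecting (τ := τ) hj hjd (hN.update_pkt rfl rfl rfl rfl rfl (by simpa [Low] using hjd)
        (by omega)) (by omega) ?_⟩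
    rw [credit_update_eq (by rfl) (by rfl)]
    have := Finset.card_insert_le x E
    omega
  · exact Or.inl ⟨h2 hpl, l, hpl⟩

/-- The leader sends a request for the smallest of the remaining ids. -/
theorem next_goSeek [DecidableEq V] {d m h : ℕ} {E : Finset ℕ} {P Q : Packet}
    (hN : Renaming a l (3 * Fintype.card V ^ 2) d m E) (hE : E.Nonempty) {p : Phase}
    (hh : 4 * credit a + 2 * E.card + 4 * Fintype.card V * (Fintype.card V - d) + 2 ≤ h)
    (hR : Roles a l k) (hC : Conversation a l P Q r (3 * Fintype.card V ^ 2))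
    (hQ : ∀ s, ¬ Answers s Q.body) (hQ' : ∀ k, Q.body ≠ .halt k)
    (hne : ∀ x, x ≠ l → react (r + 2) (a x) = a x)
    (hreact : react (r + 2) (a l) = goSeek (r + 2) (a l) ⟨p, m, E⟩) :
    Next l r h fun x => finish (r + 2) (react (r + 2) (a x)) := by
  have hn := count_le_card hN.name_surj
  have hM := card_le_sq (V := V)
  have hmem := Finset.min'_mem _ hE
  have hmin := fun y hy => Finset.min'_le E y hy
  set x := E.min' hE with hx
  unfold goSeek at hreact
  rw [← Finset.coe_min' hE] at hreact
  simp only at hreact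
  rw [round_eq_update hne (hC.finish_eq_self hQ' _) hreact (finish_of_pkt rfl (by simp))]
  have hxM := hN.remaining_le x hmem
  refine Or.inl ⟨_, _, _, h - 1, by omega, hR.update_leader rfl rfl,
    hC.issue hQ hQ' rfl (by simp only [SmallBody]; omega),
    .seeking hmem hmin (hN.update_pkt rfl rfl rfl rfl) ?_⟩
  rw [credit_update_eq (by rfl) (by rfl)]
  omega

/-- The leader continues after an id has been dealt with. -/
theorem next_goSeek_or_newCycle [DecidableEq V] {d m h : ℕ} {E : Finset ℕ} {P Q : Packet}
    (hN : Renaming a l (3 * Fintype.card V ^ 2) d m E) {p : Phase}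
    (hh : 4 * credit a + 2 * E.card + 4 * Fintype.card V * (Fintype.card V - d) + 2 ≤ h)
    (hR : Roles a l k) (hC : Conversation a l P Q r (3 * Fintype.card V ^ 2))
    (hQ : ∀ s, ¬ Answers s Q.body) (hQ' : ∀ k, Q.body ≠ .halt k)
    (hne : ∀ x, x ≠ l → react (r + 2) (a x) = a x)
    (hreact : react (r + 2) (a l) = goSeek (r + 2) (a l) ⟨p, m, E⟩) :
    Next l r h fun x => finish (r + 2) (react (r + 2) (a x)) := by
  rcases E.eq_empty_or_nonempty with rfl | hE
  · have hn := count_le_card hN.name_surj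
    have hM := card_le_sq (V := V)
    have hd := hN.two_le
    have hdm : d < m := by
      rcases hN.progress with h | ⟨z, y, -, hy⟩
      · exact h
      · simp at hy
    unfold goSeek newCycle goUnfreeze at hreact
    simp only [Finset.min_empty] at hreact
    rw [if_pos (by omega)] at hreact
    rw [round_eq_update hne (hC.finish_eq_self hQ' _) hreact (finish_of_pkt rfl (by simp))]
    -- The count has grown by at least one, which frees 4n; unfreezing and freezing in the new cycle
    -- takes up 4m ≤ 4n of it.
    have hmul : 4 * Fintype.card V * (Fintype.card V - m) + 4 * Fintype.card V ≤
        4 * Fintype.card V * (Fintype.card V - d) := by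
      rw [← Nat.mul_succ]
      exact Nat.mul_le_mul_left _ (by omega)
    refine Or.inl ⟨_, _, _, h - 1, by omega, hR.update_leader rfl rfl,
      hC.issue hQ hQ' rfl (by simp only [SmallBody]; omega),
      .unfreezing (τ := r + 2) le_rfl (by omega) (hN.newCycle rfl rfl rfl rfl rfl
        (by simp only [Low]; omega) fun x => by
          have := hC.stampOf_le_succ x
          omega) le_rfl ?_⟩
    rw [credit_update_eq (by rfl) (by rw [hN.given_empty])]
    omega
  · exact next_goSeek hN hE hh hR hC hQ hQ' hne hreact

/-- The leader announces termination. -/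
theorem next_halt [DecidableEq V] {d h τ : ℕ} {P Q : Packet} {p : Phase}
    (hN : Naming a l (3 * Fintype.card V ^ 2) d d d ∅ τ)
    (hR : Roles a l k) (hC : Conversation a l P Q r (3 * Fintype.card V ^ 2))
    (hQ : ∀ s, ¬ Answers s Q.body) (hQ' : ∀ k, Q.body ≠ .halt k)
    (hne : ∀ x, x ≠ l → react (r + 2) (a x) = a x)
    (hreact : react (r + 2) (a l) = goCollect (r + 2) (a l) ⟨p, d, ∅⟩ d) :
    Next l r h fun x => finish (r + 2) (react (r + 2) (a x)) := by
  obtain ⟨hdn, hlt⟩ := hN.complete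
  have hM := card_le_sq (V := V)
  have hd := hN.two_le
  unfold goCollect at hreact
  simp only [lt_self_iff_false, if_false, if_true] at hreact
  rw [round_eq_update hne (hC.finish_eq_self hQ' _) hreact
    -- The announcement has the stamp of the next round and contains `d ≥ 2`, so it does not take
    -- effect at once.
    (by rw [finish_halt rfl, if_neg (by omega)])]
  subst hdn
  have hconv := hC.issue (s := { a l with
    pkt := some ⟨r + 2, .halt (Fintype.card V)⟩,
    ctrl := some ⟨.stopped, Fintype.card V, ∅⟩ }) hQ hQ' rfl (by simpa only [SmallBody] using hM)
  dsimp only at hconv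
  have hfields := fields_update (a := a) (e := l) (s := { a l with
    pkt := some ⟨r + 2, .halt (Fintype.card V)⟩,
    ctrl := some ⟨.stopped, Fintype.card V, ∅⟩ }) rfl rfl rfl rfl
  refine Or.inr ⟨⟨_, hR.update_leader rfl rfl, rfl⟩, hconv, ?_, ?_, ?_, ?_⟩
  · intro x
    rw [(hfields x).1]
    exact hlt x
  · intro x y i
    rw [(hfields x).1, (hfields y).1]
    exact hN.name_inj x y i
  · have := one_le_holders hconv
    omega
  · intro x
    rw [(hfields x).2.2.1]
    by_contra hx
    obtain ⟨i, hi⟩ := Option.ne_none_iff_exists'.1 hx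
    obtain ⟨-, i, -, h1, h2⟩ := hN.active_spec x i hi
    omega

/-- Three continuations: another node to freeze, or else an announcement or a seek. If the pool is
empty after the last report, no id was issued in this cycle and `next_halt` applies. -/
theorem outcome_collectedNone [DecidableEq V] {d j τ t t' h : ℕ} {E : Finset ℕ} (hj : 1 ≤ j)
    (hjd : j < d) (hN : Naming a l (3 * Fintype.card V ^ 2) d d (j + 1) E τ) (hτ : τ ≤ t')
    (hh : 4 * credit a + 2 * (d - j) + 2 * E.card +
      4 * Fintype.card V * (Fintype.card V - d) ≤ h)
    (hR : Roles a l ⟨.collecting j, d, E⟩)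
    (hC : Conversation a l ⟨t, .collect j⟩ ⟨t', .collected j none⟩ r (3 * Fintype.card V ^ 2)) :
    Outcome a l ⟨t', .collected j none⟩ r h := by
  have hn := count_le_card hN.name_surj
  have hM := card_le_sq (V := V)
  obtain ⟨h1, h2⟩ := hC.react_reply hR (t := r + 2)
    (by intro hp; unfold lead; rw [hp]) (by simp [Answers])
  have hst := hC.stampOf_le_succ l
  have hst' := hC.stamp_le
  simp only at hst'
  by_cases hpl : (a l).pkt = some ⟨t', .collected j none⟩
  · refine Or.inr ?_
    have hreact : react (r + 2) (a l) =
        goCollect (r + 2) (a l) ⟨.collecting j, d, E⟩ (j + 1) := by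
      unfold react lead
      rw [hR.leader, hpl]
      simp
    by_cases hlt : j + 1 < d
    · unfold goCollect at hreact
      simp only at hreact
      rw [if_pos hlt] at hreact
      rw [round_eq_update h1 (hC.finish_eq_self (by simp) _) hreact (finish_of_pkt rfl (by simp))]
      refine Or.inl ⟨_, _, _, h - 1, by omega, hR.update_leader rfl rfl,
        hC.issue (by simp [Answers]) (by simp) rfl (by simp only [SmallBody]; omega),
        .collecting (τ := τ) (by omega) hlt (hN.update_pkt rfl rfl rfl rfl rfl
          (by simpa [Low] using hlt) (by omega)) (by omega) ?_⟩
      rw [credit_update_eq (by rfl) (by rfl)]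
      omega
    · obtain rfl : d = j + 1 := by omega
      rcases E.eq_empty_or_nonempty with rfl | hE
      · exact next_halt hN hR hC (by simp [Answers]) (by simp) h1 hreact
      · unfold goCollect at hreact
        simp only [lt_self_iff_false, if_false] at hreact
        rw [if_neg hE.ne_empty] at hreact
        exact next_goSeek (hN.toRenaming hE) hE (by omega) hR hC (by simp [Answers]) (by simp) h1
          hreact
  · exact Or.inl ⟨h2 hpl, l, hpl⟩

/-- Exactly one node adopted or rejected `x`. It is not the leader, whose id is 0 and whose list of
rejected ids is empty. -/
theorem outcome_seeking [DecidableEq V] {d m x t h : ℕ} {E : Finset ℕ} (hx : x ∈ E)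
    (hmin : ∀ y ∈ E, x ≤ y) (hN : Renaming a l (3 * Fintype.card V ^ 2) d m E)
    (hh : 4 * credit a + 1 + 2 * E.card +
      4 * Fintype.card V * (Fintype.card V - d) ≤ h)
    (hR : Roles a l ⟨.seeking x, m, E⟩)
    (hC : Conversation a l ⟨t, .seek x m⟩ ⟨t, .seek x m⟩ r (3 * Fintype.card V ^ 2)) :
    Outcome a l ⟨t, .seek x m⟩ r h := by
  obtain ⟨e, he⟩ := hN.answer_exists x hx
  have hxM := hN.remaining_le x hx
  have hmx := hN.remaining_ge x hx
  have hd := hN.two_le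
  have hdm := hN.le_count
  have hel : e ≠ l := by
    rintro rfl
    rw [hN.name_leader, hN.rejected_leader] at he
    simp at he
    omega
  have huniq : ∀ y, y ≠ l → Answers (a y) (.seek x m) → y = e :=
    fun y _ hy => hN.answer_unique x hx y e hy he
  obtain ⟨h1, h2⟩ := hC.react_request hR (t := r + 2) (e := e)
    (by unfold lead; rw [hC.leader_pkt_eq]) huniq
  by_cases hpe : (a e).pkt = some ⟨t, .seek x m⟩
  · refine Or.inr ?_
    by_cases hex : (a e).name = some x
    · have hreact : react (r + 2) (a e) = { a e with
          name := some m, pkt := some ⟨r + 2, .adopted x⟩ } := by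
        unfold react respond
        rw [hR.other e hel, hpe]
        simp [hex, hR.other e hel]
      dsimp only at hreact
      rw [round_eq_update h1 (hC.finish_eq_self (by simp) _) hreact (finish_of_pkt rfl (by simp))]
      refine Or.inl ⟨_, _, _, h - 1, by omega, hR.update_other hel rfl rfl,
        hC.reply hel huniq (by simp) rfl (by simpa only [SmallBody] using hxM),
        .adopted hx (hN.rename hx hmin hex rfl rfl rfl rfl) ?_⟩
      have := credit_update (a := a) (e := e) (s := { a e with
          name := some m, pkt := some ⟨r + 2, .adopted x⟩ }) (by simp [hex])
      simp only at this
      omega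
    · have hrej := he.resolve_left hex
      have hreact : react (r + 2) (a e) = { a e with pkt := some ⟨r + 2, .rejected x⟩ } := by
        unfold react respond
        rw [hR.other e hel, hpe]
        simp [hex, hrej, hR.other e hel]
      dsimp only at hreact
      rw [round_eq_update h1 (hC.finish_eq_self (by simp) _) hreact (finish_of_pkt rfl (by simp))]
      refine Or.inl ⟨_, _, _, h - 1, by omega, hR.update_other hel rfl rfl,
        hC.reply hel huniq (by simp) rfl (by simpa only [SmallBody] using hxM),
        .rejected hx ((hN.erase hx hex hrej).update_pkt rfl rfl rfl rfl) ?_⟩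
      rw [credit_update_eq (by rfl) (by rfl)]
      omega
  · exact Or.inl ⟨h2 hpe, e, hpe⟩

theorem outcome_adopted [DecidableEq V] {d m x t t' h : ℕ} {E : Finset ℕ} (hx : x ∈ E)
    (hN : Renaming a l (3 * Fintype.card V ^ 2) d (m + 1) (E.erase x))
    (hh : 4 * credit a + 2 * E.card + 4 * Fintype.card V * (Fintype.card V - d) ≤ h)
    (hR : Roles a l ⟨.seeking x, m, E⟩)
    (hC : Conversation a l ⟨t, .seek x m⟩ ⟨t', .adopted x⟩ r (3 * Fintype.card V ^ 2)) :
    Outcome a l ⟨t', .adopted x⟩ r h := by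
  obtain ⟨h1, h2⟩ := hC.react_reply hR (t := r + 2)
    (by intro hp; unfold lead; rw [hp]) (by simp [Answers])
  by_cases hpl : (a l).pkt = some ⟨t', .adopted x⟩
  · refine Or.inr ?_
    have hreact : react (r + 2) (a l) =
        goSeek (r + 2) (a l) ⟨.seeking x, m + 1, E.erase x⟩ := by
      unfold react lead
      rw [hR.leader, hpl]
      simp
    have := Finset.card_erase_add_one hx
    exact next_goSeek_or_newCycle hN (by omega) hR hC (by simp [Answers]) (by simp) h1 hreact
  · exact Or.inl ⟨h2 hpl, l, hpl⟩

theorem outcome_rejected [DecidableEq V] {d m x t t' h : ℕ} {E : Finset ℕ} (hx : x ∈ E)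
    (hN : Renaming a l (3 * Fintype.card V ^ 2) d m (E.erase x))
    (hh : 4 * credit a + 2 * E.card + 4 * Fintype.card V * (Fintype.card V - d) ≤ h)
    (hR : Roles a l ⟨.seeking x, m, E⟩)
    (hC : Conversation a l ⟨t, .seek x m⟩ ⟨t', .rejected x⟩ r (3 * Fintype.card V ^ 2)) :
    Outcome a l ⟨t', .rejected x⟩ r h := by
  obtain ⟨h1, h2⟩ := hC.react_reply hR (t := r + 2)
    (by intro hp; unfold lead; rw [hp]) (by simp [Answers])
  by_cases hpl : (a l).pkt = some ⟨t', .rejected x⟩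
  · refine Or.inr ?_
    have hreact : react (r + 2) (a l) =
        goSeek (r + 2) (a l) ⟨.seeking x, m, E.erase x⟩ := by
      unfold react lead
      rw [hR.leader, hpl]
      simp
    have := Finset.card_erase_add_one hx
    exact next_goSeek_or_newCycle hN (by omega) hR hC (by simp [Answers]) (by simp) h1 hreact
  · exact Or.inl ⟨h2 hpl, l, hpl⟩

theorem Stage.outcome [DecidableEq V] {P Q : Packet} {h : ℕ} (hS : Stage a l k P Q h)
    (hR : Roles a l k) (hC : Conversation a l P Q r (3 * Fintype.card V ^ 2))
    (hprog : k.phase = .common → (∃ y, Issued a ∅ y) ∨ ∀ z, (a z).name ≠ none) :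
    Outcome a l Q r h := by
  cases hS with
  | unfreezing hj hjd hN hτ hh => exact outcome_unfreezing hj hjd hN hτ hh hR hC
  | unfrozen hj hjd hN hτ hh => exact outcome_unfrozen hj hjd hN hτ hh hR hC
  | common hjd hN hτ hh => exact outcome_common hjd hN hτ (hprog rfl) hh hR hC
  | collecting hj hjd hN hτ hh => exact outcome_collecting hj hjd hN hτ hh hR hC
  | collectedSome hj hjd hN hτ hh => exact outcome_collectedSome hj hjd hN hτ hh hR hC
  | collectedNone hj hjd hN hτ hh => exact outcome_collectedNone hj hjd hN hτ hh hR hC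
  | seeking hx hmin hN hh => exact outcome_seeking hx hmin hN hh hR hC
  | adopted hx hN hh => exact outcome_adopted hx hN hh hR hC
  | rejected hx hN hh => exact outcome_rejected hx hN hh hR hC

end Events

variable {V : Type u}

theorem Roles.absorbed {N : DynamicNetwork V} {c : V → Node} {l : V} {k : Ctrl} {R : ℕ}
    (h : Roles c l k) : Roles (absorbed N R c) l k :=
  ⟨(absorbed_ctrl l).trans h.leader, fun x hx => (absorbed_ctrl x).trans (h.other x hx),
    fun x => (absorbed_out x).trans (h.running x)⟩

theorem Conversation.succ {c : V → Node} {l : V} {P Q : Packet} {r M : ℕ}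
    (h : Conversation c l P Q r M) :
    Conversation c l P Q (r + 1) M :=
  { h with stamp_le := h.stamp_le.trans (Nat.le_succ _) }

variable [Fintype V]

/-! ### The execution until the announcement of termination -/

section

variable {N : DynamicNetwork V} {c : V → Node} {l : V} {k : Ctrl} {P Q : Packet} {r R h : ℕ}

theorem Stage.absorbed (hS : Stage c l k P Q h) (hout : ∀ x, (c x).out = none) :
    Stage (absorbed N R c) l k P Q h := by
  have hc := credit_absorbed (N := N) (R := R) hout
  cases hS with
  | unfreezing hj hjd hN hτ hh => exact .unfreezing hj hjd (hN.absorbed hout) hτ (by omega)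
  | unfrozen hj hjd hN hτ hh => exact .unfrozen hj hjd (hN.absorbed hout) hτ (by omega)
  | common hjd hN hτ hh => exact .common hjd (hN.absorbed hout) hτ (by omega)
  | collecting hj hjd hN hτ hh => exact .collecting hj hjd (hN.absorbed hout) hτ (by omega)
  | collectedSome hj hjd hN hτ hh => exact .collectedSome hj hjd (hN.absorbed hout) hτ (by omega)
  | collectedNone hj hjd hN hτ hh => exact .collectedNone hj hjd (hN.absorbed hout) hτ (by omega)
  | seeking hx hmin hN hh => exact .seeking hx hmin (hN.absorbed hout) (by omega)
  | adopted hx hN hh => exact .adopted hx (hN.absorbed hout) (by omega)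
  | rejected hx hN hh => exact .rejected hx (hN.absorbed hout) (by omega)

theorem Stage.naming_or_renaming (hS : Stage c l k P Q h) :
    (∃ d k' f E τ, Naming c l (3 * Fintype.card V ^ 2) d k' f E τ) ∨
      ∃ d m E, Renaming c l (3 * Fintype.card V ^ 2) d m E := by
  cases hS with
  | unfreezing _ _ hN _ _ => exact Or.inl ⟨_, _, _, _, _, hN⟩
  | unfrozen _ _ hN _ _ => exact Or.inl ⟨_, _, _, _, _, hN⟩
  | common _ hN _ _ => exact Or.inl ⟨_, _, _, _, _, hN⟩
  | collecting _ _ hN _ _ => exact Or.inl ⟨_, _, _, _, _, hN⟩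
  | collectedSome _ _ hN _ _ => exact Or.inl ⟨_, _, _, _, _, hN⟩
  | collectedNone _ _ hN _ _ => exact Or.inl ⟨_, _, _, _, _, hN⟩
  | seeking _ _ hN _ => exact Or.inr ⟨_, _, _, hN⟩
  | adopted _ hN _ => exact Or.inr ⟨_, _, _, hN⟩
  | rejected _ hN _ => exact Or.inr ⟨_, _, _, hN⟩

theorem Stage.stable (hS : Stage c l k P Q h) (hout : ∀ x, (c x).out = none) :
    Stable c (IndividualConversations.absorbed N R c) := by
  rcases hS.naming_or_renaming with ⟨_, _, _, _, _, hN⟩ | ⟨_, _, _, hN⟩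
  · exact hN.stable hout
  · exact hN.stable hout

theorem Stage.body_ne_halt (hS : Stage c l k P Q h) (n : ℕ) : Q.body ≠ .halt n := by
  cases hS <;> simp

theorem Stage.exists_issued (hS : Stage c l k P Q h) (hout : ∀ x, (c x).out = none)
    (hconn : (N.graph R).Connected) (hk : k.phase = .common) :
    (∃ y, Issued (IndividualConversations.absorbed N R c) ∅ y) ∨
      ∀ z, (IndividualConversations.absorbed N R c z).name ≠ none := by
  cases hS with
  | common _ hN _ _ => exact hN.exists_issued_absorbed hout hconn
  | _ => simp at hk

/-- After round `r`, termination has not been announced yet, and it will be soon. -/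
def Running (c : V → Node) (l : V) (r B : ℕ) : Prop :=
  ∃ k P Q h, Roles c l k ∧ Conversation c l P Q r (3 * Fintype.card V ^ 2) ∧ Stage c l k P Q h ∧
    r + Fintype.card V * h + Fintype.card V ≤ B + holders c Q

/-- The potential argument: either nobody reacts and the latest message gains a holder, or an event
uses up a unit of `h`. -/
theorem Running.next [DecidableEq V] {B : ℕ}
    (h : Running (states N l r) l r B)
    (hconn : (N.graph (r + 1)).Connected) :
    Running (states N l (r + 1)) l (r + 1) B ∨
      Halting (states N l (r + 1)) l (r + 1) (r + 2) := by
  obtain ⟨k, P, Q, h, hR, hC, hS, hB⟩ := h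
  have hC' := hC.absorbed (R := r + 1) hR.running (hS.stable (N := N) (R := r + 1) hR.running)
  have hS' := hS.absorbed (N := N) (R := r + 1) hR.running
  have hstates : states N l (r + 1) = fun x => finish (r + 2) (react (r + 2)
      (absorbed N (r + 1) (states N l r) x)) :=
    funext fun x => states_succ N l r hR.running x
  have hle := holders_le (states N l r) Q
  rw [hstates]
  rcases hS'.outcome hR.absorbed hC' (hS.exists_issued hR.running hconn) with
    ⟨hreact, x, hx⟩ | ⟨k', P', Q', h', hh, hR', hC'', hS''⟩ | hH
  · have hsame : (fun x => finish (r + 2) (react (r + 2)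
        (absorbed N (r + 1) (states N l r) x))) =
        absorbed N (r + 1) (states N l r) := by
      funext y
      rw [hreact, hC'.finish_eq_self hS.body_ne_halt]
    rw [hsame]
    have hlt := holders_absorbed (R := r + 1) hC hR.running hconn (x := x)
      fun hx' => hx (hC.absorbed_holder hR.running hx' (Or.inl rfl))
    exact Or.inl ⟨k, P, Q, h, hR.absorbed, hC'.succ, hS', by omega⟩
  · refine Or.inl ⟨k', P', Q', h', hR', hC'', hS'', ?_⟩
    -- The number of holders falls from at most n to at least 1, while n·h falls by at least n. That
    -- leaves the one unit needed for the elapsed round.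
    have h1 := one_le_holders hC''
    have h2 := Nat.mul_le_mul_left (Fintype.card V) hh
    rw [Nat.mul_succ] at h2
    omega
  · exact Or.inr hH

theorem Running.le {B : ℕ} (h : Running c l r B) : r ≤ B := by
  obtain ⟨k, P, Q, h, hR, hC, hS, hB⟩ := h
  have := holders_le c Q
  omega

/-! ### The execution after the announcement of termination -/

/-- All nodes are named, so absorption changes no ids; an announcement asks for no answer and the
leader has stopped. Only forwarding goes on. -/
theorem Halting.react_absorbed {t : ℕ} (h : Halting c l r t) (T : ℕ) :
    Conversation (absorbed N R c) l ⟨t, .halt (Fintype.card V)⟩ ⟨t, .halt (Fintype.card V)⟩ r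
      (3 * Fintype.card V ^ 2) ∧
    (∀ x, (absorbed N R c x).name = (c x).name) ∧
    ∀ x, react T (absorbed N R c x) = absorbed N R c x := by
  obtain ⟨k, hR, hk⟩ := h.ctrl
  have hsame : ∀ x, (absorbed N R c x).name = (c x).name ∧
      (absorbed N R c x).rejected = (c x).rejected := by
    intro x
    obtain ⟨i, hi, -⟩ := h.name_lt x
    rw [hi]
    exact absorbed_of_named hi
  have hC := h.conv.absorbed (N := N) (R := R) hR.running fun x => Or.inl (hsame x)
  refine ⟨hC, fun x => (hsame x).1, fun x => ?_⟩
  by_cases hx : x = l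
  · subst hx
    unfold react
    rw [hR.absorbed.leader]
    unfold lead
    simp only [hk]
  · unfold react
    rw [hR.absorbed.other x hx]
    refine respond_eq_self fun p hp hans => ?_
    rcases hC.outdated x hx x p hp hans with h1 | rfl
    · rw [hp] at h1
      simp at h1
    · simp [Answers] at hans

theorem Halting.next [DecidableEq V] {t : ℕ}
    (h : Halting (states N l r) l r t)
    (hconn : (N.graph (r + 1)).Connected) (ht : r + 2 < t + Fintype.card V) :
    Halting (states N l (r + 1)) l (r + 1) t := by
  obtain ⟨k, hR, hk⟩ := h.ctrl
  obtain ⟨hC, hname, hreact⟩ := h.react_absorbed (N := N) (R := r + 1) (r + 2)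
  have hsame : states N l (r + 1) =
      absorbed N (r + 1) (states N l r) := by
    funext x
    rw [states_succ N l r hR.running x, hreact]
    by_cases hp : (absorbed N (r + 1) (states N l r) x).pkt =
        some ⟨t, .halt (Fintype.card V)⟩
    · rw [finish_halt hp, if_neg (by omega)]
    · refine finish_eq_self fun p n hp' hn => ?_
      rw [hC.halt_eq x p n hp' hn] at hp'
      exact hp hp'
  rw [hsame]
  refine ⟨⟨k, hR.absorbed, hk⟩, hC.succ, ?_, ?_, ?_, ?_⟩
  · intro x
    rw [hname]
    exact h.name_lt x
  · intro x y i
    rw [hname, hname]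
    exact h.name_inj x y i
  · classical
    have hle := h.le_holders
    by_cases hall : ∀ x, (states N l r x).pkt =
        some ⟨t, .halt (Fintype.card V)⟩
    · have : holders (absorbed N (r + 1) (states N l r))
          ⟨t, .halt (Fintype.card V)⟩ = Fintype.card V := by
        unfold holders
        rw [Finset.filter_true_of_mem fun x _ =>
          h.conv.absorbed_holder hR.running (hall x) (Or.inl rfl)]
        rfl
      omega
    · push Not at hall
      obtain ⟨x, hx⟩ := hall
      have := holders_absorbed h.conv hR.running hconn hx
      omega
  · intro x
    rw [absorbed_active]
    exact h.active_eq x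

/-- At this moment `le_holders` forces all n nodes to know the announcement, so they all terminate
together and nobody misses it because a neighbour fell silent earlier. -/
theorem Halting.terminate [DecidableEq V] {t : ℕ}
    (h : Halting (states N l r) l r t)
    (ht : r + 2 = t + Fintype.card V) (x : V) :
    (states N l (r + 1) x).out =
      (states N l r x).name := by
  obtain ⟨k, hR, hk⟩ := h.ctrl
  obtain ⟨hC, hname, hreact⟩ := h.react_absorbed (N := N) (R := r + 1) (r + 2)
  have hall : (states N l r x).pkt =
      some ⟨t, .halt (Fintype.card V)⟩ := by
    classical
    have hle := h.le_holders
    have hcard := holders_le (states N l r)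
      ⟨t, .halt (Fintype.card V)⟩
    have heq : holders (states N l r)
      ⟨t, .halt (Fintype.card V)⟩ = Fintype.card V := by omega
    unfold holders at heq
    have := (Finset.card_eq_iff_eq_univ _).1 heq
    have hx := Finset.mem_univ x
    rw [← this] at hx
    simpa using hx
  rw [states_succ N l r hR.running x, hreact,
    finish_halt (h.conv.absorbed_holder hR.running hall (Or.inl rfl)), if_pos (by omega)]
  exact hname x

end

/-! ### The first round -/

section Start

theorem freshId_start {m i : ℕ} (hi : i < m) : freshId 0 1 ∅ m i = i + 1 := by
  unfold freshId
  simp [hi, Nat.add_comm]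

theorem one_le_deg {V : Type u} [Fintype V] (N : DynamicNetwork V) {r : ℕ} (hconn : (N.graph r).Connected) (hn : 2 ≤ Fintype.card V) (x : V) :
    1 ≤ N.deg r x := by
  have : Nontrivial V := Fintype.one_lt_card_iff_nontrivial.1 hn
  obtain ⟨y, hy⟩ := exists_ne x
  obtain ⟨a, b, hab, rfl, -⟩ := exists_adj_boundary (p := fun z => z = x) hconn rfl hy
  exact (Nat.zero_le _).trans_lt ((N.port r a).symm ⟨b, hab⟩).isLt

variable {V : Type u} [DecidableEq V] (N : DynamicNetwork V) (l : V)

theorem states_zero_out (x : V) : (states N l 0 x).out = none := by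
  rw [states_zero]; split_ifs <;> rfl

theorem states_zero_pkt (x : V) : (states N l 0 x).pkt = none := by
  rw [states_zero]; split_ifs <;> rfl

theorem states_zero_name (x : V) : (states N l 0 x).name = if x = l then some 0 else none := by
  rw [states_zero]; split_ifs <;> rfl

theorem offerTo_start (y z : V) (v : ℕ) : offerTo N 1 (states N l 0) y z = some v ↔
    y = l ∧ ∃ i : Fin (N.deg 1 l), (N.port 1 l i : V) = z ∧ v = i + 1 := by
  constructor
  · intro h
    obtain ⟨hadj, j, d, hj, -⟩ := offerTo_eq_some h
    rw [states_zero_name] at hj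
    split_ifs at hj with hy
    subst hy
    refine ⟨rfl, (N.port 1 y).symm ⟨z, hadj⟩, by simp, ?_⟩
    unfold offerTo offer at h
    rw [dif_pos hadj, states_zero, if_pos rfl] at h
    simp only [leaderInit, Option.some.injEq] at h
    rw [← h, freshId_start (Fin.is_lt _)]
  · rintro ⟨rfl, i, rfl, rfl⟩
    have hadj : (N.graph 1).Adj y (N.port 1 y i) := (N.port 1 y i).2
    unfold offerTo offer
    rw [dif_pos hadj, states_zero, if_pos rfl]
    simp only [leaderInit, Option.some.injEq]
    rw [freshId_start (Fin.is_lt _)]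
    exact congrArg (fun i : Fin _ => i.val + 1) ((N.port 1 y).symm_apply_apply i)

theorem absorbed_start_name (z : V) (v : ℕ) : (absorbed N 1 (states N l 0) z).name = some v ↔
    z = l ∧ v = 0 ∨ ∃ i : Fin (N.deg 1 l), (N.port 1 l i : V) = z ∧ v = i + 1 := by
  have hl : ∀ i : Fin (N.deg 1 l), (N.port 1 l i : V) ≠ l := fun i =>
    (SimpleGraph.Adj.ne (N.port 1 l i).2).symm
  rcases absorbed_name_cases (N := N) (R := 1) (states_zero_out N l) z with
    ⟨h1, -, h3⟩ | ⟨h1, w, h2, ⟨y, h3⟩, h4⟩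
  · rw [h1]
    rw [states_zero_name] at h3 ⊢
    by_cases hz : z = l
    · subst hz
      simp only [if_true, Option.some.injEq, true_and]
      constructor
      · exact fun h => Or.inl h.symm
      · rintro (h | ⟨i, hi, -⟩)
        · exact h.symm
        · exact absurd hi (hl i)
    · simp only [hz, if_false, reduceCtorEq, false_and, false_or, false_iff, not_exists]
      rintro i ⟨hi, hv⟩
      have := (offerTo_start N l l z v).2 ⟨rfl, i, hi, hv⟩
      rw [h3 (by simp [hz])] at this
      simp at this
  · rw [h2]
    rw [states_zero_name] at h1
    have hz : z ≠ l := by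
      rintro rfl
      simp at h1
    obtain ⟨-, i, rfl, rfl⟩ := (offerTo_start N l y z w).1 h3
    simp only [Option.some.injEq, hz, false_and, false_or]
    constructor
    · rintro rfl
      exact ⟨i, rfl, rfl⟩
    · rintro ⟨i', hi', rfl⟩
      have := (N.port 1 l).injective (Subtype.ext hi')
      rw [this]

/-- Only the leader makes offers in the first round, one for each neighbour, so nobody has anything
to reject. -/
theorem absorbed_start_rejected (z : V) : (absorbed N 1 (states N l 0) z).rejected = ∅ := by
  have h0 : (states N l 0 z).rejected = ∅ := by
    rw [states_zero]; split_ifs <;> rfl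
  rcases absorbed_name_cases (N := N) (R := 1) (states_zero_out N l) z with
    ⟨-, h2, -⟩ | ⟨h1, w, h2, ⟨y, h3⟩, h4⟩
  · rw [h2, h0]
  · have hnot : w ∉ (absorbed N 1 (states N l 0) z).rejected := by
      unfold absorbed at h2 ⊢
      by_cases hne : (offered (mail N 1 (states N l 0) z)).Nonempty
      · rw [absorb_eq_of_offered _ _ h1 hne] at h2 ⊢
        simp only [Option.some.injEq] at h2
        simp [h2]
      · rw [Finset.not_nonempty_iff_eq_empty] at hne
        rw [absorb_eq_of_not_offered _ _ hne, h0]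
        simp
    refine Finset.eq_empty_of_forall_notMem fun v hv => ?_
    obtain ⟨y', hy'⟩ := (h4 v).1 (Or.inr hv)
    obtain ⟨-, i, hi, rfl⟩ := (offerTo_start N l _ _ _).1 h3
    obtain ⟨-, i', hi', rfl⟩ := (offerTo_start N l _ _ _).1 hy'
    have := (N.port 1 l).injective (Subtype.ext (hi.trans hi'.symm))
    rw [← this] at hv
    exact hnot hv

theorem absorbed_start_given (z : V) : (absorbed N 1 (states N l 0) z).given =
    if z = l then Finset.univ.image fun i : Fin (N.deg 1 l) => (i : ℕ) + 1 else ∅ := by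
  have hl : ∀ i : Fin (N.deg 1 l), (N.port 1 l i : V) ≠ l := fun i =>
    (SimpleGraph.Adj.ne (N.port 1 l i).2).symm
  have h0 : (states N l 0 z).given = ∅ := by
    rw [states_zero]; split_ifs <;> rfl
  ext v
  rw [mem_absorbed_given (states_zero_out N l), h0]
  simp only [offerTo_start, states_zero_name]
  by_cases hz : z = l
  · simp only [hz, if_true, true_and, Finset.notMem_empty, false_or, Finset.mem_image,
      Finset.mem_univ]
    constructor
    · rintro ⟨w, -, i, -, rfl⟩
      exact ⟨i, rfl⟩
    · rintro ⟨i, rfl⟩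
      exact ⟨N.port 1 l i, by simp [hl], i, rfl, rfl⟩
  · simp [hz]

theorem absorbed_start_pkt (z : V) : (absorbed N 1 (states N l 0) z).pkt = none := by
  obtain ⟨y, hy⟩ := (absorbed_pkt (N := N) (r := 1) (states_zero_out N l) z).2.2
  rw [hy, states_zero_pkt]

variable [Fintype V]

/-- The first round ends like a seeking part: ids 0, …, d - 1 in use, nothing remaining, count grown
from 1. So `Renaming.newCycle` starts the first cycle. -/
theorem running_one (hconn : (N.graph 1).Connected) (hn : 2 ≤ Fintype.card V) :
    Running (states N l 1) l 1 (14 * Fintype.card V ^ 3) := by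
  have hdeg := one_le_deg N hconn hn l
  set a := absorbed N 1 (states N l 0) with ha
  set d := 1 + N.deg 1 l with hd
  have hname := absorbed_start_name N l
  have hrej := absorbed_start_rejected N l
  have hgiven := absorbed_start_given N l
  have hpkt := absorbed_start_pkt N l
  rw [← ha] at hname hrej hgiven hpkt
  have hctrl : ∀ x, (a x).ctrl = if x = l then some ⟨.start, 1, ∅⟩ else none := by
    intro x
    rw [ha, absorbed_ctrl, states_zero]
    split_ifs <;> rfl
  have hactive : ∀ x, x ≠ l → (a x).active = none := by
    intro x hx
    rw [ha, absorbed_active, states_zero, if_neg hx]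
    rfl
  have hout : ∀ x, (a x).out = none := by
    intro x
    rw [ha, absorbed_out, states_zero_out]
  have hcard : (a l).given.card = N.deg 1 l := by
    rw [hgiven, if_pos rfl, Finset.card_image_of_injective _ fun i j h => by
      simpa [Fin.val_inj] using h]
    simp
  have hreact : react 2 (a l) = { a l with
      active := some d, given := ∅, pkt := some ⟨2, .unfreeze 1 d⟩,
      ctrl := some ⟨.unfreezing 1, d, ∅⟩ } := by
    unfold react
    rw [hctrl, if_pos rfl]
    unfold lead newCycle goUnfreeze
    simp only [hcard]
    rw [if_pos (by omega)]
  dsimp only at hreact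
  have hother : ∀ x, x ≠ l → react 2 (a x) = a x := by
    intro x hx
    unfold react
    rw [hctrl, if_neg hx]
    exact respond_eq_self (by simp [hpkt])
  have hstates : states N l 1 = fun x => finish 2 (react 2 (a x)) :=
    funext fun x => states_succ N l 0 (states_zero_out N l) x
  rw [hstates, round_eq_update hother (fun x => finish_eq_self (by simp [hpkt])) hreact
    (finish_of_pkt rfl (by simp))]
  have hlt : ∀ z y, (a z).name = some y → y < d := by
    intro z y hy
    rcases (hname z y).1 hy with ⟨-, rfl⟩ | ⟨i, -, rfl⟩
    · omega
    · have := i.isLt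
      omega
  have hl : ∀ i : Fin (N.deg 1 l), (N.port 1 l i : V) ≠ l := fun i =>
    (SimpleGraph.Adj.ne (N.port 1 l i).2).symm
  have hfields := fun x => Function.update_apply a l { a l with active := none, given := ∅ } x
  -- An auxiliary configuration in which the leader is frozen and has no recorded ids. The second
  -- update of the leader overwrites this one.
  have hR : Renaming (Function.update a l { a l with active := none, given := ∅ }) l
      (3 * Fintype.card V ^ 2) 1 d ∅ := by
    have hname' : ∀ x, (Function.update a l { a l with active := none, given := ∅ } x).name =
        (a x).name := by
      intro x; rw [hfields]; split_ifs with h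
      · rw [h]
      · rfl
    have hrej' : ∀ x, (Function.update a l { a l with active := none, given := ∅ } x).rejected =
        ∅ := by
      intro x; rw [hfields]; split_ifs with h
      · exact hrej l
      · exact hrej x
    constructor
    · intro x y i hx hy
      rw [hname'] at hx hy
      rcases (hname x i).1 hx with ⟨rfl, rfl⟩ | ⟨j, rfl, rfl⟩ <;>
        rcases (hname y _).1 hy with ⟨rfl, h⟩ | ⟨j', rfl, h⟩
      · rfl
      · omega
      · omega
      · obtain rfl : j = j' := Fin.ext (by omega)
        rfl
    · intro i hi
      rcases i with _ | i
      · exact ⟨l, by rw [hname', hname]; exact Or.inl ⟨rfl, rfl⟩⟩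
      · exact ⟨N.port 1 l ⟨i, by omega⟩, by rw [hname', hname]; exact Or.inr ⟨_, rfl, rfl⟩⟩
    · rw [hname', hname]; exact Or.inl ⟨rfl, rfl⟩
    · exact hrej' l
    · omega
    · omega
    · intro x
      rw [hfields]
      split_ifs with h
      · rfl
      · exact hactive x h
    · intro x
      rw [hfields]
      split_ifs with h
      · rfl
      · rw [hgiven, if_neg h]
    · simp
    · simp
    · simp
    · simp
    · intro z y hz
      rw [hname'] at hz
      exact Or.inl (hlt z y hz)
    · intro z _
      exact hrej' z
    · left; omega
  have hdn := count_le_card hR.name_surj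
  have hM := card_le_sq (V := V)
  have hN := hR.newCycle (s := { a l with
      active := some d, given := ∅, pkt := some ⟨2, .unfreeze 1 d⟩,
      ctrl := some ⟨.unfreezing 1, d, ∅⟩ }) (t := 2) (b := .unfreeze 1 d)
    (by simp) (by simp) rfl rfl rfl (by simp only [Low]; omega) (fun x => by
      rw [hfields]
      split_ifs <;> simp [hpkt])
  rw [Function.update_idem] at hN
  dsimp only at hN
  set c := Function.update a l { a l with
      active := some d, given := ∅, pkt := some ⟨2, .unfreeze 1 d⟩,
      ctrl := some ⟨.unfreezing 1, d, ∅⟩ } with hc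
  dsimp only at hc
  have hcl : (c l).pkt = some ⟨2, .unfreeze 1 d⟩ := by rw [hc, Function.update_self]
  have hcx : ∀ x, x ≠ l → c x = a x := fun x hx => by rw [hc, Function.update_of_ne hx]
  have hpc : ∀ y p, (c y).pkt = some p → p = ⟨2, .unfreeze 1 d⟩ := by
    intro y p hp
    by_cases hy : y = l
    · rw [hy, hcl] at hp
      exact (Option.some.inj hp).symm
    · rw [hcx y hy, hpkt] at hp
      simp at hp
  have hC : Conversation c l ⟨2, .unfreeze 1 d⟩ ⟨2, .unfreeze 1 d⟩ 1
      (3 * Fintype.card V ^ 2) := by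
    constructor
    · exact Or.inl hcl
    · exact Or.inl rfl
    · simp
    · simp
    · exact fun y p hp => Or.inl (hpc y p hp)
    · exact fun _ _ y p hp _ => Or.inr (hpc y p hp)
    · intro y p hp
      rw [hpc y p hp]
      simp only [SmallBody]
      omega
    · exact fun y p _ hp _ => hpc y p hp
    · exact ⟨l, hcl⟩
  have hcredit : credit c ≤ Fintype.card V * Fintype.card V := by
    have hg : ∀ x, (c x).given = ∅ := by
      intro x
      by_cases hx : x = l
      · rw [hx, hc, Function.update_self]
      · rw [hcx x hx, hgiven, if_neg hx]
    unfold credit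
    simp only [hg, Finset.card_empty, Finset.sum_const_zero, zero_add]
    exact Nat.mul_le_mul_left _ (Finset.card_le_univ _)
  refine ⟨_, _, _, 4 * credit c + 2 * (2 * d + 1 - 1) + 1 +
    4 * Fintype.card V * (Fintype.card V - d), ?_, hC,
    .unfreezing (E := ∅) le_rfl (by omega) hN le_rfl le_rfl, ?_⟩
  · constructor
    · rw [hc, Function.update_self]
    · intro x hx
      rw [hcx x hx, hctrl, if_neg hx]
    · intro x
      by_cases hx : x = l
      · rw [hx, hc, Function.update_self]; exact hout l
      · rw [hcx x hx, hout]
  · have h1 := one_le_holders hC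
    have h2 : 4 * Fintype.card V * (Fintype.card V - d) ≤ 4 * Fintype.card V * Fintype.card V :=
      Nat.mul_le_mul_left _ (Nat.sub_le _ _)
    -- The credit gives 4n², the later cycles 4n², and the first cycle 4d + 1 ≤ 5n². Multiplied by n
    -- this is 13n³, and the remaining summands fit into another n³.
    have h3 : 4 * credit c + 2 * (2 * d + 1 - 1) + 1 +
        4 * Fintype.card V * (Fintype.card V - d) ≤ 13 * Fintype.card V ^ 2 := by
      have h4 := Nat.le_mul_self (Fintype.card V)
      rw [mul_assoc 4 (Fintype.card V) (Fintype.card V)] at h2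
      rw [sq]
      omega
    have h4 := Nat.mul_le_mul_left (Fintype.card V) h3
    have h5 : Fintype.card V ≤ Fintype.card V ^ 3 := Nat.le_self_pow (by norm_num) _
    have h6 : Fintype.card V * (13 * Fintype.card V ^ 2) = 13 * Fintype.card V ^ 3 := by ring
    omega

/-- The execution in a network with at least two nodes: termination is announced in round
`r₀`. -/
theorem exists_announcement (hN : N.OneIntervalConnected) (hn : 2 ≤ Fintype.card V) :
    ∃ r₀, r₀ ≤ 14 * Fintype.card V ^ 3 + 1 ∧
      (∀ r, 1 ≤ r → r < r₀ → Running (states N l r) l r (14 * Fintype.card V ^ 3)) ∧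
      ∀ i < Fintype.card V, Halting (states N l (r₀ + i)) l (r₀ + i) (r₀ + 1) := by
  classical
  -- `r₀` is the first round after which `Running` fails; `Running.le` shows that it exists. It is
  -- not 1, so `Running.next` from the preceding round leaves only `Halting`.
  have hex : ∃ r, 1 ≤ r ∧ ¬ Running (states N l r) l r (14 * Fintype.card V ^ 3) :=
    ⟨14 * Fintype.card V ^ 3 + 1, by omega, fun h => by
      have := h.le
      omega⟩
  have hspec := Nat.find_spec hex
  have hmin := fun r => Nat.find_min hex (m := r)
  have hle : Nat.find hex ≤ 14 * Fintype.card V ^ 3 + 1 := Nat.find_min' hex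
    ⟨by omega, fun h => by
      have := h.le
      omega⟩
  set r₀ := Nat.find hex with hr₀
  have hrun : ∀ r, 1 ≤ r → r < r₀ → Running (states N l r) l r (14 * Fintype.card V ^ 3) := by
    intro r h1 h2
    by_contra h
    exact hmin r h2 ⟨h1, h⟩
  have hne : r₀ ≠ 1 := by
    intro h
    rw [h] at hspec
    exact hspec.2 (running_one N l (hN 1 le_rfl) hn)
  obtain ⟨r₁, hr₁⟩ : ∃ r₁, r₀ = r₁ + 1 := ⟨r₀ - 1, by omega⟩
  have hH : Halting (states N l r₀) l r₀ (r₀ + 1) := by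
    have := (hrun r₁ (by omega) (by omega)).next (hN (r₁ + 1) (by omega))
    rw [← hr₁] at this
    rw [hr₁]
    rw [hr₁] at this hspec
    exact this.resolve_left hspec.2
  refine ⟨r₀, hle, hrun, fun i => ?_⟩
  induction i with
  | zero => exact fun _ => hH
  | succ i ih =>
    intro hi
    exact (ih (by omega)).next (hN _ (by omega)) (by omega)

end Start

/-! ### The size of the messages -/

section Size

/-- All numbers in the message are at most `X`. -/
def SmallMsg (X : ℕ) (m : Msg) : Prop :=
  (∀ j, m.name = some j → j ≤ X) ∧ (∀ v, m.offer = some v → v ≤ X) ∧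
    ∀ p, m.pkt = some p → p.stamp ≤ X ∧ SmallBody X p.body

theorem SmallBody.mono {X Y : ℕ} (hXY : X ≤ Y) {b : Body} (h : SmallBody X b) :
    SmallBody Y b := by
  cases b <;> simp only [SmallBody] at h ⊢
  case collected => exact ⟨h.1.trans hXY, fun y hy => (h.2 y hy).trans hXY⟩
  all_goals omega

theorem length_encBits (l : List Bool) : (encBits l).length = 2 * l.length + 1 := by
  induction l with
  | nil => rfl
  | cons b l ih => simp only [encBits, List.length_cons, ih]; omega

theorem length_encNat (x : ℕ) : (encNat x).length = 2 * x.size + 1 := by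
  rw [encNat, length_encBits, Nat.size_eq_bits_len]

theorem length_encNat_le {x X : ℕ} (h : x ≤ X) : (encNat x).length ≤ 2 * X.size + 1 := by
  rw [length_encNat]
  have := Nat.size_le_size h
  omega

theorem length_encOption_le {α : Type} {f : α → List Bool} {o : Option α} {k : ℕ}
    (h : ∀ a, o = some a → (f a).length ≤ k) : (encOption f o).length ≤ k + 1 := by
  cases o with
  | none => simp [encOption]
  | some a => simpa [encOption] using h a rfl

theorem length_encBody_le {X : ℕ} {b : Body} (h : SmallBody X b) :
    (encBody b).length ≤ 4 * X.size + 6 := by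
  cases b <;> simp only [SmallBody] at h <;>
    simp only [encBody, List.length_cons, List.length_append]
  case collected id x =>
    have h1 := length_encNat_le h.1
    have h2 := length_encOption_le (f := encNat) fun y hy => length_encNat_le (h.2 y hy)
    omega
  case unfreeze =>
    have h1 := length_encNat_le h.1
    have h2 := length_encNat_le h.2
    omega
  case seek =>
    have h1 := length_encNat_le h.1
    have h2 := length_encNat_le h.2
    omega
  all_goals
    have h1 := length_encNat_le h
    omega

/-- A message contains at most five numbers (name, offer, stamp and two in the body), each taking
twice its binary length plus one; the rest are tags. -/
theorem length_encode_le {X : ℕ} {m : Msg} (h : SmallMsg X m) :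
    (encode m).length ≤ 10 * X.size + 12 := by
  obtain ⟨h1, h2, h3⟩ := h
  have h4 := length_encOption_le (f := encNat) fun j hj => length_encNat_le (h1 j hj)
  have h5 := length_encOption_le (f := encNat) fun j hj => length_encNat_le (h2 j hj)
  have h6 : (encOption encPacket m.pkt).length ≤ 6 * X.size + 7 + 1 := by
    refine length_encOption_le fun p hp => ?_
    obtain ⟨h6, h7⟩ := h3 p hp
    have h8 := length_encNat_le h6
    have h9 := length_encBody_le h7
    unfold encPacket
    rw [List.length_append]
    omega
  unfold encode
  rw [List.length_append, List.length_append]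
  omega

variable {V : Type u} {N : DynamicNetwork V} {c : V → Node} {l : V}

theorem offer_eq_offerTo (r : ℕ) (x : V) (i : Fin (N.deg r x)) :
    offer (c x) (N.deg r x) i = offerTo N r c x (N.port r x i) := by
  have hadj : (N.graph r).Adj x (N.port r x i) := (N.port r x i).2
  unfold offerTo
  rw [dif_pos hadj]
  exact congrArg (fun i : Fin _ => offer (c x) (N.deg r x) i)
    ((N.port r x).symm_apply_apply i).symm

theorem sent_eq_some [DecidableEq V] {r : ℕ} {x : V} {i : Fin (N.deg (r + 1) x)} {m : Msg}
    (h : Individual_Conversations.sent N (r + 1) (Individual_Conversations.config N l r) x i =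
      some m) :
    (states N l r x).out = none ∧ m = send (r + 1) (states N l r x) (N.deg (r + 1) x) i := by
  unfold Protocol.sent at h
  split_ifs at h with h1
  exact ⟨Option.not_isSome_iff_eq_none.1 h1, (Option.some.inj h).symm⟩

theorem sent_of_running [DecidableEq V] {r : ℕ} {x : V} (h : (states N l r x).out = none)
    (i : Fin (N.deg (r + 1) x)) :
    Individual_Conversations.sent N (r + 1) (Individual_Conversations.config N l r) x i =
      some (send (r + 1) (states N l r x) (N.deg (r + 1) x) i) := by
  have h1 : Individual_Conversations.output (Individual_Conversations.config N l r x) = none := h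
  unfold Protocol.sent
  rw [if_neg (by rw [h1]; simp)]
  rfl

variable [Fintype V]

theorem smallMsg_send {P Q : Packet} {r X : ℕ}
    (hC : Conversation c l P Q r (3 * Fintype.card V ^ 2))
    (hname : ∀ x j, (c x).name = some j → j ≤ X)
    (hoffer : ∀ x z v, offerTo N (r + 1) c x z = some v → v ≤ X)
    (hX : 3 * Fintype.card V ^ 2 ≤ X) (hr : r + 1 ≤ X) (x : V) (i : Fin (N.deg (r + 1) x)) :
    SmallMsg X (send (r + 1) (c x) (N.deg (r + 1) x) i) := by
  refine ⟨hname x, fun v hv => hoffer x (N.port (r + 1) x i) v ?_, fun p hp => ?_⟩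
  · rw [← offer_eq_offerTo]
    exact hv
  · exact ⟨(hC.stamp_le_succ hp).trans hr, (hC.small x p hp).mono hX⟩

/-- An id that is not consecutive was issued in the current cycle or remains to be dealt with, so
the quadratic bound on such ids applies to it. -/
theorem Running.smallMsg {r B X : ℕ} (h : Running c l r B) (hX : 3 * Fintype.card V ^ 2 ≤ X)
    (hr : r + 1 ≤ X) (x : V) (i : Fin (N.deg (r + 1) x)) :
    SmallMsg X (send (r + 1) (c x) (N.deg (r + 1) x) i) := by
  obtain ⟨k, P, Q, h, hR, hC, hS, -⟩ := h
  have hM := card_le_sq (V := V)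
  rcases hS.naming_or_renaming with ⟨d, k', f, E, τ, hN⟩ | ⟨d, m, E, hN⟩
  · have hn := count_le_card hN.name_surj
    refine smallMsg_send hC (fun y j hj => ?_)
      (fun y z v hv => (hN.offerTo_spec hv).2.2.2.1.trans hX) hX hr x i
    by_cases hjd : j < d
    · omega
    · rcases hN.issued_of_held y j ⟨j, hj, by omega, Or.inl rfl⟩ with ⟨z, hz⟩ | hE
      · exact (hN.given_spec z j hz).2.1.trans hX
      · exact (hN.extra_spec j hE).2.1.trans hX
  · have hn := count_le_card hN.name_surj
    refine smallMsg_send hC (fun y j hj => ?_)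
      (fun y z v hv => by rw [hN.offerTo_eq_none] at hv; simp at hv) hX hr x i
    rcases hN.name_cases y j hj with h1 | h1
    · omega
    · exact (hN.remaining_le j h1).trans hX

theorem Halting.smallMsg {r t X : ℕ} (h : Halting c l r t) (hX : 3 * Fintype.card V ^ 2 ≤ X)
    (hr : r + 1 ≤ X) (x : V) (i : Fin (N.deg (r + 1) x)) :
    SmallMsg X (send (r + 1) (c x) (N.deg (r + 1) x) i) := by
  have hM := card_le_sq (V := V)
  refine smallMsg_send h.conv (fun y j hj => ?_) (fun y z v hv => ?_) hX hr x i
  · obtain ⟨j', hj', hlt⟩ := h.name_lt y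
    obtain rfl : j' = j := Option.some.inj (hj'.symm.trans hj)
    omega
  · obtain ⟨-, j, d, -, hd⟩ := offerTo_eq_some hv
    rw [h.active_eq] at hd
    simp at hd

theorem smallMsg_start [DecidableEq V] {X : ℕ} (hX : Fintype.card V ≤ X) (x : V)
    (i : Fin (N.deg 1 x)) : SmallMsg X (send 1 (states N l 0 x) (N.deg 1 x) i) := by
  refine ⟨fun j hj => ?_, fun v hv => ?_, fun p hp => ?_⟩
  · have hj' : (states N l 0 x).name = some j := hj
    rw [states_zero_name] at hj'
    split_ifs at hj'
    have := Option.some.inj hj'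
    omega
  · have hv' : offerTo N 1 (states N l 0) x (N.port 1 x i) = some v := by
      rw [← offer_eq_offerTo]
      exact hv
    obtain ⟨-, i', -, rfl⟩ := (offerTo_start N l _ _ _).1 hv'
    have := deg_le_card N 1 l
    have := i'.isLt
    omega
  · have hp' : (states N l 0 x).pkt = some p := hp
    rw [states_zero_pkt] at hp'
    simp at hp'

theorem size_le_length_encode {m : Msg} {t n : ℕ} (h : m.pkt = some ⟨t, .halt n⟩) :
    n.size ≤ (encode m).length := by
  unfold encode
  rw [h]
  simp only [encOption, encPacket, encBody, List.length_append, List.length_cons, length_encNat]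
  omega

end Size

/-! ### The network with a single node -/

section Single

theorem deg_eq_zero {V : Type u} [Subsingleton V] (N : DynamicNetwork V) (r : ℕ) (x : V) : N.deg r x = 0 := by
  by_contra h
  have hadj : (N.graph r).Adj x (N.port r x ⟨0, Nat.pos_of_ne_zero h⟩) :=
    (N.port r x ⟨0, Nat.pos_of_ne_zero h⟩).2
  exact hadj.ne (Subsingleton.elim _ _)

variable {V : Type u} [DecidableEq V] [Subsingleton V] (N : DynamicNetwork V) (l : V)

theorem states_succ_single {r : ℕ} {s : Node} (h : states N l r l = s) (hs : s.out = none) :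
    states N l (r + 1) l = finish (r + 2) (react (r + 2) s) := by
  subst h
  rw [states_succ N l r (fun x => by rw [Subsingleton.elim x l]; exact hs)]
  unfold absorbed
  rw [absorb_eq_self_of_isEmpty _ _ (deg_eq_zero N _ _)]

/-- There is nobody to talk to: round 1 leads directly to the common round, round 2 announces `halt
1` with stamp 3, and this takes effect at the end of round 3. -/
theorem states_three_out : (states N l 3 l).out = some 0 := by
  have h0 : states N l 0 l = leaderInit := by rw [states_zero, if_pos rfl]
  have h1 := states_succ_single N l h0 rfl
  have h2 := states_succ_single N l h1 rfl
  have h3 := states_succ_single N l h2 rfl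
  rw [h3]
  rfl

end Single

/-! ### Assembling termination and message bounds -/

theorem isMinimalNaming_of_name {V : Type u} [Fintype V] {c : V → Node} {id : V → ℕ}
    (hid : ∀ x, (c x).name = some (id x)) (hlt : ∀ x, id x < Fintype.card V)
    (hinj : ∀ x y i, (c x).name = some i → (c y).name = some i → x = y) :
    IsMinimalNaming id := by
  have h : Function.Injective id := fun x y hxy =>
    hinj x y (id x) (hid x) (by rw [hid y, hxy])
  refine ⟨h, ?_⟩
  have hbij : Function.Bijective fun x => (⟨id x, hlt x⟩ : Fin (Fintype.card V)) := by
    rw [Fintype.bijective_iff_injective_and_card]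
    exact ⟨fun x y hxy => h (congrArg Fin.val hxy), by simp⟩
  ext k
  constructor
  · rintro ⟨x, rfl⟩
    exact hlt x
  · intro hk
    obtain ⟨x, hx⟩ := hbij.2 ⟨k, hk⟩
    exact ⟨x, congrArg Fin.val hx⟩

section Main

variable {V : Type u} [Fintype V] [DecidableEq V] {N : DynamicNetwork V} {l : V}

theorem exists_terminated (hn : 2 ≤ Fintype.card V) {r₀ : ℕ}
    (hH : ∀ i < Fintype.card V, Halting (states N l (r₀ + i)) l (r₀ + i) (r₀ + 1)) :
    ∃ id : V → ℕ, IsMinimalNaming id ∧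
      ∀ x, ∀ r ≥ r₀ + Fintype.card V, (states N l r x).out = some (id x) := by
  have h := hH (Fintype.card V - 1) (by omega)
  have hlt := h.name_lt
  choose id hid hidlt using hlt
  refine ⟨id, isMinimalNaming_of_name hid hidlt h.name_inj, fun x r hr => ?_⟩
  have hout := h.terminate (by omega) x
  rw [hid] at hout
  exact states_of_terminated N l hout (by omega)

theorem smallMsg_of_sent (hn : 2 ≤ Fintype.card V) {r₀ : ℕ}
    (hr₀ : r₀ ≤ 14 * Fintype.card V ^ 3 + 1)
    (hrun : ∀ r, 1 ≤ r → r < r₀ → Running (states N l r) l r (14 * Fintype.card V ^ 3))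
    (hH : ∀ i < Fintype.card V, Halting (states N l (r₀ + i)) l (r₀ + i) (r₀ + 1))
    (hterm : ∀ x, ∀ r ≥ r₀ + Fintype.card V, (states N l r x).out ≠ none)
    {r : ℕ} {x : V} {i : Fin (N.deg (r + 1) x)} {m : Msg}
    (hm : Individual_Conversations.sent N (r + 1) (Individual_Conversations.config N l r) x i =
      some m) : SmallMsg (20 * Fintype.card V ^ 3) m := by
  obtain ⟨hout, rfl⟩ := sent_eq_some hm
  have h1 : Fintype.card V ≤ Fintype.card V ^ 3 := Nat.le_self_pow (by norm_num) _
  have h2 : Fintype.card V ^ 2 ≤ Fintype.card V ^ 3 :=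
    Nat.pow_le_pow_right (by omega) (by norm_num)
  have hr : r < r₀ + Fintype.card V := by
    by_contra h
    exact hterm x r (by omega) hout
  rcases Nat.eq_zero_or_pos r with rfl | hr1
  · exact smallMsg_start (by omega) x i
  · rcases lt_or_ge r r₀ with hlt | hge
    · exact (hrun r hr1 hlt).smallMsg (by omega) (by omega) x i
    · have := hH (r - r₀) (by omega)
      rw [Nat.add_sub_cancel' hge] at this
      exact this.smallMsg (by omega) (by omega) x i

theorem exists_sent_halt (hN : N.OneIntervalConnected) (hn : 2 ≤ Fintype.card V) {r t : ℕ}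
    (h : Halting (states N l r) l r t) :
    ∃ (x : V) (i : Fin (N.deg (r + 1) x)) (m : Msg),
      Individual_Conversations.sent N (r + 1) (Individual_Conversations.config N l r) x i =
        some m ∧ (Fintype.card V).size ≤ (encode m).length := by
  obtain ⟨k, hR, -⟩ := h.ctrl
  have hdeg := one_le_deg N (hN (r + 1) (by omega)) hn l
  exact ⟨l, ⟨0, hdeg⟩, _, sent_of_running (hR.running l) _,
    size_le_length_encode h.conv.leader_pkt_eq⟩

end Main

/-! ### From binary length to logarithms -/

theorem size_mul_log_two_le {X : ℕ} (hX : 0 < X) :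
    (X.size : ℝ) * Real.log 2 ≤ Real.log X + Real.log 2 := by
  have h1 : X.size - 1 < X.size := Nat.sub_lt (Nat.size_pos.2 hX) one_pos
  have h2 : (2 : ℝ) ^ (X.size - 1) ≤ X := by exact_mod_cast Nat.lt_size.1 h1
  have h3 := Real.log_le_log (by positivity) h2
  rw [Real.log_pow] at h3
  have h4 : ((X.size - 1 : ℕ) : ℝ) = X.size - 1 := by
    rw [Nat.cast_sub (Nat.size_pos.2 hX)]
    simp
  rw [h4] at h3
  linarith

theorem log_le_size (n : ℕ) : Real.log n ≤ n.size := by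
  rcases Nat.eq_zero_or_pos n with rfl | hn
  · simp
  · have h1 : (n : ℝ) ≤ 2 ^ n.size := by exact_mod_cast (Nat.lt_size_self n).le
    have h2 := Real.log_le_log (by exact_mod_cast hn) h1
    rw [Real.log_pow] at h2
    have h3 : Real.log 2 ≤ 1 := by linarith [Real.log_two_lt_d9]
    nlinarith [(Nat.cast_nonneg n.size : (0 : ℝ) ≤ n.size)]

/-- Since n ≥ 2, 20n³ ≤ 32n³ ≤ n⁸, so its binary length times log 2 is at most 8 log n + log 2. Ten
times this plus 12 log 2 is at most (80 + 22) log n, whence the 102. -/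
theorem length_encode_le_log {n : ℕ} (hn : 2 ≤ n) {m : Msg} (h : SmallMsg (20 * n ^ 3) m) :
    ((encode m).length : ℝ) ≤ 102 / Real.log 2 * Real.log n := by
  have hlog2 : 0 < Real.log 2 := Real.log_pos (by norm_num)
  have h1 : ((encode m).length : ℝ) ≤ 10 * ((20 * n ^ 3).size : ℝ) + 12 := by
    exact_mod_cast length_encode_le h
  have h2 := size_mul_log_two_le (X := 20 * n ^ 3) (by positivity)
  have h3 : 20 * n ^ 3 ≤ n ^ 8 := by
    have : 2 ^ 5 ≤ n ^ 5 := Nat.pow_le_pow_left hn 5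
    nlinarith [Nat.zero_le (n ^ 3)]
  have h4 : Real.log ((20 * n ^ 3 : ℕ) : ℝ) ≤ 8 * Real.log n := by
    have h5 : ((20 * n ^ 3 : ℕ) : ℝ) ≤ (n : ℝ) ^ 8 := by exact_mod_cast h3
    have h6 := Real.log_le_log (by exact_mod_cast (by positivity : 0 < 20 * n ^ 3)) h5
    rw [Real.log_pow] at h6
    exact_mod_cast h6
  have h5 : Real.log 2 ≤ Real.log n := Real.log_le_log (by norm_num) (by exact_mod_cast hn)
  rw [div_mul_eq_mul_div, le_div_iff₀ hlog2]
  nlinarith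

end IndividualConversations

theorem theorem7 :
    ∃ (T : ℕ) (c C : ℝ), 0 < c ∧ 0 < C ∧
      ∀ (V : Type u) [Fintype V] [DecidableEq V] (N : DynamicNetwork V) (l : V),
        N.OneIntervalConnected →
        -- all nodes terminate within `T * n ^ 3` rounds, and their outputs are a minimal naming
        (∃ id : V → ℕ, IsMinimalNaming id ∧
          ∀ x, ∀ r ≥ T * Fintype.card V ^ 3,
            Individual_Conversations.output (Individual_Conversations.config N l r x)
              = some (id x)) ∧
        -- every message that is ever sent has at most `C * log n` bits
        (∀ (r : ℕ) (x : V) (i : Fin (N.deg (r + 1) x)) (m : Individual_Conversations.Msg),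
          Individual_Conversations.sent N (r + 1) (Individual_Conversations.config N l r) x i
              = some m →
            ((Individual_Conversations.encode m).length : ℝ) ≤ C * Real.log (Fintype.card V)) ∧
        -- if there are at least two nodes, a message of at least `c * log n` bits is sent
        (2 ≤ Fintype.card V →
          ∃ (r : ℕ) (x : V) (i : Fin (N.deg (r + 1) x)) (m : Individual_Conversations.Msg),
            Individual_Conversations.sent N (r + 1) (Individual_Conversations.config N l r) x i
              = some m ∧
            c * Real.log (Fintype.card V) ≤ ((Individual_Conversations.encode m).length : ℝ)) := by
  -- For n ≥ 2 all nodes have stopped by round 14n³ + 1 + n ≤ 20n³; for n = 1 they have by round 3.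
  refine ⟨20, 1, 102 / Real.log 2, one_pos, div_pos (by norm_num) (Real.log_pos (by norm_num)),
    fun V _ _ N l hN => ?_⟩
  have hpos : 0 < Fintype.card V := Fintype.card_pos_iff.2 ⟨l⟩
  have h1 : Fintype.card V ≤ Fintype.card V ^ 3 := Nat.le_self_pow (by norm_num) _
  rcases Nat.lt_or_ge (Fintype.card V) 2 with hlt | hn
  · have hone : Fintype.card V = 1 := by omega
    have : Subsingleton V := Fintype.card_le_one_iff_subsingleton.1 hone.le
    refine ⟨⟨fun _ => 0, ⟨fun x y _ => Subsingleton.elim x y, ?_⟩, fun x r hr => ?_⟩, ?_, by omega⟩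
    · ext k
      rw [hone]
      simp only [Set.mem_range, Set.mem_ofPred_eq, Nat.lt_one_iff]
      exact ⟨fun ⟨_, h⟩ => h.symm, fun h => ⟨l, h.symm⟩⟩
    · rw [Subsingleton.elim x l]
      exact IndividualConversations.states_of_terminated N l (IndividualConversations.states_three_out N l) (by omega)
    -- A single node has no edges, hence sends nothing; here log n = 0 leaves no room for any
    -- message.
    · intro r x i
      have h := i.isLt
      have h' := IndividualConversations.deg_eq_zero N (r + 1) x
      omega
  · obtain ⟨r₀, hr₀, hrun, hH⟩ := IndividualConversations.exists_announcement N l hN hn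
    obtain ⟨id, hid, hterm⟩ := IndividualConversations.exists_terminated hn hH
    refine ⟨⟨id, hid, fun x r hr => hterm x r (by omega)⟩, fun r x i m hm => ?_, fun _ => ?_⟩
    · exact IndividualConversations.length_encode_le_log hn
        (IndividualConversations.smallMsg_of_sent hn hr₀ hrun hH (fun x r hr => by rw [hterm x r hr]; simp) hm)
    · obtain ⟨x, i, m, hm, hlen⟩ := IndividualConversations.exists_sent_halt hN hn (hH 0 hpos)
      refine ⟨r₀ + 0, x, i, m, hm, ?_⟩
      rw [one_mul]
      exact (IndividualConversations.log_le_size _).trans (by exact_mod_cast hlen)
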